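/- Let $(\mathcal C,\otimes,1_\otimes)$ be a symmetric monoidal category with all small limits; write $\star_{\mathcal C}$ for its final object. Notation. Let $\Sigma_*$ be the category of finite sets and bijections; a symmetric sequence is a functor $\Sigma_*\to\mathcal C$. Let $\Sigma_*^{\wr n}$ be the category of chains of maps of finite sets $S_0\leftarrow S_1\leftarrow\cdots\leftarrow S_n$ with $|S_0|=1$ (level trees with $n$ levels) and their isomorphisms. Let $\gamma^n:\Sigma_*^{\wr n}\to\Sigma_*$ be $S_\bullet\mapsto S_n$. For $1\le i\le n-1$ let $\partial^n_i:\Sigma_*^{\wr n}\to\Sigma_*^{\wr(n-1)}$ forget $S_i$ (composing the two adjacent maps), and for $0\le i\le n$ let $s^n_i:\Sigma_*^{\wr n}\to\Sigma_*^{\wr(n+1)}$ repeat $S_i$ (inserting an identity map); then $\gamma^{n-1}\partial^n_i=\gamma^n$ and $\gamma^{n+1}s^n_i=\gamma^n$. For symmetric sequences $A_1,\dots,A_n$ let $A_1\circledcirc\cdots\circledcirc A_n:\Sigma_*^{\wr n}\to\mathcal C$ be the functor $$S_\bullet\longmapsto\bigotimes_{0\le i<n}\ \bigotimes_{s\in S_i}A_{i+1}(f_i^{-1}(s)),\qquad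 f_i:S_{i+1}\to S_i ,$$ where the tensor products are unordered. Write $R_{\gamma^n}$ for right Kan extension along $\gamma^n$, let $A^{\hat\circ n}=R_{\gamma^n}(A^{\circledcirc n})$, and let $\iota_n:A^{\hat\circ n}\gamma^n\to A^{\circledcirc n}$ be the universal transformation. Let $\mathbb 1$ be the symmetric sequence with $\mathbb 1(T)=1_\otimes$ if $|T|=1$ and $\mathbb 1(T)=\star_{\mathcal C}$ otherwise. Let $\mathcal O$ be a symmetric sequence with natural transformations $\tilde\Delta:\mathcal O\gamma^2\to\mathcal O\circledcirc\mathcal O$ and $\tilde\epsilon:\mathcal O\to\mathbb 1$. Let $\tilde\Delta^n_i:\mathcal O^{\circledcirc(n-1)}\partial^n_i\to\mathcal O^{\circledcirc n}$ ($1\le i\le n-1$) apply $\tilde\Delta$ at every vertex $s\in S_{i-1}$ and the identity at all other vertices, and let $\tilde\epsilon^n_i:\mathcal O^{\circledcirc(n+1)}s^n_i\to\mathcal O^{\circledcirc n}$ ($0\le i\le n$) apply $\tilde\epsilon$ at every vertex of height $i$ and the identity at all other vertices. Then $(\mathcal O,\tilde\Delta,\tilde\epsilon)$ is a counital cooperad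 if the two composites $$\mathcal O\gamma^3=\mathcal O\gamma^2\partial^3_i\xrightarrow{\tilde\Delta\,\partial^3_i}(\mathcal O\circledcirc\mathcal O)\,\partial^3_i\xrightarrow{\tilde\Delta^3_i}\mathcal O\circledcirc\mathcal O\circledcirc\mathcal O\qquad(i=1,2)$$ agree, and the two composites $$\mathcal O\gamma^1=\mathcal O\gamma^2s^1_i\xrightarrow{\tilde\Delta\,s^1_i}(\mathcal O\circledcirc\mathcal O)\,s^1_i\xrightarrow{\tilde\epsilon^1_i}\mathcal O^{\circledcirc 1}\qquad(i=0,1)$$ are the canonical identification of $\mathcal O\gamma^1$ with $\mathcal O^{\circledcirc 1}$. Define the coface maps $\Delta^n_i:\mathcal O^{\hat\circ(n-1)}\to\mathcal O^{\hat\circ n}$ ($1\le i\le n-1$) and the codegeneracy maps $\epsilon^n_i:\mathcal O^{\hat\circ(n+1)}\to\mathcal O^{\hat\circ n}$ ($0\le i\le n$) as the composites $$\mathcal O^{\hat\circ(n-1)}\to R_{\gamma^n}\bigl(\mathcal O^{\circledcirc(n-1)}\partial^n_i\bigr)\xrightarrow{R_{\gamma^n}(\tilde\Delta^n_i)}\mathcal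 O^{\hat\circ n},\qquad \mathcal O^{\hat\circ(n+1)}\to R_{\gamma^n}\bigl(\mathcal O^{\circledcirc(n+1)}s^n_i\bigr)\xrightarrow{R_{\gamma^n}(\tilde\epsilon^n_i)}\mathcal O^{\hat\circ n},$$ in which the first maps are induced by $\iota_{n-1}\partial^n_i$ and $\iota_{n+1}s^n_i$. Theorem. Let $(\mathcal O,\tilde\Delta,\tilde\epsilon)$ be a counital cooperad. Then the symmetric sequences $\mathcal O^{\hat\circ n}$, $n\ge1$, with the cofaces $\Delta^n_i$ and the codegeneracies $\epsilon^n_i$ ($n\ge1$) form a coaugmented cosimplicial symmetric sequence with two extra codegeneracies, $$\mathcal O\to\mathcal O\,\hat\circ\,\mathcal O\rightrightarrows\mathcal O^{\hat\circ3}\cdots ;$$ that is, whenever the maps are defined, * $\Delta^{n+1}_j\Delta^n_i=\Delta^{n+1}_i\Delta^n_{j-1}$ for $j>i$; * $\epsilon^{n-1}_i\epsilon^n_j=\epsilon^{n-1}_{j-1}\epsilon^n_i$ for $j>i$; * $\epsilon^n_j\Delta^{n+1}_i=\mathrm{id}$ for $j=i-1,i$; $\ \epsilon^n_j\Delta^{n+1}_i=\Delta^n_{i-1}\epsilon^{n-1}_j$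 for $j<i-1$; $\ \epsilon^n_j\Delta^{n+1}_i=\Delta^n_i\epsilon^{n-1}_{j-1}$ for $j>i$. Moreover the canonical map $\mathcal O\to\mathcal O^{\hat\circ1}$ is an isomorphism, and composed with $\Delta^2_1$ it is the map $\mathcal O\to\mathcal O\,\hat\circ\,\mathcal O$ corresponding to $\tilde\Delta$; $\Delta^n_i$ is the only map with $\iota_n\circ(\Delta^n_i\gamma^n)=\tilde\Delta^n_i\circ(\iota_{n-1}\partial^n_i)$, and $\epsilon^n_i$ is the only map with $\iota_n\circ(\epsilon^n_i\gamma^n)=\tilde\epsilon^n_i\circ(\iota_{n+1}s^n_i)$. -/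

import Mathlib

open CategoryTheory MonoidalCategory Limits

universe v u

set_option linter.unusedSectionVars false

noncomputable section

namespace WreathCooperad

section UnorderedTensor

variable {C : Type u} [Category.{v} C] [MonoidalCategory C]

/-- The tensor product of a family along a list of indices, bracketed to the right. -/
def listTensor {ι : Type} (X : ι → C) : List ι → C
  | [] => 𝟙_ C
  | a :: l => X a ⊗ listTensor X l

/-- Ways of rearranging a list by adjacent transpositions. -/
inductive Rearr {ι : Type} : List ι → List ι → Type
  | nil : Rearr [] []
  | cons (a : ι) {l l' : List ι} (p : Rearr l l') : Rearr (a :: l) (a :: l')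
  | swap (a b : ι) (l : List ι) : Rearr (a :: b :: l) (b :: a :: l)
  | trans {l l' l'' : List ι} (p : Rearr l l') (q : Rearr l' l'') : Rearr l l''

namespace Rearr

variable {ι κ : Type}

def refl : (l : List ι) → Rearr l l
  | [] => nil
  | a :: l => cons a (refl l)

def symm : {l l' : List ι} → Rearr l l' → Rearr l' l
  | _, _, nil => nil
  | _, _, cons a p => cons a p.symm
  | _, _, swap a b l => swap b a l
  | _, _, trans p q => trans q.symm p.symm

def map (e : ι → κ) : {l l' : List ι} → Rearr l l' → Rearr (l.map e) (l'.map e)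
  | _, _, nil => nil
  | _, _, cons a p => cons (e a) (p.map e)
  | _, _, swap a b l => swap (e a) (e b) (l.map e)
  | _, _, trans p q => trans (p.map e) (q.map e)

theorem perm {l l' : List ι} (p : Rearr l l') : l.Perm l' := by
  induction p with
  | nil => exact .nil
  | cons a _ ih => exact ih.cons a
  | swap a b l => exact .swap b a l
  | trans _ _ ih₁ ih₂ => exact ih₁.trans ih₂

theorem nonempty_of_perm {l l' : List ι} (h : l.Perm l') : Nonempty (Rearr l l') := by
  induction h with
  | nil => exact ⟨nil⟩
  | cons a _ ih => exact ih.map (cons a)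
  | swap a b l => exact ⟨swap b a l⟩
  | trans _ _ ih₁ ih₂ => exact ⟨trans ih₁.some ih₂.some⟩

end Rearr

variable [SymmetricCategory C]

/-- Exchange of the first two factors by the symmetry of `C`. -/
def swapHom (A B Z : C) : A ⊗ (B ⊗ Z) ⟶ B ⊗ (A ⊗ Z) :=
  (α_ A B Z).inv ≫ (β_ A B).hom ▷ Z ≫ (α_ B A Z).hom

theorem swapHom_swapHom (A B Z : C) : swapHom A B Z ≫ swapHom B A Z = 𝟙 _ := by
  simp [swapHom, ← comp_whiskerRight_assoc]

theorem swapHom_naturality {A A' B B' Z Z' : C} (f : A ⟶ A') (g : B ⟶ B') (h : Z ⟶ Z') :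
    (f ⊗ₘ (g ⊗ₘ h)) ≫ swapHom A' B' Z' = swapHom A B Z ≫ (g ⊗ₘ (f ⊗ₘ h)) := by
  simp only [swapHom, Category.assoc]
  rw [associator_inv_naturality_assoc, ← tensorHom_id, ← tensorHom_id,
    tensorHom_comp_tensorHom_assoc, BraidedCategory.braiding_naturality, Category.comp_id,
    ← associator_naturality, tensorHom_comp_tensorHom_assoc, Category.id_comp]

theorem swapHom_tensor_right (A B B' Z : C) :
    swapHom A (B ⊗ B') Z = (A ◁ (α_ B B' Z).hom) ≫ swapHom A B (B' ⊗ Z) ≫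
      B ◁ swapHom A B' Z ≫ (α_ B B' (A ⊗ Z)).inv := by
  simp [swapHom]

theorem swapHom_tensor_left (A A' B Z : C) :
    swapHom (A ⊗ A') B Z = (α_ A A' (B ⊗ Z)).hom ≫ A ◁ swapHom A' B Z ≫ swapHom A B (A' ⊗ Z) ≫
      B ◁ (α_ A A' Z).inv := by
  simp [swapHom]

theorem swapHom_yangBaxter (A B D Z : C) :
    swapHom A B (D ⊗ Z) ≫ B ◁ swapHom A D Z ≫ swapHom B D (A ⊗ Z) =
      A ◁ swapHom B D Z ≫ swapHom A D (B ⊗ Z) ≫ D ◁ swapHom A B Z := by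
  have h := swapHom_naturality (𝟙 A) (β_ B D).hom (𝟙 Z)
  rw [swapHom_tensor_right, swapHom_tensor_right] at h
  have h' := congrArg (fun t => A ◁ (α_ B D Z).inv ≫ t ≫ (α_ D B (A ⊗ Z)).hom) h
  simp only [Category.assoc, Iso.inv_hom_id, Category.comp_id, id_tensorHom, tensorHom_id,
    id_whiskerRight, whiskerLeft_inv_hom_assoc] at h'
  rw [show swapHom B D (A ⊗ Z) = (α_ B D (A ⊗ Z)).inv ≫ (β_ B D).hom ▷ (A ⊗ Z) ≫
    (α_ D B (A ⊗ Z)).hom from rfl, ← h']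
  simp [swapHom]

variable {ι κ μ : Type}

/-- The canonical map between the tensor products along two rearranged lists. -/
def Rearr.eval (X : ι → C) : {l l' : List ι} → Rearr l l' → (listTensor X l ⟶ listTensor X l')
  | _, _, .nil => 𝟙 _
  | _, _, .cons a p => X a ◁ p.eval X
  | _, _, .swap a b l => swapHom (X a) (X b) (listTensor X l)
  | _, _, .trans p q => p.eval X ≫ q.eval X

theorem Rearr.eval_refl (X : ι → C) (l : List ι) : (Rearr.refl l).eval X = 𝟙 _ := by
  induction l with
  | nil => rfl
  | cons a l ih => simp only [Rearr.refl, Rearr.eval, ih, whiskerLeft_id]; rfl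

theorem Rearr.eval_symm (X : ι → C) {l l' : List ι} (p : Rearr l l') :
    p.eval X ≫ p.symm.eval X = 𝟙 _ ∧ p.symm.eval X ≫ p.eval X = 𝟙 _ := by
  induction p with
  | nil => exact ⟨Category.comp_id _, Category.comp_id _⟩
  | cons a p ih =>
    dsimp only [Rearr.symm, Rearr.eval, listTensor]
    simp only [← whiskerLeft_comp, ih.1, ih.2, whiskerLeft_id, and_self]
  | swap a b l => exact ⟨swapHom_swapHom _ _ _, swapHom_swapHom _ _ _⟩
  | trans p q ihp ihq =>
    dsimp only [Rearr.symm, Rearr.eval]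
    simp only [Category.assoc]
    constructor
    · rw [← Category.assoc (q.eval X), ihq.1, Category.id_comp, ihp.1]
    · rw [← Category.assoc (p.symm.eval X), ihp.2, Category.id_comp, ihq.2]

/-- `Ins a l m`: the list `m` arises from `l` by inserting `a`. -/
inductive Ins (a : ι) : List ι → List ι → Type
  | here (l : List ι) : Ins a l (a :: l)
  | there (b : ι) {l m : List ι} (i : Ins a l m) : Ins a (b :: l) (b :: m)

theorem Ins.mem {a : ι} {l m : List ι} (i : Ins a l m) : a ∈ m := by
  induction i with
  | here l => exact List.mem_cons_self
  | there b _ ih => exact List.mem_cons_of_mem _ ih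

theorem Ins.nonempty_of_mem {a : ι} {m : List ι} (h : a ∈ m) : ∃ l, Nonempty (Ins a l m) := by
  induction m with
  | nil => exact absurd h List.not_mem_nil
  | cons b m ih =>
    rcases List.mem_cons.1 h with rfl | h
    · exact ⟨m, ⟨.here m⟩⟩
    · obtain ⟨l, ⟨i⟩⟩ := ih h
      exact ⟨b :: l, ⟨.there b i⟩⟩

/-- Moving the inserted factor to the front. -/
def Ins.pull (X : ι → C) {a : ι} : {l m : List ι} → Ins a l m →
    (listTensor X m ⟶ X a ⊗ listTensor X l)
  | _, _, .here _ => 𝟙 _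
  | _, _, .there b i => X b ◁ i.pull X ≫ swapHom (X b) (X a) _

theorem swapHom_isIso (A B Z : C) : IsIso (swapHom A B Z) :=
  ⟨_, swapHom_swapHom _ _ _, swapHom_swapHom _ _ _⟩

theorem Ins.pull_isIso (X : ι → C) {a : ι} {l m : List ι} (i : Ins a l m) :
    IsIso (i.pull X) := by
  induction i with
  | here l => exact inferInstanceAs (IsIso (𝟙 _))
  | @there b l m i ih =>
    have := swapHom_isIso (X b) (X a) (listTensor X l)
    exact inferInstanceAs (IsIso (X b ◁ i.pull X ≫ swapHom (X b) (X a) _))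

theorem swapHom_pull (A B D : C) {P Q : C} (f : P ⟶ A ⊗ Q) :
    swapHom B D P ≫ D ◁ (B ◁ f ≫ swapHom B A Q) ≫ swapHom D A (B ⊗ Q) =
      (B ◁ (D ◁ f ≫ swapHom D A Q) ≫ swapHom B A (D ⊗ Q)) ≫ A ◁ swapHom B D Q := by
  have n := swapHom_naturality (𝟙 B) (𝟙 D) f
  simp only [id_tensorHom] at n
  simp only [whiskerLeft_comp, Category.assoc, ← swapHom_yangBaxter]
  rw [← Category.assoc, ← n, Category.assoc]

theorem Ins.unique {a : ι} {k k' l : List ι} (hl : l.Nodup) (i : Ins a k l) (i' : Ins a k' l) :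
    ∃ h : k = k', h ▸ i = i' := by
  induction i generalizing k' with
  | here l =>
    cases i' with
    | here => exact ⟨rfl, rfl⟩
    | there _ j' => exact absurd j'.mem (List.nodup_cons.1 hl).1
  | there b j ih =>
    cases i' with
    | here => exact absurd j.mem (List.nodup_cons.1 hl).1
    | there _ j' =>
      obtain ⟨h, h'⟩ := ih (List.nodup_cons.1 hl).2 j'
      subst h
      exact ⟨rfl, congrArg (Ins.there b) h'⟩

theorem Rearr.exists_pull (X : ι → C) {l l' : List ι} (p : Rearr l l') (hl : l.Nodup) (a : ι)
    {k k' : List ι} (i : Ins a k l) (i' : Ins a k' l') :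
    ∃ q : Rearr k k', p.eval X ≫ i'.pull X = i.pull X ≫ X a ◁ q.eval X := by
  induction p generalizing k k' with
  | nil => cases i
  | cons b p ih =>
    cases i with
    | here =>
      cases i' with
      | here => exact ⟨p, (Category.comp_id _).trans (Category.id_comp _).symm⟩
      | there _ j' => exact absurd (p.perm.mem_iff.2 j'.mem) (List.nodup_cons.1 hl).1
    | there _ j =>
      cases i' with
      | here => exact absurd j.mem (List.nodup_cons.1 hl).1
      | there _ j' =>
        obtain ⟨q, hq⟩ := ih (List.nodup_cons.1 hl).2 j j'
        refine ⟨.cons b q, ?_⟩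
        have := swapHom_naturality (𝟙 (X b)) (𝟙 (X a)) (q.eval X)
        simp only [id_tensorHom] at this
        dsimp only [Rearr.eval, Ins.pull, listTensor]
        simp only [Category.assoc, ← this]
        simp only [← whiskerLeft_comp_assoc, hq]
  | swap x y l =>
    cases i with
    | here =>
      cases i' with
      | here => simp at hl
      | there _ j' =>
        cases j' with
        | here =>
          refine ⟨Rearr.refl _, ?_⟩
          dsimp only [Rearr.eval, Ins.pull, listTensor]
          rw [Rearr.eval_refl]
          dsimp only [listTensor]
          simp [swapHom_swapHom]
        | there _ j' => simp [j'.mem] at hl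
    | there _ j =>
      cases j with
      | here =>
        cases i' with
        | here =>
          refine ⟨Rearr.refl _, ?_⟩
          dsimp only [Rearr.eval, Ins.pull, listTensor]
          rw [Rearr.eval_refl]
          dsimp only [listTensor]
          simp
        | there _ j' =>
          cases j' with
          | here => simp at hl
          | there _ j' => simp [j'.mem] at hl
      | there _ j =>
        cases i' with
        | here => simp [j.mem] at hl
        | there _ j' =>
          cases j' with
          | here => simp [j.mem] at hl
          | there _ j' =>
            obtain ⟨rfl, rfl⟩ := Ins.unique (List.nodup_cons.1 (List.nodup_cons.1 hl).2).2 j j'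
            exact ⟨.swap x y _, swapHom_pull (X a) (X x) (X y) (j.pull X)⟩
  | trans p q ihp ihq =>
    obtain ⟨k'', ⟨i''⟩⟩ := Ins.nonempty_of_mem (p.perm.mem_iff.1 i.mem)
    obtain ⟨r, hr⟩ := ihp hl i i''
    obtain ⟨s, hs⟩ := ihq (p.perm.nodup_iff.1 hl) i'' i'
    refine ⟨.trans r s, ?_⟩
    dsimp only [Rearr.eval]
    simp only [Category.assoc, hs, whiskerLeft_comp]
    rw [← Category.assoc, hr, Category.assoc]

/-- Coherence: between two repetition-free lists there is only one canonical map. -/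
theorem Rearr.eval_eq (X : ι → C) {l l' : List ι} (hl : l.Nodup) (p q : Rearr l l') :
    p.eval X = q.eval X := by
  induction l generalizing l' with
  | nil =>
    obtain rfl : l' = [] := p.perm.nil_eq.symm
    have key : ∀ {k k' : List ι} (r : Rearr k k') (hk : k = []) (hk' : k' = []),
        r.eval X = eqToHom (by rw [hk, hk']) := by
      intro k k' r
      induction r with
      | nil => intros; rfl
      | cons a p ih => intro h; cases h
      | swap a b l => intro h; cases h
      | trans p q ihp ihq =>
        intro hk hk'
        have hm := List.perm_nil.1 (hk' ▸ q.perm)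
        dsimp only [Rearr.eval]
        rw [ihp hk hm, ihq hm hk', eqToHom_trans]
    rw [key p rfl rfl, key q rfl rfl]
  | cons a l ih =>
    obtain ⟨k', ⟨i'⟩⟩ := Ins.nonempty_of_mem (p.perm.mem_iff.1 (List.mem_cons_self (a := a)))
    obtain ⟨r, hr⟩ := p.exists_pull X hl a (.here l) i'
    obtain ⟨s, hs⟩ := q.exists_pull X hl a (.here l) i'
    have := i'.pull_isIso X
    rw [← cancel_mono (i'.pull X), hr, hs, ih (List.nodup_cons.1 hl).2 r s]

/-- A list in which every element of `ι` occurs exactly once. -/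
def IsEnum (l : List ι) : Prop := l.Nodup ∧ ∀ a, a ∈ l

theorem IsEnum.perm {l l' : List ι} (h : IsEnum l) (h' : IsEnum l') : l.Perm l' :=
  (List.perm_ext_iff_of_nodup h.1 h'.1).2 fun a => iff_of_true (h.2 a) (h'.2 a)

theorem IsEnum.map {l : List ι} (h : IsEnum l) {e : ι → κ} (he : Function.Bijective e) :
    IsEnum (l.map e) :=
  ⟨h.1.map he.1, fun b => by
    obtain ⟨a, rfl⟩ := he.2 b
    exact List.mem_map_of_mem (h.2 a)⟩

theorem exists_isEnum (ι : Type) [Finite ι] : ∃ l : List ι, IsEnum l := by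
  have := Fintype.ofFinite ι
  exact ⟨Finset.univ.toList, Finset.nodup_toList _, by simp⟩

/-- A chosen enumeration of a finite set. -/
def enum (ι : Type) [Finite ι] : List ι := (exists_isEnum ι).choose

theorem isEnum_enum (ι : Type) [Finite ι] : IsEnum (enum ι) := (exists_isEnum ι).choose_spec

/-- The unordered tensor product `⨂_{i ∈ ι} X i` of a finite family of objects. -/
abbrev unTensor [Finite ι] (X : ι → C) : C := listTensor X (enum ι)

/-- The canonical isomorphism from the tensor product along an arbitrary enumeration to the
unordered tensor product. -/
def ins [Finite ι] (X : ι → C) (l : List ι) (hl : IsEnum l) : listTensor X l ⟶ unTensor X :=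
  (Rearr.nonempty_of_perm (hl.perm (isEnum_enum ι))).some.eval X

theorem eval_ins [Finite ι] (X : ι → C) {l l' : List ι} (hl : IsEnum l) (hl' : IsEnum l')
    (p : Rearr l l') : p.eval X ≫ ins X l' hl' = ins X l hl :=
  Rearr.eval_eq X hl.1
    (p.trans (Rearr.nonempty_of_perm (hl'.perm (isEnum_enum ι))).some) _

theorem ins_enum [Finite ι] (X : ι → C) : ins X (enum ι) (isEnum_enum ι) = 𝟙 _ :=
  (Rearr.eval_eq X (isEnum_enum ι).1 _ (Rearr.refl _)).trans (Rearr.eval_refl X _)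

theorem Rearr.eval_isIso (X : ι → C) {l l' : List ι} (p : Rearr l l') : IsIso (p.eval X) :=
  ⟨_, (p.eval_symm X).1, (p.eval_symm X).2⟩

theorem ins_isIso [Finite ι] (X : ι → C) (l : List ι) (hl : IsEnum l) : IsIso (ins X l hl) :=
  Rearr.eval_isIso X _

/-- Tensor product of maps, reindexed along a map of index sets. -/
def listMap {X : ι → C} {Y : κ → C} (e : ι → κ) (g : ∀ i, X i ⟶ Y (e i)) :
    (l : List ι) → (listTensor X l ⟶ listTensor Y (l.map e))
  | [] => 𝟙 _
  | a :: l => g a ⊗ₘ listMap e g l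

theorem eval_listMap {X : ι → C} {Y : κ → C} (e : ι → κ) (g : ∀ i, X i ⟶ Y (e i))
    {l l' : List ι} (p : Rearr l l') :
    p.eval X ≫ listMap e g l' = listMap e g l ≫ (p.map e).eval Y := by
  induction p with
  | nil => rfl
  | cons a p ih =>
    dsimp only [Rearr.eval, Rearr.map, listMap, listTensor, List.map]
    rw [whiskerLeft_comp_tensorHom, tensorHom_comp_whiskerLeft, ih]
  | swap a b l => exact (swapHom_naturality (g a) (g b) (listMap e g l)).symm
  | trans p q ihp ihq =>
    dsimp only [Rearr.eval, Rearr.map]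
    rw [Category.assoc, ihq, ← Category.assoc, ihp, Category.assoc]

/-- Functoriality of the unordered tensor product in bijections of index sets and maps of the
factors. -/
def unMap [Finite ι] [Finite κ] {X : ι → C} {Y : κ → C} (e : ι → κ) (he : Function.Bijective e)
    (g : ∀ i, X i ⟶ Y (e i)) : unTensor X ⟶ unTensor Y :=
  listMap e g (enum ι) ≫ ins Y ((enum ι).map e) ((isEnum_enum ι).map he)

theorem ins_unMap [Finite ι] [Finite κ] {X : ι → C} {Y : κ → C} (e : ι → κ)
    (he : Function.Bijective e) (g : ∀ i, X i ⟶ Y (e i)) (l : List ι) (hl : IsEnum l) :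
    ins X l hl ≫ unMap e he g = listMap e g l ≫ ins Y (l.map e) (hl.map he) := by
  rw [unMap, ins, ← Category.assoc, eval_listMap, Category.assoc, eval_ins]

def Rearr.mapId : (l : List ι) → Rearr (l.map id) l
  | [] => .nil
  | a :: l => .cons a (mapId l)

def Rearr.mapMap (e : ι → κ) (e' : κ → μ) : (l : List ι) → Rearr ((l.map e).map e') (l.map (e' ∘ e))
  | [] => .nil
  | a :: l => .cons (e' (e a)) (mapMap e e' l)

theorem listMap_id (X : ι → C) (l : List ι) :
    listMap id (fun i => 𝟙 (X i)) l ≫ (Rearr.mapId l).eval X = 𝟙 _ := by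
  induction l with
  | nil => exact Category.comp_id _
  | cons a l ih =>
    dsimp only [listMap, Rearr.mapId, Rearr.eval, listTensor, List.map, id]
    rw [tensorHom_comp_whiskerLeft, ih, id_tensorHom_id]

theorem listMap_comp {X : ι → C} {Y : κ → C} {Z : μ → C} (e : ι → κ) (e' : κ → μ)
    (g : ∀ i, X i ⟶ Y (e i)) (g' : ∀ i, Y i ⟶ Z (e' i)) (l : List ι) :
    listMap e g l ≫ listMap e' g' (l.map e) ≫ (Rearr.mapMap e e' l).eval Z =
      listMap (e' ∘ e) (fun i => g i ≫ g' (e i)) l := by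
  induction l with
  | nil => exact (Category.id_comp _).trans (Category.id_comp _)
  | cons a l ih =>
    dsimp only [listMap, Rearr.mapMap, Rearr.eval, listTensor, List.map, Function.comp]
    rw [tensorHom_comp_whiskerLeft, tensorHom_comp_tensorHom, ih]

theorem unMap_id [Finite ι] (X : ι → C) :
    unMap id Function.bijective_id (fun i => 𝟙 (X i)) = 𝟙 (unTensor X) := by
  rw [unMap, ← eval_ins X ((isEnum_enum ι).map Function.bijective_id) (isEnum_enum ι)
    (Rearr.mapId _), ← Category.assoc, listMap_id, ins_enum]
  exact Category.comp_id _

theorem unMap_comp [Finite ι] [Finite κ] [Finite μ] {X : ι → C} {Y : κ → C} {Z : μ → C}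
    (e : ι → κ) (he : Function.Bijective e) (e' : κ → μ) (he' : Function.Bijective e')
    (g : ∀ i, X i ⟶ Y (e i)) (g' : ∀ i, Y i ⟶ Z (e' i)) :
    unMap e he g ≫ unMap e' he' g' =
      unMap (Y := Z) (e' ∘ e) (he'.comp he) (fun i => g i ≫ g' (e i)) := by
  rw [unMap, Category.assoc, ins_unMap, unMap, ← listMap_comp, Category.assoc, Category.assoc,
    eval_ins]

theorem unMap_congr [Finite ι] [Finite κ] {X : ι → C} {Y : κ → C} {e e' : ι → κ}
    (he : Function.Bijective e) (he' : Function.Bijective e') (h : ∀ i, e i = e' i)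
    (g : ∀ i, X i ⟶ Y (e i)) (g' : ∀ i, X i ⟶ Y (e' i))
    (hg : ∀ i, g i ≫ eqToHom (congrArg Y (h i)) = g' i) : unMap e he g = unMap e' he' g' := by
  obtain rfl : e = e' := funext h
  congr 1
  funext i
  simpa using hg i

/-- Concatenation of tensor products. -/
def append (X : ι → C) : (l k : List ι) → (listTensor X l ⊗ listTensor X k ⟶ listTensor X (l ++ k))
  | [], k => (λ_ (listTensor X k)).hom
  | a :: l, k => (α_ (X a) (listTensor X l) (listTensor X k)).hom ≫ X a ◁ append X l k

def Rearr.appendRight (k : List ι) : {l l' : List ι} → Rearr l l' → Rearr (l ++ k) (l' ++ k)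
  | _, _, .nil => Rearr.refl k
  | _, _, .cons a p => .cons a (p.appendRight k)
  | _, _, .swap a b l => .swap a b (l ++ k)
  | _, _, .trans p q => .trans (p.appendRight k) (q.appendRight k)

def Rearr.appendLeft {k k' : List ι} (p : Rearr k k') : (l : List ι) → Rearr (l ++ k) (l ++ k')
  | [] => p
  | a :: l => .cons a (p.appendLeft l)

theorem swapHom_whiskerRight (A B L K W : C) (f : L ⊗ K ⟶ W) :
    swapHom A B L ▷ K ≫ ((α_ B (A ⊗ L) K).hom ≫ B ◁ ((α_ A L K).hom ≫ A ◁ f)) =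
      ((α_ A (B ⊗ L) K).hom ≫ A ◁ ((α_ B L K).hom ≫ B ◁ f)) ≫ swapHom A B W := by
  have := swapHom_naturality (𝟙 A) (𝟙 B) f
  simp only [id_tensorHom] at this
  simp only [whiskerLeft_comp, Category.assoc, this]
  simp [swapHom]

theorem append_appendRight (X : ι → C) (k : List ι) {l l' : List ι} (p : Rearr l l') :
    p.eval X ▷ listTensor X k ≫ append X l' k = append X l k ≫ (p.appendRight k).eval X := by
  induction p with
  | nil =>
    exact (by simp : 𝟙 (𝟙_ C) ▷ _ ≫ (λ_ (listTensor X k)).hom = (λ_ (listTensor X k)).hom ≫ 𝟙 _).trans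
      (congrArg ((λ_ (listTensor X k)).hom ≫ ·) (Rearr.eval_refl X k).symm)
  | cons a p ih =>
    dsimp only [Rearr.appendRight, Rearr.eval, append, listTensor, List.cons_append]
    rw [Category.assoc, ← whiskerLeft_comp, ← ih]
    simp
  | swap a b l => exact swapHom_whiskerRight _ _ _ _ _ (append X l k)
  | trans p q ihp ihq =>
    dsimp only [Rearr.appendRight, Rearr.eval]
    rw [comp_whiskerRight, Category.assoc, ihq, ← Category.assoc, ihp, Category.assoc]

theorem append_appendLeft (X : ι → C) {k k' : List ι} (p : Rearr k k') (l : List ι) :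
    listTensor X l ◁ p.eval X ≫ append X l k' = append X l k ≫ (p.appendLeft l).eval X := by
  induction l with
  | nil =>
    dsimp only [Rearr.appendLeft, append, listTensor]
    exact leftUnitor_naturality _
  | cons a l ih =>
    dsimp only [Rearr.appendLeft, Rearr.eval, append, listTensor, List.cons_append]
    rw [Category.assoc, ← whiskerLeft_comp, ← ih]
    simp

theorem moveFront_aux {A B K Z W V : C} (f : K ⊗ Z ⟶ W) (r : A ⊗ W ⟶ V) (g : K ⊗ (A ⊗ Z) ⟶ V)
    (h : A ◁ f ≫ r = swapHom A K Z ≫ g) :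
    A ◁ ((α_ B K Z).hom ≫ B ◁ f) ≫ (swapHom A B W ≫ B ◁ r) =
      swapHom A (B ⊗ K) Z ≫ ((α_ B K (A ⊗ Z)).hom ≫ B ◁ g) := by
  have n := swapHom_naturality (𝟙 A) (𝟙 B) f
  simp only [id_tensorHom] at n
  rw [whiskerLeft_comp, Category.assoc, ← Category.assoc (A ◁ B ◁ _), n, swapHom_tensor_right,
    Category.assoc, ← whiskerLeft_comp, h]
  simp

theorem moveFront_nil (A Z : C) :
    A ◁ (λ_ Z).hom ≫ 𝟙 (A ⊗ Z) = swapHom A (𝟙_ C) Z ≫ (λ_ (A ⊗ Z)).hom := by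
  simp [swapHom]

theorem exists_moveFront (X : ι → C) (x : ι) (k z : List ι) :
    ∃ r : Rearr (x :: (k ++ z)) (k ++ (x :: z)), X x ◁ append X k z ≫ r.eval X =
      swapHom (X x) (listTensor X k) (listTensor X z) ≫ append X k (x :: z) := by
  induction k with
  | nil =>
    exact ⟨Rearr.refl _, (congrArg (X x ◁ (λ_ (listTensor X z)).hom ≫ ·)
      (Rearr.eval_refl X (x :: z))).trans (moveFront_nil _ _)⟩
  | cons b k ih =>
    obtain ⟨r, hr⟩ := ih
    exact ⟨.trans (.swap x b (k ++ z)) (.cons b r), moveFront_aux _ _ _ hr⟩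

theorem blockSwap_aux {A L K Z KZ LKZ LZ KLZ V : C} (f : K ⊗ Z ⟶ KZ) (g : L ⊗ KZ ⟶ LKZ)
    (r : LKZ ⟶ KLZ) (f' : L ⊗ Z ⟶ LZ) (g' : K ⊗ LZ ⟶ KLZ) (q : A ⊗ KLZ ⟶ V)
    (g'' : K ⊗ (A ⊗ LZ) ⟶ V) (hr : (L ◁ f ≫ g) ≫ r = swapHom L K Z ≫ K ◁ f' ≫ g')
    (hq : A ◁ g' ≫ q = swapHom A K LZ ≫ g'') :
    ((A ⊗ L) ◁ f ≫ ((α_ A L KZ).hom ≫ A ◁ g)) ≫ (A ◁ r ≫ q) =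
      swapHom (A ⊗ L) K Z ≫ K ◁ ((α_ A L Z).hom ≫ A ◁ f') ≫ g'' := by
  have n := swapHom_naturality (𝟙 A) (𝟙 K) f'
  simp only [id_tensorHom] at n
  have hr' := congrArg (fun t => (α_ A L (K ⊗ Z)).hom ≫ A ◁ t ≫ q) hr
  simp only [whiskerLeft_comp, Category.assoc, hq] at hr'
  rw [← Category.assoc (A ◁ K ◁ f'), n] at hr'
  rw [swapHom_tensor_left]
  simp only [Category.assoc, whiskerLeft_comp, whiskerLeft_inv_hom_assoc]
  simp only [Category.assoc] at hr'
  rw [← hr']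
  simp

theorem exists_blockSwap (X : ι → C) (l k z : List ι) :
    ∃ r : Rearr (l ++ (k ++ z)) (k ++ (l ++ z)),
      (listTensor X l ◁ append X k z ≫ append X l (k ++ z)) ≫ r.eval X =
        swapHom (listTensor X l) (listTensor X k) (listTensor X z) ≫
          listTensor X k ◁ append X l z ≫ append X k (l ++ z) := by
  induction l with
  | nil =>
    exact ⟨Rearr.refl _, (congrArg ((𝟙_ C ◁ append X k z ≫ (λ_ (listTensor X (k ++ z))).hom) ≫ ·)
      (Rearr.eval_refl X (k ++ z))).trans (by dsimp only [append, listTensor]; simp [swapHom])⟩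
  | cons a l ih =>
    obtain ⟨r, hr⟩ := ih
    obtain ⟨q, hq⟩ := exists_moveFront X a k (l ++ z)
    exact ⟨.trans (.cons a r) q, blockSwap_aux _ _ _ _ _ _ _ hr hq⟩

variable {κ' : ι → Type}

/-- The concatenation of the lists `m i`, `i` in `l`. -/
def blocks (m : ∀ i, List (κ' i)) : List ι → List (Σ i, κ' i)
  | [] => []
  | a :: l => (m a).map (Sigma.mk a) ++ blocks m l

/-- An iterated tensor product is a tensor product over the concatenated list. -/
def flat (Y : ∀ i, κ' i → C) (m : ∀ i, List (κ' i)) : (l : List ι) →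
    (listTensor (fun i => listTensor (Y i) (m i)) l ⟶
      listTensor (fun p : Σ i, κ' i => Y p.1 p.2) (blocks m l))
  | [] => 𝟙 _
  | a :: l => (listMap (Sigma.mk a) (fun b => 𝟙 (Y a b)) (m a) ⊗ₘ flat Y m l) ≫
      append (fun p : Σ i, κ' i => Y p.1 p.2) _ _

theorem isEnum_blocks {m : ∀ i, List (κ' i)} (hm : ∀ i, IsEnum (m i)) {l : List ι}
    (hl : IsEnum l) : IsEnum (blocks m l) := by
  have mem : ∀ (l : List ι) (p : Σ i, κ' i), p ∈ blocks m l ↔ p.1 ∈ l := by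
    intro l p
    induction l with
    | nil => simp [blocks]
    | cons a l ih =>
      simp only [blocks, List.mem_append, List.mem_map, ih, List.mem_cons]
      refine or_congr ⟨?_, ?_⟩ Iff.rfl
      · rintro ⟨b, -, rfl⟩
        rfl
      · obtain ⟨i, b⟩ := p
        rintro rfl
        exact ⟨b, (hm _).2 b, rfl⟩
  refine ⟨?_, fun p => (mem l p).2 (hl.2 p.1)⟩
  have nd := hl.1
  clear hl
  induction l with
  | nil => exact List.nodup_nil
  | cons a l ih =>
    refine List.Nodup.append ((hm a).1.map sigma_mk_injective) (ih (List.nodup_cons.1 nd).2) ?_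
    intro p hp hp'
    obtain ⟨b, -, rfl⟩ := List.mem_map.1 hp
    exact (List.nodup_cons.1 nd).1 ((mem l _).1 hp')

theorem flat_swap_aux {A B Z A' B' Z' W₁ W₂ V₁ V₂ : C} (a : A ⟶ A') (b : B ⟶ B') (z : Z ⟶ Z')
    (f : B' ⊗ Z' ⟶ W₁) (g : A' ⊗ W₁ ⟶ V₁) (f' : A' ⊗ Z' ⟶ W₂) (g' : B' ⊗ W₂ ⟶ V₂) (r : V₁ ⟶ V₂)
    (hr : (A' ◁ f ≫ g) ≫ r = swapHom A' B' Z' ≫ B' ◁ f' ≫ g') :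
    swapHom A B Z ≫ ((b ⊗ₘ ((a ⊗ₘ z) ≫ f')) ≫ g') = ((a ⊗ₘ ((b ⊗ₘ z) ≫ f)) ≫ g) ≫ r := by
  have h₁ : b ⊗ₘ ((a ⊗ₘ z) ≫ f') = (b ⊗ₘ (a ⊗ₘ z)) ≫ B' ◁ f' := by
    rw [tensorHom_comp_whiskerLeft]
  have h₂ : a ⊗ₘ ((b ⊗ₘ z) ≫ f) = (a ⊗ₘ (b ⊗ₘ z)) ≫ A' ◁ f := by
    rw [tensorHom_comp_whiskerLeft]
  simp only [Category.assoc] at hr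
  rw [h₁, h₂]
  simp only [Category.assoc]
  rw [hr, ← Category.assoc, ← swapHom_naturality, Category.assoc]

theorem exists_flat_rearr (Y : ∀ i, κ' i → C) (m : ∀ i, List (κ' i)) {l l' : List ι}
    (p : Rearr l l') : ∃ q : Rearr (blocks m l) (blocks m l'),
      p.eval _ ≫ flat Y m l' = flat Y m l ≫ q.eval _ := by
  induction p with
  | nil => exact ⟨.nil, rfl⟩
  | cons a p ih =>
    obtain ⟨q, hq⟩ := ih
    refine ⟨q.appendLeft _, ?_⟩
    dsimp only [flat, blocks, Rearr.eval, listTensor]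
    rw [Category.assoc, ← append_appendLeft, whiskerLeft_comp_tensorHom_assoc, hq,
      tensorHom_comp_whiskerLeft_assoc]
  | swap a b l =>
    obtain ⟨r, hr⟩ := exists_blockSwap (fun p : Σ i, κ' i => Y p.1 p.2)
      ((m a).map (Sigma.mk a)) ((m b).map (Sigma.mk b)) (blocks m l)
    exact ⟨r, flat_swap_aux _ _ _ _ _ _ _ _ hr⟩
  | trans p q ihp ihq =>
    obtain ⟨r, hr⟩ := ihp
    obtain ⟨s, hs⟩ := ihq
    refine ⟨.trans r s, ?_⟩
    dsimp only [Rearr.eval]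
    rw [Category.assoc, hs, ← Category.assoc, hr, Category.assoc]

/-- Tensor product of maps along a fixed list. -/
def listHom {X X' : ι → C} (g : ∀ i, X i ⟶ X' i) : (l : List ι) → (listTensor X l ⟶ listTensor X' l)
  | [] => 𝟙 _
  | a :: l => g a ⊗ₘ listHom g l

theorem exists_flat_blocks (Y : ∀ i, κ' i → C) {m m' : ∀ i, List (κ' i)}
    (r : ∀ i, Rearr (m i) (m' i)) (l : List ι) : ∃ q : Rearr (blocks m l) (blocks m' l),
      listHom (fun i => (r i).eval (Y i)) l ≫ flat Y m' l = flat Y m l ≫ q.eval _ := by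
  induction l with
  | nil => exact ⟨.nil, rfl⟩
  | cons a l ih =>
    obtain ⟨q, hq⟩ := ih
    refine ⟨.trans (((r a).map (Sigma.mk a)).appendRight _) (q.appendLeft _), ?_⟩
    dsimp only [flat, blocks, Rearr.eval, listTensor, listHom]
    rw [Category.assoc, ← Category.assoc (append _ _ _), ← append_appendRight, Category.assoc,
      ← append_appendLeft, tensorHom_comp_tensorHom_assoc, hq, eval_listMap,
      tensorHom_comp_whiskerRight_assoc, tensorHom_comp_whiskerLeft_assoc]

theorem eval_listHom {X X' : ι → C} (g : ∀ i, X i ⟶ X' i) {l l' : List ι} (p : Rearr l l') :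
    p.eval X ≫ listHom g l' = listHom g l ≫ p.eval X' := by
  induction p with
  | nil => rfl
  | cons a p ih =>
    dsimp only [Rearr.eval, listHom, listTensor]
    rw [whiskerLeft_comp_tensorHom, tensorHom_comp_whiskerLeft, ih]
  | swap a b l => exact (swapHom_naturality (g a) (g b) (listHom g l)).symm
  | trans p q ihp ihq =>
    dsimp only [Rearr.eval]
    rw [Category.assoc, ihq, ← Category.assoc, ihp, Category.assoc]

/-- An iterated unordered tensor product is the unordered tensor product over the disjoint union of
the index sets. -/
def unSigma [Finite ι] [∀ i, Finite (κ' i)] (Y : ∀ i, κ' i → C) :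
    unTensor (fun i => unTensor (Y i)) ⟶ unTensor (fun p : Σ i, κ' i => Y p.1 p.2) :=
  flat Y (fun i => enum (κ' i)) (enum ι) ≫
    ins _ _ (isEnum_blocks (fun i => isEnum_enum (κ' i)) (isEnum_enum ι))

theorem ins_unSigma [Finite ι] [∀ i, Finite (κ' i)] (Y : ∀ i, κ' i → C) (l : List ι)
    (hl : IsEnum l) (m : ∀ i, List (κ' i)) (hm : ∀ i, IsEnum (m i)) :
    listHom (fun i => ins (Y i) (m i) (hm i)) l ≫ ins _ l hl ≫ unSigma Y =
      flat Y m l ≫ ins _ _ (isEnum_blocks hm hl) := by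
  obtain ⟨p, hp⟩ : ∃ p : Rearr l (enum ι), ∀ X : ι → C, ins X l hl = p.eval X := ⟨_, fun _ => rfl⟩
  obtain ⟨r, hr⟩ : ∃ r : ∀ i, Rearr (m i) (enum (κ' i)),
      ∀ i, ins (Y i) (m i) (hm i) = (r i).eval (Y i) := ⟨_, fun _ => rfl⟩
  obtain ⟨q, hq⟩ := exists_flat_rearr Y (fun i => enum (κ' i)) p
  obtain ⟨s, hs⟩ := exists_flat_blocks Y r l
  have he := isEnum_blocks (fun i => isEnum_enum (κ' i)) hl
  simp only [hp, hr]
  rw [unSigma, ← Category.assoc (p.eval _), hq, Category.assoc, eval_ins _ he, ← Category.assoc,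
    hs, Category.assoc, eval_ins]

def Rearr.mapAppend (e : ι → κ) (k : List ι) : (l : List ι) →
    Rearr ((l ++ k).map e) (l.map e ++ k.map e)
  | [] => Rearr.refl _
  | a :: l => .cons (e a) (mapAppend e k l)

theorem append_listMap {X : ι → C} {Y : κ → C} (e : ι → κ) (g : ∀ i, X i ⟶ Y (e i))
    (l k : List ι) :
    append X l k ≫ listMap e g (l ++ k) ≫ (Rearr.mapAppend e k l).eval Y =
      (listMap e g l ⊗ₘ listMap e g k) ≫ append Y (l.map e) (k.map e) := by
  induction l with
  | nil =>
    have h := Rearr.eval_refl Y (k.map e)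
    exact (congrArg (fun t => (λ_ _).hom ≫ listMap e g k ≫ t) h).trans
      (by simp : (λ_ _).hom ≫ listMap e g k ≫ 𝟙 _ = (𝟙 (𝟙_ C) ⊗ₘ listMap e g k) ≫ (λ_ _).hom)
  | cons a l ih =>
    have ih' := congrArg (fun t => (α_ (X a) (listTensor X l) (listTensor X k)).hom ≫ (g a ⊗ₘ t)) ih
    dsimp only [append, listMap, listTensor, List.map, List.cons_append, Rearr.mapAppend,
      Rearr.eval] at ih' ⊢
    rw [tensorHom_comp_whiskerLeft, Category.assoc, whiskerLeft_comp_tensorHom, ih',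
      ← tensorHom_comp_whiskerLeft, associator_naturality_assoc]

theorem flat_cons_aux {A B A' B' A₂ B₂ V P Q W W' W₂ P' Q' W₃ : C} (a : A ⟶ A') (b : B ⟶ B')
    (s : A' ⟶ A₂) (t : B' ⟶ B₂) (app₂ : A₂ ⊗ B₂ ⟶ V) (s₀ : A ⟶ P) (t₀ : B ⟶ Q)
    (app₀ : P ⊗ Q ⟶ W) (M : W ⟶ W') (ma : W' ⟶ W₂) (x : P ⟶ P') (y : Q ⟶ Q')
    (app₁ : P' ⊗ Q' ⟶ W₂) (r : P' ⟶ A₂) (q : Q' ⟶ B₂) (R : W₂ ⟶ W₃) (S : W₃ ⟶ V)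
    (app' : A₂ ⊗ Q' ⟶ W₃) (h : app₀ ≫ M ≫ ma = (x ⊗ₘ y) ≫ app₁)
    (h₁ : r ▷ Q' ≫ app' = app₁ ≫ R) (h₂ : A₂ ◁ q ≫ app₂ = app' ≫ S)
    (hr : s₀ ≫ x ≫ r = a ≫ s) (hq : b ≫ t = t₀ ≫ y ≫ q) :
    (a ⊗ₘ b) ≫ ((s ⊗ₘ t) ≫ app₂) = ((s₀ ⊗ₘ t₀) ≫ app₀) ≫ M ≫ (ma ≫ (R ≫ S)) := by
  have h' := congrArg (fun z => (s₀ ⊗ₘ t₀) ≫ z ≫ R ≫ S) h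
  simp only [Category.assoc] at h' ⊢
  rw [h', ← Category.assoc app₁, ← h₁, Category.assoc, ← h₂, tensorHom_comp_tensorHom_assoc,
    tensorHom_comp_tensorHom_assoc, tensorHom_comp_whiskerRight_assoc,
    tensorHom_comp_whiskerLeft_assoc, Category.assoc, Category.assoc, hr, hq]

theorem exists_map_mk {κ'' : ι → Type} {Y : ∀ i, κ' i → C} {Y' : ∀ i, κ'' i → C}
    (e : ∀ i, κ' i → κ'' i) (g : ∀ i b, Y i b ⟶ Y' i (e i b)) (a : ι) (k : List (κ' a)) :
    ∃ q : Rearr ((k.map (Sigma.mk a)).map (fun p => ⟨p.1, e p.1 p.2⟩)) ((k.map (e a)).map (Sigma.mk a)),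
      listMap (Y := fun p : Σ i, κ' i => Y p.1 p.2) (Sigma.mk a) (fun b => 𝟙 (Y a b)) k ≫
        listMap (Y := fun p : Σ i, κ'' i => Y' p.1 p.2) (fun p => ⟨p.1, e p.1 p.2⟩) (fun p => g p.1 p.2) _ ≫
          q.eval _ =
      listMap (e a) (g a) k ≫
        listMap (Y := fun p : Σ i, κ'' i => Y' p.1 p.2) (Sigma.mk a) (fun b => 𝟙 (Y' a b)) _ := by
  induction k with
  | nil => exact ⟨.nil, Category.id_comp (𝟙 _ ≫ 𝟙 _)⟩
  | cons b k ih =>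
    obtain ⟨q, hq⟩ := ih
    refine ⟨.cons _ q, ?_⟩
    dsimp only [listMap, listTensor, List.map, Rearr.eval] at hq ⊢
    rw [tensorHom_comp_whiskerLeft, tensorHom_comp_tensorHom, tensorHom_comp_tensorHom, hq,
      Category.id_comp, Category.comp_id]

theorem flat_map (Y : ∀ i, κ' i → C) {κ'' : ι → Type} (Y' : ∀ i, κ'' i → C)
    (e : ∀ i, κ' i → κ'' i) (g : ∀ i b, Y i b ⟶ Y' i (e i b)) (m : ∀ i, List (κ' i)) (l : List ι) :
    ∃ q : Rearr ((blocks m l).map (fun p => ⟨p.1, e p.1 p.2⟩)) (blocks (fun i => (m i).map (e i)) l),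
    listHom (fun i => listMap (e i) (g i) (m i)) l ≫ flat Y' (fun i => (m i).map (e i)) l =
      flat Y m l ≫ listMap (Y := fun p : Σ i, κ'' i => Y' p.1 p.2) (fun p => ⟨p.1, e p.1 p.2⟩)
        (fun p => g p.1 p.2) _ ≫ q.eval _ := by
  induction l with
  | nil => exact ⟨.nil, (Category.id_comp (𝟙 _ ≫ 𝟙 _)).symm⟩
  | cons a l ih =>
    obtain ⟨q, hq⟩ := ih
    obtain ⟨r, hr⟩ := exists_map_mk e g a (m a)
    refine ⟨.trans (Rearr.mapAppend _ _ _) (.trans (r.appendRight _) (q.appendLeft _)), ?_⟩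
    exact flat_cons_aux _ _ _ _ _ _ _ _ _ _ _ _ _ _ _ _ _ _ (append_listMap _ _ _ _)
      (append_appendRight _ _ r) (append_appendLeft _ q _) hr hq

theorem exists_map_mk_reindex {κ'' : κ → Type} (Y : ∀ i, κ'' i → C) (e : ι → κ) (a : ι)
    (k : List (κ'' (e a))) :
    ∃ q : Rearr ((k.map (Sigma.mk (β := fun i => κ'' (e i)) a)).map
        (fun p : Σ i, κ'' (e i) => (⟨e p.1, p.2⟩ : Σ j, κ'' j))) (k.map (Sigma.mk (e a))),
      listMap (Y := fun p : Σ i, κ'' (e i) => Y (e p.1) p.2) (Sigma.mk a)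
          (fun b => 𝟙 (Y (e a) b)) k ≫
        listMap (Y := fun p : Σ i, κ'' i => Y p.1 p.2) (fun p : Σ i, κ'' (e i) => (⟨e p.1, p.2⟩ : Σ j, κ'' j))
          (fun _ => 𝟙 _) _ ≫ q.eval _ =
      listMap (Y := fun p : Σ i, κ'' i => Y p.1 p.2) (Sigma.mk (e a))
        (fun b => 𝟙 (Y (e a) b)) k := by
  induction k with
  | nil => exact ⟨.nil, (Category.id_comp _).trans (Category.id_comp _)⟩
  | cons b k ih =>
    obtain ⟨q, hq⟩ := ih
    refine ⟨.cons _ q, ?_⟩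
    dsimp only [listMap, listTensor, List.map, Rearr.eval] at hq ⊢
    rw [tensorHom_comp_whiskerLeft, tensorHom_comp_tensorHom, hq, Category.id_comp]

theorem flat_reindex {κ'' : κ → Type} (Y : ∀ i, κ'' i → C) (e : ι → κ)
    (m : ∀ i, List (κ'' i)) (l : List ι) :
    ∃ q : Rearr ((blocks (fun i => m (e i)) l).map (fun p : Σ i, κ'' (e i) => (⟨e p.1, p.2⟩ : Σ j, κ'' j)))
      (blocks m (l.map e)),
    listMap (Y := fun i => listTensor (Y i) (m i)) e (fun i => 𝟙 (listTensor (Y (e i)) (m (e i)))) l ≫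
        flat Y m (l.map e) =
      flat (fun i => Y (e i)) (fun i => m (e i)) l ≫
        listMap (Y := fun p : Σ i, κ'' i => Y p.1 p.2) (fun p : Σ i, κ'' (e i) => (⟨e p.1, p.2⟩ : Σ j, κ'' j))
          (fun _ => 𝟙 _) _ ≫ q.eval _ := by
  induction l with
  | nil => exact ⟨.nil, (Category.id_comp (𝟙 _ ≫ 𝟙 _)).symm⟩
  | cons a l ih =>
    obtain ⟨q, hq⟩ := ih
    obtain ⟨r, hr⟩ := exists_map_mk_reindex Y e a (m (e a))
    refine ⟨.trans (Rearr.mapAppend _ _ _) (.trans (r.appendRight _) (q.appendLeft _)), ?_⟩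
    exact flat_cons_aux _ _ _ _ _ _ _ _ _ _ _ _ _ _ _ _ _ _ (append_listMap _ _ _ _)
      (append_appendRight _ _ r) (append_appendLeft _ q _) (hr.trans (Category.id_comp _).symm) hq

theorem bijective_sigma {κ'' : κ → Type} {e : ι → κ} (he : Function.Bijective e)
    {f : ∀ i, κ' i → κ'' (e i)} (hf : ∀ i, Function.Bijective (f i)) :
    Function.Bijective (fun p : Σ i, κ' i => (⟨e p.1, f p.1 p.2⟩ : Σ j, κ'' j)) :=
  ⟨he.1.sigma_map fun i => (hf i).1, he.2.sigma_map fun i => (hf i).2⟩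

theorem listMap_listHom {X : ι → C} {X' : ι → C} {Y : κ → C} (e : ι → κ)
    (f : ∀ i, X i ⟶ X' i) (g : ∀ i, X' i ⟶ Y (e i)) (l : List ι) :
    listHom f l ≫ listMap e g l = listMap e (fun i => f i ≫ g i) l := by
  induction l with
  | nil => exact Category.id_comp _
  | cons a l ih =>
    dsimp only [listMap, listTensor, List.map, listHom]
    rw [tensorHom_comp_tensorHom, ih]

theorem listHom_comp {X X' X'' : ι → C} (f : ∀ i, X i ⟶ X' i) (g : ∀ i, X' i ⟶ X'' i)
    (l : List ι) : listHom f l ≫ listHom g l = listHom (fun i => f i ≫ g i) l := by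
  induction l with
  | nil => exact Category.id_comp _
  | cons a l ih =>
    dsimp only [listTensor, listHom]
    rw [tensorHom_comp_tensorHom, ih]

theorem listHom_id (X : ι → C) (l : List ι) : listHom (fun i => 𝟙 (X i)) l = 𝟙 _ := by
  induction l with
  | nil => rfl
  | cons a l ih =>
    dsimp only [listTensor, listHom]
    rw [ih, id_tensorHom_id]

theorem unMap_eq_listHom [Finite ι] {X X' : ι → C} (g : ∀ i, X i ⟶ X' i) :
    unMap id Function.bijective_id g = listHom g (enum ι) := by
  have h := listMap_listHom id g (fun i => 𝟙 (X' i)) (enum ι)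
  simp only [Category.comp_id] at h
  have h' : unMap id Function.bijective_id g =
      listMap id g (enum ι) ≫ (Rearr.mapId (enum ι)).eval X' := by
    rw [unMap, ← eval_ins X' ((isEnum_enum ι).map Function.bijective_id) (isEnum_enum ι)
      (Rearr.mapId _), ins_enum]
    exact congrArg (listMap id g (enum ι) ≫ ·) (Category.comp_id _)
  rw [h', ← h, Category.assoc, listMap_id, Category.comp_id]

theorem unSigma_reindex [Finite ι] [Finite κ] {κ'' : κ → Type} [∀ i, Finite (κ'' i)]
    (Y : ∀ i, κ'' i → C) (e : ι → κ) (he : Function.Bijective e) :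
    unMap (Y := fun i => unTensor (Y i)) e he (fun i => 𝟙 (unTensor (Y (e i)))) ≫ unSigma Y =
      unSigma (fun i => Y (e i)) ≫
        unMap (Y := fun p : Σ i, κ'' i => Y p.1 p.2) (fun p : Σ i, κ'' (e i) => ⟨e p.1, p.2⟩)
          (bijective_sigma he fun _ => Function.bijective_id) (fun p => 𝟙 (Y (e p.1) p.2)) := by
  have hm := fun i => isEnum_enum (κ'' i)
  obtain ⟨q, hq⟩ := flat_reindex Y e (fun i => enum (κ'' i)) (enum ι)
  have h := ins_unSigma Y _ ((isEnum_enum ι).map he) _ hm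
  simp only [ins_enum, listHom_id, Category.id_comp] at h
  rw [unMap, Category.assoc, h, ← Category.assoc, hq, unSigma]
  simp only [Category.assoc]
  rw [ins_unMap, eval_ins]

theorem unSigma_map [Finite ι] {κ'' : ι → Type} [∀ i, Finite (κ' i)] [∀ i, Finite (κ'' i)]
    (Y : ∀ i, κ' i → C) (Y' : ∀ i, κ'' i → C) (f : ∀ i, κ' i → κ'' i)
    (hf : ∀ i, Function.Bijective (f i)) (g : ∀ i b, Y i b ⟶ Y' i (f i b)) :
    unMap (X := fun i => unTensor (Y i)) (Y := fun i => unTensor (Y' i)) id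
        Function.bijective_id (fun i => unMap (f i) (hf i) (g i)) ≫ unSigma Y' =
      unSigma Y ≫ unMap (Y := fun p : Σ i, κ'' i => Y' p.1 p.2)
        (fun p : Σ i, κ' i => ⟨p.1, f p.1 p.2⟩) (bijective_sigma Function.bijective_id hf)
        (fun p => g p.1 p.2) := by
  obtain ⟨q, hq⟩ := flat_map Y Y' f g (fun i => enum (κ' i)) (enum ι)
  have h := ins_unSigma Y' _ (isEnum_enum ι) _ (fun i => (isEnum_enum (κ' i)).map (hf i))
  rw [ins_enum, Category.id_comp] at h
  have h₀ : unMap (X := fun i => unTensor (Y i)) (Y := fun i => unTensor (Y' i)) id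
      Function.bijective_id (fun i => unMap (f i) (hf i) (g i)) =
      listHom (fun i => listMap (f i) (g i) (enum (κ' i)) ≫
        ins (Y' i) _ ((isEnum_enum (κ' i)).map (hf i))) (enum ι) := unMap_eq_listHom _
  rw [h₀, ← listHom_comp, Category.assoc, h, ← Category.assoc, hq, unSigma]
  simp only [Category.assoc]
  have h' := ins_unMap (Y := fun p : Σ i, κ'' i => Y' p.1 p.2)
    (fun p : Σ i, κ' i => ⟨p.1, f p.1 p.2⟩) (bijective_sigma Function.bijective_id hf)
    (fun p => g p.1 p.2) _ (isEnum_blocks (fun i => isEnum_enum (κ' i)) (isEnum_enum ι))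
  rw [eval_ins, ← h']
  exact (isEnum_blocks (fun i => isEnum_enum (κ' i)) (isEnum_enum ι)).map
    (bijective_sigma Function.bijective_id hf)

/-- Naturality of the identification of iterated tensor products. -/
theorem unSigma_naturality [Finite ι] [Finite κ] {κ'' : κ → Type} [∀ i, Finite (κ' i)]
    [∀ i, Finite (κ'' i)] (Y : ∀ i, κ' i → C) (Y' : ∀ i, κ'' i → C) (e : ι → κ)
    (he : Function.Bijective e) (f : ∀ i, κ' i → κ'' (e i)) (hf : ∀ i, Function.Bijective (f i))
    (g : ∀ i b, Y i b ⟶ Y' (e i) (f i b)) :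
    unMap (Y := fun i => unTensor (Y' i)) e he (fun i => unMap (f i) (hf i) (g i)) ≫ unSigma Y' =
      unSigma Y ≫ unMap (Y := fun p : Σ i, κ'' i => Y' p.1 p.2)
        (fun p : Σ i, κ' i => ⟨e p.1, f p.1 p.2⟩) (bijective_sigma he hf)
        (fun p => g p.1 p.2) := by
  have h₁ := unMap_comp (Z := fun i => unTensor (Y' i)) id Function.bijective_id e he
    (fun i => unMap (f i) (hf i) (g i)) (fun i => 𝟙 (unTensor (Y' (e i))))
  simp only [Category.comp_id] at h₁
  refine (congrArg (· ≫ unSigma Y') h₁.symm).trans ?_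
  simp only [Category.assoc]
  rw [unSigma_reindex, ← Category.assoc, unSigma_map Y (fun i => Y' (e i)) f hf g, Category.assoc,
    unMap_comp]
  simp only [Category.comp_id]
  rfl

end UnorderedTensor

section Trees

/-- A finite set as an object of the category `Σ_*` of finite sets and bijections. -/
def Sig.of (α : Type) [Finite α] : Core FintypeCat.{0} := ⟨FintypeCat.of α⟩

/-- A bijection as a morphism of `Σ_*`. -/
def Sig.map {α β : Type} [Finite α] [Finite β] (e : α ≃ β) : Sig.of α ⟶ Sig.of β :=
  ⟨FintypeCat.equivEquivIso (A := FintypeCat.of α) (B := FintypeCat.of β) e⟩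

theorem Sig.map_refl (α : Type) [Finite α] : Sig.map (Equiv.refl α) = 𝟙 _ := rfl

theorem Sig.map_comp {α β δ : Type} [Finite α] [Finite β] [Finite δ] (e : α ≃ β) (e' : β ≃ δ) :
    Sig.map e ≫ Sig.map e' = Sig.map (e.trans e') := rfl

/-- Chains of maps of finite sets `S 0 ← S 1 ← ⋯ ← S n` in which `S 0` has one element; all composite
maps `f : S j → S i`, `i ≤ j`, are part of the data. In other words, contravariant functors from the
poset `{0 < 1 < ⋯ < n}` to finite sets sending `0` to a one-element set. -/
structure LevelTree (n : ℕ) where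
  S : Fin (n + 1) → Type
  finite : ∀ i, Finite (S i)
  f : ∀ {i j : Fin (n + 1)}, i ≤ j → S j → S i
  f_refl : ∀ {i : Fin (n + 1)} (h : i ≤ i) (x : S i), f h x = x
  f_trans : ∀ {i j k : Fin (n + 1)} (h : i ≤ j) (h' : j ≤ k) (x : S k),
    f h (f h' x) = f (h.trans h') x
  root_nonempty : Nonempty (S 0)
  root_subsingleton : Subsingleton (S 0)

namespace LevelTree

variable {n m : ℕ}

instance (X : LevelTree n) (i : Fin (n + 1)) : Finite (X.S i) := X.finite i

/-- Natural isomorphisms of chains. -/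
@[ext]
structure Hom (X Y : LevelTree n) where
  e : ∀ i, X.S i ≃ Y.S i
  comm : ∀ {i j : Fin (n + 1)} (h : i ≤ j) (x : X.S j), e i (X.f h x) = Y.f h (e j x)

/-- The category `Σ_*^{≀ n}` of chains and natural isomorphisms. -/
instance : Category (LevelTree n) where
  Hom := Hom
  id X := ⟨fun i => Equiv.refl _, fun _ _ => rfl⟩
  comp a b := ⟨fun i => (a.e i).trans (b.e i), fun h x => by
    simp only [Equiv.trans_apply, a.comm, b.comm]⟩

/-- Levels with equal indices. -/
def cast (X : LevelTree n) {i j : Fin (n + 1)} (h : i = j) : X.S i ≃ X.S j where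
  toFun := X.f h.ge
  invFun := X.f h.le
  left_inv x := by rw [X.f_trans, X.f_refl]
  right_inv x := by rw [X.f_trans, X.f_refl]

variable (n) in
/-- `γ^n`, forgetting all but the top set of a chain. -/
def gamma : LevelTree n ⥤ Core FintypeCat.{0} where
  obj X := Sig.of (X.S (Fin.last n))
  map a := Sig.map (a.e (Fin.last n))

end LevelTree

/-- Monotone maps `{0 < ⋯ < m} → {0 < ⋯ < n}` that preserve the two end points. -/
structure EndMap (m n : ℕ) where
  toFun : Fin (m + 1) → Fin (n + 1)
  mono : Monotone toFun
  zero : toFun 0 = 0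
  last : toFun (Fin.last m) = Fin.last n

namespace LevelTree

variable {n m : ℕ}

/-- The functor `Σ_*^{≀ n} ⥤ Σ_*^{≀ m}` given by composing chains with `φ`. -/
def pull (φ : EndMap m n) : LevelTree n ⥤ LevelTree m where
  obj X :=
    { S := fun i => X.S (φ.toFun i)
      finite := fun _ => inferInstance
      f := fun h => X.f (φ.mono h)
      f_refl := fun _ x => X.f_refl _ x
      f_trans := fun _ _ x => X.f_trans _ _ x
      root_nonempty := by rw [φ.zero]; exact X.root_nonempty
      root_subsingleton := by rw [φ.zero]; exact X.root_subsingleton }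
  map a := ⟨fun i => a.e (φ.toFun i), fun h x => a.comm (φ.mono h) x⟩

/-- The identification `γ^n = γ^m ∘ φ^*`. -/
def gammaPull (φ : EndMap m n) : gamma n ⟶ pull φ ⋙ gamma m where
  app X := Sig.map (X.cast φ.last.symm)
  naturality X Y a := by
    refine (Sig.map_comp _ _).trans (Eq.trans ?_ (Sig.map_comp _ _).symm)
    congr 1
    ext x
    exact (a.comm _ x).symm

/-- The interior vertices of the level tree of a chain: the elements of `S 0, …, S (n-1)`. -/
abbrev V (X : LevelTree n) : Type := Σ i : Fin n, X.S i.castSucc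

/-- The incoming edges of a vertex `s ∈ S i`: the fibre of `S (i+1) → S i` over `s`. -/
abbrev In (X : LevelTree n) (v : X.V) : Type :=
  {t : X.S v.1.succ // X.f (Fin.castSucc_le_succ v.1) t = v.2}

/-- The map of vertices induced by an isomorphism of chains. -/
abbrev Hom.v {X Y : LevelTree n} (a : X ⟶ Y) (v : X.V) : Y.V := ⟨v.1, a.e _ v.2⟩

theorem Hom.v_bijective {X Y : LevelTree n} (a : X ⟶ Y) : Function.Bijective (Hom.v a) :=
  bijective_sigma (e := fun i : Fin n => i) (f := fun i => a.e i.castSucc)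
    Function.bijective_id fun i => (a.e i.castSucc).bijective

/-- The bijection of incoming edges induced by an isomorphism of chains. -/
def Hom.inEquiv {X Y : LevelTree n} (a : X ⟶ Y) (v : X.V) : X.In v ≃ Y.In (Hom.v a v) :=
  (a.e v.1.succ).subtypeEquiv fun t => by
    have h := a.comm (Fin.castSucc_le_succ v.1) t
    exact (a.e v.1.castSucc).injective.eq_iff.symm.trans (by rw [h])

end LevelTree

end Trees

open LevelTree

section Circ

variable {C : Type u} [Category.{v} C] [MonoidalCategory C] [SymmetricCategory C]

variable (C) in
/-- Symmetric sequences in `C`. -/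
abbrev SymSeq : Type _ := Core FintypeCat.{0} ⥤ C

/-- The product `A₁ ⊚ ⋯ ⊚ Aₙ`, a functor on level trees: the unordered tensor product, over all
vertices, of the value of `A (i+1)` (here indexed by `i : Fin n`) at the set of incoming edges of
the vertex of height `i`. -/
def circ {n : ℕ} (A : Fin n → SymSeq C) : LevelTree n ⥤ C where
  obj X := unTensor fun v : X.V => (A v.1).obj (Sig.of (X.In v))
  map a := unMap (Hom.v a) (Hom.v_bijective a) fun v => (A v.1).map (Sig.map (Hom.inEquiv a v))
  map_id X := by
    refine Eq.trans ?_ (unMap_id _)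
    exact congrArg (unMap id Function.bijective_id) (funext fun v => (A v.1).map_id _)
  map_comp a b := by
    refine Eq.trans ?_ (unMap_comp _ _ _ _ _ _).symm
    exact congrArg (unMap _ _) (funext fun v =>
      (A v.1).map_comp (Sig.map (Hom.inEquiv a v)) (Sig.map (Hom.inEquiv b (Hom.v a v))))

/-- `A^{⊚ n}`. -/
abbrev circPow (A : SymSeq C) (n : ℕ) : LevelTree n ⥤ C := circ fun _ : Fin n => A

variable (C) in
/-- The counit symmetric sequence: the monoidal unit on one-element sets and the final object on all
other finite sets. -/
def counitSeq [HasTerminal C] : SymSeq C where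
  obj T := if Nat.card T.of = 1 then 𝟙_ C else ⊤_ C
  map {T T'} a := eqToHom (by rw [Nat.card_congr (FintypeCat.equivEquivIso.symm a.iso)])

theorem counitSeq_obj_of [HasTerminal C] {α : Type} [Finite α] (h : Nat.card α = 1) :
    (counitSeq C).obj (Sig.of α) = 𝟙_ C :=
  if_pos h

end Circ

section Subtrees

namespace LevelTree

variable {n m g : ℕ}

/-- For an element `s` of the level `a` of a chain `X`, the chain of the sets of elements lying over
`s` in the levels `ψ 0 ≤ ψ 1 ≤ ⋯ ≤ ψ g`, where `ψ 0 = a`. -/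
def sub (X : LevelTree n) (ψ : Fin (g + 1) → Fin (n + 1)) (hψ : Monotone ψ) {a : Fin (n + 1)}
    (h₀ : ψ 0 = a) (s : X.S a) : LevelTree g where
  S l := {t : X.S (ψ l) // X.f (h₀.ge.trans (hψ (Fin.zero_le l))) t = s}
  finite _ := inferInstance
  f h t := ⟨X.f (hψ h) t.1, by rw [X.f_trans]; exact t.2⟩
  f_refl _ _ := Subtype.ext (X.f_refl _ _)
  f_trans _ _ _ := Subtype.ext (X.f_trans _ _ _)
  root_nonempty := ⟨⟨X.f h₀.le s, by rw [X.f_trans, X.f_refl]⟩⟩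
  root_subsingleton := ⟨fun t t' => Subtype.ext ((X.cast h₀).injective (t.2.trans t'.2.symm))⟩

/-- The isomorphism of subtrees induced by an isomorphism of chains. -/
def subHom {X Y : LevelTree n} (b : X ⟶ Y) (ψ : Fin (g + 1) → Fin (n + 1)) (hψ : Monotone ψ)
    {a : Fin (n + 1)} (h₀ : ψ 0 = a) (s : X.S a) :
    X.sub ψ hψ h₀ s ⟶ Y.sub ψ hψ h₀ (b.e a s) where
  e l := (b.e (ψ l)).subtypeEquiv fun t => by
    have h := b.comm (h₀.ge.trans (hψ (Fin.zero_le l))) t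
    exact (b.e a).injective.eq_iff.symm.trans (by rw [h])
  comm h t := Subtype.ext (b.comm (hψ h) t.1)

end LevelTree

namespace EndMap

variable {m n : ℕ} (φ : EndMap m n)

/-- The number of levels of a chain `X` that become one level of `φ^* X`. -/
def gap (i : Fin m) : ℕ := (φ.toFun i.succ : ℕ) - φ.toFun i.castSucc

theorem add_gap (i : Fin m) :
    (φ.toFun i.castSucc : ℕ) + φ.gap i = φ.toFun i.succ := by
  have : (φ.toFun i.castSucc : ℕ) ≤ φ.toFun i.succ := φ.mono (Fin.castSucc_le_succ i)
  unfold gap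
  omega

/-- The levels between `φ i` and `φ (i+1)`. -/
def seg (i : Fin m) (l : Fin (φ.gap i + 1)) : Fin (n + 1) :=
  ⟨φ.toFun i.castSucc + l, by have := φ.add_gap i; omega⟩

theorem seg_mono (i : Fin m) : Monotone (φ.seg i) := fun l l' h => by
  have : (l : ℕ) ≤ l' := h
  simp only [seg, Fin.mk_le_mk]
  omega

theorem seg_zero (i : Fin m) : φ.seg i 0 = φ.toFun i.castSucc := by
  ext; simp [seg]

theorem seg_last (i : Fin m) : φ.seg i (Fin.last _) = φ.toFun i.succ := by
  ext; simp [seg, φ.add_gap i]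

end EndMap

namespace LevelTree

variable {m n : ℕ} (φ : EndMap m n)

/-- The part of the level tree `X` that is contracted to the vertex `v` of `φ^* X`. -/
abbrev part (X : LevelTree n) (v : ((pull φ).obj X).V) : LevelTree (φ.gap v.1) :=
  X.sub (φ.seg v.1) (φ.seg_mono v.1) (φ.seg_zero v.1) v.2

/-- The incoming edges of `v` in `φ^* X` are the leaves of the part of `X` contracted to `v`. -/
def leafEquiv (X : LevelTree n) (v : ((pull φ).obj X).V) :
    ((pull φ).obj X).In v ≃ (X.part φ v).S (Fin.last _) :=
  (X.cast (φ.seg_last v.1).symm).subtypeEquiv fun t => by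
    have h : X.f ((φ.seg_zero v.1).ge.trans (φ.seg_mono v.1 (Fin.zero_le _)))
        (X.cast (φ.seg_last v.1).symm t) = X.f (φ.mono (Fin.castSucc_le_succ v.1)) t :=
      X.f_trans _ _ _
    rw [h]
    rfl

/-- The vertices of `X` are the vertices of the parts that are contracted by `φ`. -/
def glue (X : LevelTree n) (p : Σ v : ((pull φ).obj X).V, (X.part φ v).V) : X.V :=
  ⟨⟨φ.toFun p.1.1.castSucc + p.2.1, by
    have := φ.add_gap p.1.1
    have := (φ.toFun p.1.1.succ).isLt
    have := p.2.1.isLt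
    omega⟩, p.2.2.1⟩

theorem V_ext {X : LevelTree n} {i j : Fin n} (h : i = j) (t : X.S j.castSucc)
    (t' : X.S i.castSucc) (ht : t' = X.f (by rw [h]) t) : (⟨i, t'⟩ : X.V) = ⟨j, t⟩ := by
  subst h
  rw [ht, X.f_refl]

theorem glue_bijective (X : LevelTree n) : Function.Bijective (X.glue φ) := by
  constructor
  · have key : ∀ i i' : Fin m, i < i' → ∀ (l : Fin (φ.gap i)) (l' : ℕ),
        (φ.toFun i.castSucc : ℕ) + l ≠ φ.toFun i'.castSucc + l' := by
      intro i i' h l l'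
      have h₁ : (φ.toFun i.succ : ℕ) ≤ φ.toFun i'.castSucc := φ.mono h
      have h₂ := φ.add_gap i
      have h₃ := l.isLt
      omega
    rintro ⟨⟨i, s⟩, ⟨l, ⟨t, ht⟩⟩⟩ ⟨⟨i', s'⟩, ⟨l', ⟨t', ht'⟩⟩⟩ h
    obtain ⟨h₁, h₂⟩ := Sigma.mk.inj h
    have h₁ := congrArg Fin.val h₁
    dsimp only at h₁
    obtain rfl : i = i' := by
      rcases lt_trichotomy i i' with h | h | h
      · exact absurd h₁ (key i i' h l l')
      · exact h
      · exact absurd h₁.symm (key i' i h l' l)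
    obtain rfl : l = l' := Fin.ext (by omega)
    obtain rfl : t = t' := eq_of_heq h₂
    obtain rfl : s = s' := Eq.trans (Eq.symm ht) ht'
    rfl
  · rintro ⟨k, t⟩
    obtain ⟨i, h₁, h₂⟩ : ∃ i : Fin m, (φ.toFun i.castSucc : ℕ) ≤ k ∧ (k : ℕ) < φ.toFun i.succ := by
      by_contra hne
      push Not at hne
      have : ∀ j : Fin (m + 1), (φ.toFun j : ℕ) ≤ k := by
        intro j
        induction j using Fin.induction with
        | zero => simp [φ.zero]
        | succ i ih => exact hne i ih
      have := this (Fin.last m)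
      rw [φ.last] at this
      simp at this
      omega
    have h₃ := φ.add_gap i
    have hk : (⟨φ.toFun i.castSucc + (k - φ.toFun i.castSucc), by omega⟩ : Fin n) = k :=
      Fin.ext (by simp; omega)
    exact ⟨⟨⟨i, X.f (show φ.toFun i.castSucc ≤ k.castSucc from h₁) t⟩,
      ⟨⟨k - φ.toFun i.castSucc, by show (k : ℕ) - φ.toFun i.castSucc < φ.gap i; omega⟩, ⟨X.f (by
        show (φ.toFun i.castSucc : ℕ) + (k - φ.toFun i.castSucc) ≤ k; omega) t,
        X.f_trans _ _ _⟩⟩⟩, V_ext hk _ _ rfl⟩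

/-- Incoming edges are not affected by decomposing a tree into parts. -/
def glueIn (X : LevelTree n) (p : Σ v : ((pull φ).obj X).V, (X.part φ v).V) :
    (X.part φ p.1).In p.2 ≃ X.In (X.glue φ p) where
  toFun u := ⟨u.1.1, congrArg Subtype.val u.2⟩
  invFun u := ⟨⟨u.1, by
    exact (X.f_trans _ (φ.seg_mono p.1.1 (Fin.castSucc_le_succ p.2.1)) u.1).symm.trans
      ((congrArg _ u.2).trans p.2.2.2)⟩, Subtype.ext u.2⟩
  left_inv _ := rfl
  right_inv _ := rfl

end LevelTree

end Subtrees

section Cooperads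

variable {C : Type u} [Category.{v} C] [MonoidalCategory C] [SymmetricCategory C] [HasTerminal C]

variable (C) in
/-- A counital symmetric sequence `ε : O ⟶ 𝟙` together with a natural transformation
`Δ : O γ² ⟶ O ⊚ O`, no compatibility being required yet. -/
structure PreCooperad where
  O : SymSeq C
  Δ : gamma 2 ⋙ O ⟶ circPow O 2
  ε : O ⟶ counitSeq C

theorem isEnum_nil_V (X : LevelTree 0) : IsEnum ([] : List X.V) :=
  ⟨List.nodup_nil, fun v => v.1.elim0⟩

theorem isEnum_root (X : LevelTree 1) (s : X.S 0) : IsEnum [(⟨0, s⟩ : X.V)] := by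
  refine ⟨List.nodup_singleton _, ?_⟩
  rintro ⟨i, s'⟩
  have := X.root_subsingleton
  obtain rfl : i = 0 := Subsingleton.elim _ _
  exact List.mem_singleton.2 (congrArg (Sigma.mk 0) (Subsingleton.elim (α := X.S 0) _ _))

/-- In a level tree with one level all leaves are incoming edges of the only vertex. -/
def rootIn (X : LevelTree 1) (s : X.S 0) : X.S (Fin.last 1) ≃ X.In ⟨0, s⟩ :=
  (Equiv.subtypeUnivEquiv fun _ => X.root_subsingleton.elim _ _).symm

/-- The canonical isomorphism from the value of `A` at the leaves of a tree with one level to the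
tensor product with only one factor, `A` at the incoming edges of the only vertex `s`. -/
def unitApp (A : SymSeq C) (X : LevelTree 1) (s : X.S 0) :
    A.obj (Sig.of (X.S (Fin.last 1))) ⟶ (circPow A 1).obj X :=
  A.map (Sig.map (rootIn X s)) ≫ (ρ_ _).inv ≫
    ins (fun v : X.V => A.obj (Sig.of (X.In v))) [⟨0, s⟩] (isEnum_root X s)

theorem unit_aux {P Q R S U W : C} (a : P ⟶ Q) (c : Q ⟶ R) (b : P ⟶ S) (d : S ⟶ R)
    (I : S ⊗ 𝟙_ C ⟶ U) (M : U ⟶ W) (J : R ⊗ 𝟙_ C ⟶ W) (h : a ≫ c = b ≫ d)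
    (h' : I ≫ M = (d ⊗ₘ 𝟙 _) ≫ J) :
    a ≫ (c ≫ (ρ_ R).inv ≫ J) = (b ≫ (ρ_ S).inv ≫ I) ≫ M := by
  simp only [Category.assoc, h', tensorHom_id, ← rightUnitor_inv_naturality_assoc]
  rw [← Category.assoc, h, Category.assoc]

theorem square_aux {P Q R S T U : C} (p : P ⟶ Q) (q : Q ⟶ R) (r : P ⟶ S) (s : S ⟶ R)
    (t : R ⟶ T) (u : S ⟶ U) (w : U ⟶ T) (h : p ≫ q = r ≫ s) (h' : s ≫ t = u ≫ w) :
    p ≫ (q ≫ t) = (r ≫ u) ≫ w := by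
  rw [← Category.assoc, h, Category.assoc, h', Category.assoc]

/-- The canonical isomorphism between a symmetric sequence `A` and `A^{⊚ 1}`. -/
def unitHom (A : SymSeq C) : gamma 1 ⋙ A ⟶ circPow A 1 where
  app X := unitApp A X X.root_nonempty.some
  naturality X Y a := by
    have h : unitApp A Y Y.root_nonempty.some = unitApp A Y (a.e 0 X.root_nonempty.some) := by
      rw [Y.root_subsingleton.elim Y.root_nonempty.some (a.e 0 X.root_nonempty.some)]
    have h₁ := ins_unMap (X := fun v : X.V => A.obj (Sig.of (X.In v)))
      (Y := fun v : Y.V => A.obj (Sig.of (Y.In v))) (Hom.v a) (Hom.v_bijective a)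
      (fun v => A.map (Sig.map (Hom.inEquiv a v))) [⟨0, X.root_nonempty.some⟩] (isEnum_root X _)
    have h₂ : A.map (Sig.map (a.e (Fin.last 1))) ≫
        A.map (Sig.map (rootIn Y (a.e 0 X.root_nonempty.some))) =
        A.map (Sig.map (rootIn X X.root_nonempty.some)) ≫
          A.map (Sig.map (Hom.inEquiv a ⟨0, X.root_nonempty.some⟩)) := by
      rw [← A.map_comp, ← A.map_comp]
      rfl
    exact (congrArg (A.map (Sig.map (a.e (Fin.last 1))) ≫ ·) h).trans
      (unit_aux _ _ _ _ _ _ _ h₂ h₁)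

namespace PreCooperad

variable (P : PreCooperad C)

/-- The counit as a map from the value of `O` on one-element sets to the monoidal unit
`O^{⊚ 0}`. -/
def counitHom : gamma 0 ⋙ P.O ⟶ circPow P.O 0 where
  app X := P.ε.app (Sig.of (X.S (Fin.last 0))) ≫
    eqToHom (counitSeq_obj_of (Nat.card_eq_one_iff_unique.2
      ⟨X.root_subsingleton, X.root_nonempty⟩)) ≫
    ins (fun v : X.V => P.O.obj (Sig.of (X.In v))) [] (isEnum_nil_V X)
  naturality X Y a := by
    have h₁ := ins_unMap (X := fun v : X.V => P.O.obj (Sig.of (X.In v)))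
      (Y := fun v : Y.V => P.O.obj (Sig.of (Y.In v))) (Hom.v a) (Hom.v_bijective a)
      (fun v => P.O.map (Sig.map (Hom.inEquiv a v))) [] (isEnum_nil_V X)
    have h₂ := P.ε.naturality (Sig.map (a.e (Fin.last 0)))
    have h₃ : ((counitSeq C).map (Sig.map (a.e (Fin.last 0))) :
        (counitSeq C).obj (Sig.of _) ⟶ (counitSeq C).obj (Sig.of _)) ≫
        eqToHom (counitSeq_obj_of (Nat.card_eq_one_iff_unique.2
          ⟨Y.root_subsingleton, Y.root_nonempty⟩)) =
        eqToHom (counitSeq_obj_of (Nat.card_eq_one_iff_unique.2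
          ⟨X.root_subsingleton, X.root_nonempty⟩)) :=
      eqToHom_trans ((counitSeq_obj_of (Nat.card_eq_one_iff_unique.2
          ⟨X.root_subsingleton, X.root_nonempty⟩)).trans
        (counitSeq_obj_of (Nat.card_eq_one_iff_unique.2
          ⟨Y.root_subsingleton, Y.root_nonempty⟩)).symm) _
    exact square_aux _ _ _ _ _ _ _ h₂ (square_aux _ _ _ _ _ _ _
      (h₃.trans (Category.comp_id _).symm) h₁.symm)

/-- The operation `O(leaves) → O^{⊚ g}` for trees with at most two levels: the counit for `g = 0`,
the identity for `g = 1` and the cocomposition for `g = 2`. -/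
def localOp : (g : ℕ) → g ≤ 2 → (gamma g ⋙ P.O ⟶ circPow P.O g)
  | 0, _ => P.counitHom
  | 1, _ => unitHom P.O
  | 2, _ => P.Δ
  | _ + 3, h => absurd h (by omega)

/-- For `φ` as below, the natural transformation `O^{⊚ m} φ^* ⟶ O^{⊚ n}` which applies, at each
vertex of `φ^* X`, the counit, the identity or the cocomposition according to whether the vertex
arises by contracting no, one or two levels of `X`. -/
def opAlong {m n : ℕ} (φ : EndMap m n) (hφ : ∀ i, φ.gap i ≤ 2) :
    pull φ ⋙ circPow P.O m ⟶ circPow P.O n where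
  app X :=
    unMap (Y := fun v : ((pull φ).obj X).V => (circPow P.O (φ.gap v.1)).obj (X.part φ v)) id
        Function.bijective_id
        (fun v : ((pull φ).obj X).V => P.O.map (Sig.map (X.leafEquiv φ v)) ≫
          (P.localOp (φ.gap v.1) (hφ v.1)).app (X.part φ v)) ≫
      unSigma (fun (v : ((pull φ).obj X).V) (w : (X.part φ v).V) =>
        P.O.obj (Sig.of ((X.part φ v).In w))) ≫
      unMap (X.glue φ) (X.glue_bijective φ) (fun p => P.O.map (Sig.map (X.glueIn φ p)))
  naturality X Y a := by
    have hD : ∀ v : ((pull φ).obj X).V,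
        P.O.map (Sig.map (Hom.inEquiv ((pull φ).map a) v)) ≫
          (P.O.map (Sig.map (Y.leafEquiv φ (Hom.v ((pull φ).map a) v))) ≫
            (P.localOp (φ.gap v.1) (hφ v.1)).app (Y.part φ (Hom.v ((pull φ).map a) v))) =
        (P.O.map (Sig.map (X.leafEquiv φ v)) ≫
          (P.localOp (φ.gap v.1) (hφ v.1)).app (X.part φ v)) ≫
          (circPow P.O (φ.gap v.1)).map
            (subHom a (φ.seg v.1) (φ.seg_mono v.1) (φ.seg_zero v.1) v.2) := by
      intro v
      have h := (P.localOp (φ.gap v.1) (hφ v.1)).naturality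
        (subHom a (φ.seg v.1) (φ.seg_mono v.1) (φ.seg_zero v.1) v.2)
      refine square_aux _ _ _ _ _ _ _ ?_ h
      refine (P.O.map_comp _ _).symm.trans (Eq.trans ?_ (P.O.map_comp _ _))
      refine congrArg P.O.map ((Sig.map_comp _ _).trans (Eq.trans ?_ (Sig.map_comp (X.leafEquiv φ v)
        ((subHom a (φ.seg v.1) (φ.seg_mono v.1) (φ.seg_zero v.1) v.2).e (Fin.last _))).symm))
      exact congrArg Sig.map (Equiv.ext fun t => Subtype.ext (a.comm _ _).symm)
    have h₁ := unMap_comp (X := fun v : ((pull φ).obj X).V => P.O.obj (Sig.of (((pull φ).obj X).In v)))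
      (Y := fun v : ((pull φ).obj Y).V => P.O.obj (Sig.of (((pull φ).obj Y).In v)))
      (Z := fun v : ((pull φ).obj Y).V => (circPow P.O (φ.gap v.1)).obj (Y.part φ v))
      (Hom.v ((pull φ).map a)) (Hom.v_bijective _) id Function.bijective_id
      (fun v => P.O.map (Sig.map (Hom.inEquiv ((pull φ).map a) v)))
      (fun v => P.O.map (Sig.map (Y.leafEquiv φ v)) ≫
          (P.localOp (φ.gap v.1) (hφ v.1)).app (Y.part φ v))
    have h₂ := unMap_comp (X := fun v : ((pull φ).obj X).V => P.O.obj (Sig.of (((pull φ).obj X).In v)))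
      (Y := fun v : ((pull φ).obj X).V => (circPow P.O (φ.gap v.1)).obj (X.part φ v))
      (Z := fun v : ((pull φ).obj Y).V => (circPow P.O (φ.gap v.1)).obj (Y.part φ v))
      id Function.bijective_id (Hom.v ((pull φ).map a)) (Hom.v_bijective _)
      (fun v => P.O.map (Sig.map (X.leafEquiv φ v)) ≫
          (P.localOp (φ.gap v.1) (hφ v.1)).app (X.part φ v))
      (fun v => (circPow P.O (φ.gap v.1)).map
            (subHom a (φ.seg v.1) (φ.seg_mono v.1) (φ.seg_zero v.1) v.2))
    have h₃ := unSigma_naturality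
      (fun (v : ((pull φ).obj X).V) (w : (X.part φ v).V) => P.O.obj (Sig.of ((X.part φ v).In w)))
      (fun (v : ((pull φ).obj Y).V) (w : (Y.part φ v).V) => P.O.obj (Sig.of ((Y.part φ v).In w)))
      (Hom.v ((pull φ).map a)) (Hom.v_bijective _)
      (fun v => Hom.v (subHom a (φ.seg v.1) (φ.seg_mono v.1) (φ.seg_zero v.1) v.2))
      (fun v => Hom.v_bijective _)
      (fun v w => P.O.map (Sig.map (Hom.inEquiv
        (subHom a (φ.seg v.1) (φ.seg_mono v.1) (φ.seg_zero v.1) v.2) w)))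
    have h₄ := h₁.trans ((congrArg (unMap _ _) (funext hD)).trans h₂.symm)
    refine square_aux _ _ _ _ _ _ _ h₄ (square_aux _ _ _ _ _ _ _ h₃ ?_)
    refine (unMap_comp _ _ _ _ _ _).trans
      (Eq.trans ?_ (unMap_comp _ _ _ (Hom.v_bijective a) _ _).symm)
    refine congrArg (unMap _ _) (funext fun p => ?_)
    exact (P.O.map_comp _ _).symm.trans 
      (P.O.map_comp (Sig.map (X.glueIn φ p)) (Sig.map (Hom.inEquiv a (X.glue φ p))))

end PreCooperad

end Cooperads

namespace EndMap

variable {n : ℕ}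

theorem gap_le {m n : ℕ} (φ : EndMap m n) (k : ℕ)
    (h : ∀ i : Fin m, (φ.toFun i.succ : ℕ) ≤ φ.toFun i.castSucc + k) (i : Fin m) : φ.gap i ≤ k := by
  have := h i
  unfold gap
  omega

/-- The map `{0 < ⋯ < n} → {0 < ⋯ < n + 1}` that leaves out the inner element `k + 1`. Composing with
it is the face functor `∂^{n+1}_{k+1} : Σ_*^{≀ (n+1)} ⥤ Σ_*^{≀ n}`. -/
def face (k : Fin n) : EndMap n (n + 1) where
  toFun := k.succ.castSucc.succAbove
  mono := (Fin.strictMono_succAbove _).monotone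
  zero := Fin.succAbove_ne_zero_zero (by simp [Fin.ext_iff])
  last := Fin.succAbove_ne_last_last (by simp [Fin.ext_iff]; omega)

theorem face_gap (k : Fin n) : ∀ i, (face k).gap i ≤ 2 := by
  refine gap_le _ _ fun i => ?_
  simp only [face, Fin.succAbove, Fin.lt_def]
  split_ifs <;> simp

/-- The map `{0 < ⋯ < n + 1} → {0 < ⋯ < n}` that takes the value `i` twice. Composing with it is the
degeneracy functor `s^n_i : Σ_*^{≀ n} ⥤ Σ_*^{≀ (n+1)}`. -/
def degen (i : Fin (n + 1)) : EndMap (n + 1) n where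
  toFun := i.predAbove
  mono := Fin.predAbove_right_monotone i
  zero := by ext; simp [Fin.predAbove]
  last := by
    have h : i.castSucc < Fin.last (n + 1) := Fin.castSucc_lt_last i
    rw [Fin.predAbove_of_castSucc_lt _ _ h]
    rfl

theorem degen_gap (k : Fin (n + 1)) : ∀ i, (degen k).gap i ≤ 2 := by
  refine gap_le _ _ fun i => ?_
  simp only [degen, Fin.predAbove, Fin.lt_def]
  split_ifs <;> simp <;> omega

end EndMap

section Cooperads

variable {C : Type u} [Category.{v} C] [MonoidalCategory C] [SymmetricCategory C] [HasTerminal C]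

/-- The transformation `Δ̃^{n+1}_{k+1} : O^{⊚ n} ∂^{n+1}_{k+1} ⟶ O^{⊚ (n+1)}` applying the
cocomposition at the vertices of height `k`. -/
def PreCooperad.treeCoface (P : PreCooperad C) {n : ℕ} (k : Fin n) :
    pull (EndMap.face k) ⋙ circPow P.O n ⟶ circPow P.O (n + 1) :=
  P.opAlong (EndMap.face k) (EndMap.face_gap k)

/-- The transformation `ε̃^n_i : O^{⊚ (n+1)} s^n_i ⟶ O^{⊚ n}` applying the counit at the vertices of
height `i`. -/
def PreCooperad.treeCodegen (P : PreCooperad C) {n : ℕ} (i : Fin (n + 1)) :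
    pull (EndMap.degen i) ⋙ circPow P.O (n + 1) ⟶ circPow P.O n :=
  P.opAlong (EndMap.degen i) (EndMap.degen_gap i)

/-- The composite `B γ^n = B γ^m φ^* ⟶ F φ^*` for a transformation `t : B γ^m ⟶ F`. -/
def restrict {m n : ℕ} (φ : EndMap m n) {B : SymSeq C} {F : LevelTree m ⥤ C}
    (t : gamma m ⋙ B ⟶ F) : gamma n ⋙ B ⟶ pull φ ⋙ F :=
  Functor.whiskerRight (gammaPull φ) B ≫ Functor.whiskerLeft (pull φ) t

variable (C) in
/-- Counital cooperads: the cocomposition is coassociative, that is, the composites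
`O γ³ = O γ² ∂³_i ⟶ (O ⊚ O) ∂³_i ⟶ O ⊚ O ⊚ O` agree for `i = 1, 2`, and it respects the counit, that
is, the composites `O = O γ² s¹_i ⟶ (O ⊚ O) s¹_i ⟶ O` are the identity for `i = 0, 1`. -/
structure Cooperad extends PreCooperad C where
  coassoc : restrict (EndMap.face 0) Δ ≫ toPreCooperad.treeCoface (0 : Fin 2) =
    restrict (EndMap.face 1) Δ ≫ toPreCooperad.treeCoface (1 : Fin 2)
  counit_left : restrict (EndMap.degen 0) Δ ≫ toPreCooperad.treeCodegen (0 : Fin 2) = unitHom O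
  counit_right : restrict (EndMap.degen 1) Δ ≫ toPreCooperad.treeCodegen (1 : Fin 2) = unitHom O

end Cooperads

section Kan

/-- Every chain is isomorphic to one whose sets are of the form `{0, …, k - 1}`. -/
theorem essentiallySmall_levelTree (n : ℕ) : EssentiallySmall.{0} (LevelTree n) := by
  refine (essentiallySmall_iff _).2 ⟨?_, inferInstance⟩
  let T : Type := {p : Σ k : Fin (n + 1) → ℕ,
    ∀ i j : Fin (n + 1), i ≤ j → Fin (k j) → Fin (k i) //
      (∀ i h x, p.2 i i h x = x) ∧
      (∀ i j k (h : i ≤ j) (h' : j ≤ k) x, p.2 i j h (p.2 j k h' x) = p.2 i k (h.trans h') x) ∧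
      Nonempty (Fin (p.1 0)) ∧ Subsingleton (Fin (p.1 0))}
  let F : T → LevelTree n := fun p =>
    { S := fun i => Fin (p.1.1 i)
      finite := fun _ => inferInstance
      f := fun {i j} h => p.1.2 i j h
      f_refl := fun h x => p.2.1 _ h x
      f_trans := fun h h' x => p.2.2.1 _ _ _ h h' x
      root_nonempty := p.2.2.2.1
      root_subsingleton := p.2.2.2.2 }
  refine small_of_surjective (f := fun p : T => toSkeleton (F p)) fun x => ?_
  induction x using Quotient.inductionOn with
  | _ X =>
  let e : ∀ i, X.S i ≃ Fin (Nat.card (X.S i)) := fun i => Finite.equivFin _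
  let p : T := ⟨⟨fun i => Nat.card (X.S i), fun i j h x => e i (X.f h ((e j).symm x))⟩,
    fun i h x => by simp [X.f_refl], fun i j k h h' x => by simp [X.f_trans],
    X.root_nonempty.map (e 0), by
      have := X.root_subsingleton
      exact (e 0).symm.subsingleton⟩
  refine ⟨p, Quotient.sound ⟨⟨⟨fun i => (e i).symm, fun h x => ?_⟩, ⟨e, fun h x => ?_⟩, ?_, ?_⟩⟩⟩
  · exact (e _).symm_apply_apply _
  · exact congrArg (fun y => e _ (X.f h y)) ((e _).symm_apply_apply x).symm
  · exact LevelTree.Hom.ext (funext fun i => (e i).symm_trans_self)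
  · exact LevelTree.Hom.ext (funext fun i => (e i).self_trans_symm)

variable {C : Type u} [Category.{v} C] [HasLimitsOfSize.{0, 0} C]

instance {n : ℕ} (F : LevelTree n ⥤ C) : (gamma n).HasRightKanExtension F := by
  have := essentiallySmall_levelTree n
  have (T : Core FintypeCat.{0}) : HasLimitsOfShape (StructuredArrow T (gamma n)) C :=
    hasLimitsOfShape_of_essentiallySmall.{0} _ _
  have : (gamma n).HasPointwiseRightKanExtension F := fun T => inferInstance
  infer_instance

/-- The right Kan extension `R_{γ^n} F` of `F` along `γ^n`. -/
abbrev ran {n : ℕ} (F : LevelTree n ⥤ C) : Core FintypeCat.{0} ⥤ C := (gamma n).rightKanExtension F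

/-- The universal transformation `(R_{γ^n} F) γ^n ⟶ F`. -/
abbrev ranι {n : ℕ} (F : LevelTree n ⥤ C) : gamma n ⋙ ran F ⟶ F :=
  (gamma n).rightKanExtensionCounit F

/-- The map `B ⟶ R_{γ^n} F` corresponding to a transformation `B γ^n ⟶ F`. -/
abbrev ranLift {n : ℕ} {F : LevelTree n ⥤ C} {B : Core FintypeCat.{0} ⥤ C} (t : gamma n ⋙ B ⟶ F) :
    B ⟶ ran F :=
  (ran F).liftOfIsRightKanExtension (ranι F) B t

/-- Functoriality of right Kan extension: `R_{γ^n} t`. -/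
def ranMap {n : ℕ} {F G : LevelTree n ⥤ C} (t : F ⟶ G) : ran F ⟶ ran G :=
  ranLift (ranι F ≫ t)

variable [MonoidalCategory C] [SymmetricCategory C]

/-- The canonical comparison map `R_{γ^m} F ⟶ R_{γ^n} (F φ^*)`, induced by
`(R_{γ^m} F) γ^n = (R_{γ^m} F) γ^m φ^* ⟶ F φ^*`. -/
def ranCompare {m n : ℕ} (φ : EndMap m n) (F : LevelTree m ⥤ C) : ran F ⟶ ran (pull φ ⋙ F) :=
  ranLift (restrict φ (ranι F))

/-- The composition power `O^{∘̂ n} = O ∘̂ ⋯ ∘̂ O`, the right Kan extension of `O^{⊚ n}` along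
`γ^n`. -/
abbrev compPow (A : SymSeq C) (n : ℕ) : SymSeq C := ran (circPow A n)

namespace PreCooperad

variable (P : PreCooperad C)

/-- The coface map `Δ^{n+1}_{k+1} : O^{∘̂ n} ⟶ O^{∘̂ (n+1)}`, where `k + 1 = 1, …, n`. -/
def coface {n : ℕ} (k : Fin n) : compPow P.O n ⟶ compPow P.O (n + 1) :=
  ranCompare (EndMap.face k) (circPow P.O n) ≫ ranMap (P.treeCoface k)

/-- The codegeneracy map `ε^n_i : O^{∘̂ (n+1)} ⟶ O^{∘̂ n}`, where `i = 0, …, n`. -/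
def codegen {n : ℕ} (i : Fin (n + 1)) : compPow P.O (n + 1) ⟶ compPow P.O n :=
  ranCompare (EndMap.degen i) (circPow P.O (n + 1)) ≫ ranMap (P.treeCodegen i)

end PreCooperad

end Kan

/-- Coaugmented cosimplicial objects with two extra codegeneracies, given by cofaces `d` and
codegeneracies `s`. In the usual numbering `X 0` has cosimplicial degree `-1`, so that
`d : X 0 ⟶ X 1` is the coaugmentation, `X (k + 1)` has degree `k`, and among the `k + 3`
codegeneracies `X (k + 2) ⟶ X (k + 1)` the first and the last one are extra. -/
structure IsCoaugmentedCosimplicialWithTwoExtra {D : Type*} [Category D] (X : ℕ → D)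
    (d : ∀ k, Fin (k + 1) → (X k ⟶ X (k + 1))) (s : ∀ k, Fin (k + 2) → (X (k + 1) ⟶ X k)) :
    Prop where
  /-- `d_j d_i = d_i d_{j-1}` for `i < j`. -/
  d_comp_d : ∀ k (i j : Fin (k + 1)), i ≤ j →
    d k i ≫ d (k + 1) j.succ = d k j ≫ d (k + 1) i.castSucc
  /-- `s_i s_j = s_{j-1} s_i` for `i < j`. -/
  s_comp_s : ∀ k (i j : Fin (k + 2)), i ≤ j →
    s (k + 1) j.succ ≫ s k i = s (k + 1) i.castSucc ≫ s k j
  /-- `s_i d_i = 1`. -/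
  d_comp_s_castSucc : ∀ k (i : Fin (k + 1)), d k i ≫ s k i.castSucc = 𝟙 (X k)
  /-- `s_{i+1} d_i = 1`. -/
  d_comp_s_succ : ∀ k (i : Fin (k + 1)), d k i ≫ s k i.succ = 𝟙 (X k)
  /-- `s_j d_i = d_{i-1} s_j` for `j < i`. -/
  d_comp_s_of_lt : ∀ k (i : Fin (k + 1)) (j : Fin (k + 2)), j ≤ i.castSucc →
    d (k + 1) i.succ ≫ s (k + 1) j.castSucc = s k j ≫ d k i
  /-- `s_j d_i = d_i s_{j-1}` for `i + 1 < j`. -/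
  d_comp_s_of_gt : ∀ k (i : Fin (k + 1)) (j : Fin (k + 2)), i.castSucc < j →
    d (k + 1) i.castSucc ≫ s (k + 1) j.succ = s k j ≫ d k i

end WreathCooperad

end

noncomputable section

namespace WreathCooperad

/-! ### Associativity of iterated unordered tensor products -/

section UnorderedTensor

variable {C : Type u} [Category.{v} C] [MonoidalCategory C] [SymmetricCategory C]
variable {ι κ μ : Type}

/-! All cofaces and codegeneracies are instances of one construction. An end point preserving
monotone map `φ` contracts a tree `X` to `φ^* X`, and each vertex of `φ^* X` stands for a subtree of
`X` whose number of levels is a gap of `φ`. If all gaps are at most 2, `opAlong φ` applies the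
counit, the identity or the cocomposition at each vertex. A map into a right Kan extension is
determined by its composite with `ranι`, so the cosimplicial identities follow once it is known that
`opAlong ψ` followed by `opAlong φ` depends only on `ψ.comp φ`: the identities between the
composites of `face` and `degen` are elementary arithmetic.

The independence is proved locally, in two steps.

Locality (`PreCooperad.opAlong_comp_app`): the composite acts separately on each subtree contracted
by `ψ.comp φ`, by a local operation followed by `opAlong` along the map `loc` which `φ` induces on
the levels of that subtree. This uses no cooperad axiom. It rests on the associativity of iterated
unordered tensor products (`unSigma_assoc`, packaged as `blockMap_comp`) and on the fact that parts
of parts of a tree are parts of the tree (`partHom`, `partPartHom`).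

Uniqueness of local operations (`Cooperad.restrict_localOp`): on a subtree with `g ≤ 3` levels, the
local composite depends only on `g`. If the first operation is the counit or the identity, this is
formal. If it is the cocomposition, the middle level goes to the bottom or the top level, which are
the two counit axioms, or strictly between them; then either `g = 2` and the second operation is the
identity, or `g = 3` and coassociativity applies. Three levels are enough, because no composite of
two maps in the cosimplicial identities has a gap larger than 3.

The claims about the first term hold because `gamma 1` is an equivalence, and because contracting a
whole tree to one vertex applies a single local operation (`PreCooperad.restrict_unitHom_opAlong`).
-/

def Rearr.appendAssoc (k z : List ι) : (l : List ι) → Rearr ((l ++ k) ++ z) (l ++ (k ++ z))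
  | [] => Rearr.refl _
  | a :: l => .cons a (appendAssoc k z l)

/-- The auxiliary lemmas of this kind are inductive steps with the list tensors replaced by
arbitrary objects, so that rewriting does not meet terms that agree only after unfolding
`listTensor` and `append`. -/
theorem append_assoc_aux {A L K Z LK KZ V W : C} (f : L ⊗ K ⟶ LK) (g : LK ⊗ Z ⟶ V) (r : V ⟶ W)
    (h : K ⊗ Z ⟶ KZ) (k : L ⊗ KZ ⟶ W) (ih : f ▷ Z ≫ g ≫ r = (α_ L K Z).hom ≫ L ◁ h ≫ k) :
    ((α_ A L K).hom ≫ A ◁ f) ▷ Z ≫ ((α_ A LK Z).hom ≫ A ◁ g) ≫ A ◁ r =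
      (α_ (A ⊗ L) K Z).hom ≫ (A ⊗ L) ◁ h ≫ (α_ A L KZ).hom ≫ A ◁ k := by
  have ih' := congrArg (fun t => (α_ A (L ⊗ K) Z).hom ≫ A ◁ t) ih
  simp only [whiskerLeft_comp] at ih'
  simp only [comp_whiskerRight, Category.assoc, associator_naturality_middle_assoc, ih']
  simp

theorem append_assoc (X : ι → C) (l k z : List ι) :
    append X l k ▷ listTensor X z ≫ append X (l ++ k) z ≫ (Rearr.appendAssoc k z l).eval X =
      (α_ _ _ _).hom ≫ listTensor X l ◁ append X k z ≫ append X l (k ++ z) := by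
  induction l with
  | nil =>
    have h := Rearr.eval_refl X (k ++ z)
    refine (congrArg (fun t => (λ_ (listTensor X k)).hom ▷ listTensor X z ≫ append X k z ≫ t)
      h).trans ?_
    dsimp only [append, listTensor]
    simp
  | cons a l ih => exact append_assoc_aux _ _ _ _ _ ih

theorem flat_append_aux {A A' L L' K K' LK E F G H M N : C} (ap : L ⊗ K ⟶ LK) (s : A ⟶ A')
    (w : LK ⟶ E) (ap₁ : A' ⊗ E ⟶ G) (q : E ⟶ F) (x : L ⟶ L') (y : K ⟶ K') (ap₄ : L' ⊗ K' ⟶ F)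
    (ap₅ : A' ⊗ F ⟶ H) (R : G ⟶ H) (ap₂ : A' ⊗ L' ⟶ M) (ap₃ : M ⊗ K' ⟶ N) (S : N ⟶ H) (S' : H ⟶ N)
    (ih : ap ≫ w ≫ q = (x ⊗ₘ y) ≫ ap₄) (hR : A' ◁ q ≫ ap₅ = ap₁ ≫ R)
    (hS : ap₂ ▷ K' ≫ ap₃ ≫ S = (α_ A' L' K').hom ≫ A' ◁ ap₄ ≫ ap₅) (hS' : S ≫ S' = 𝟙 _) :
    ((α_ A L K).hom ≫ A ◁ ap) ≫ ((s ⊗ₘ w) ≫ ap₁) ≫ (R ≫ S') =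
      (((s ⊗ₘ x) ≫ ap₂) ⊗ₘ y) ≫ ap₃ := by
  have h₁ : (((s ⊗ₘ x) ≫ ap₂) ⊗ₘ y) ≫ ap₃ = ((s ⊗ₘ x) ⊗ₘ y) ≫ (ap₂ ▷ K' ≫ ap₃ ≫ S) ≫ S' := by
    simp only [Category.assoc, hS', Category.comp_id, tensorHom_comp_whiskerRight_assoc]
  rw [h₁, hS]
  simp only [Category.assoc]
  rw [associator_naturality_assoc, tensorHom_comp_whiskerLeft_assoc, ← ih,
    ← reassoc_of% hR, tensorHom_comp_whiskerLeft_assoc, whiskerLeft_comp_tensorHom_assoc]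

variable {κ' : ι → Type}

/-- The two lists are equal, but not definitionally, so they are compared through some
rearrangement. Which one is immaterial: `eval_ins` absorbs every rearrangement of an enumeration. -/
theorem flat_append (Y : ∀ i, κ' i → C) (m : ∀ i, List (κ' i)) (x y : List ι) :
    ∃ q : Rearr (blocks m (x ++ y)) (blocks m x ++ blocks m y),
      append _ x y ≫ flat Y m (x ++ y) ≫ q.eval _ = (flat Y m x ⊗ₘ flat Y m y) ≫ append _ _ _ := by
  induction x with
  | nil =>
    have h := Rearr.eval_refl (fun p : Σ i, κ' i => Y p.1 p.2) (blocks m y)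
    refine ⟨Rearr.refl _, (congrArg (fun t => (λ_ _).hom ≫ flat Y m y ≫ t) h).trans ?_⟩
    exact (by simp : (λ_ _).hom ≫ flat Y m y ≫ 𝟙 _ = (𝟙 (𝟙_ C) ⊗ₘ flat Y m y) ≫ (λ_ _).hom)
  | cons a x ih =>
    obtain ⟨q, hq⟩ := ih
    exact ⟨.trans (q.appendLeft _) (Rearr.appendAssoc _ _ _).symm,
      flat_append_aux _ _ _ _ _ _ _ _ _ _ _ _ _ _ hq (append_appendLeft _ q _)
        (append_assoc _ _ _ _) (Rearr.eval_symm _ _).1⟩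

/-- Reassociation of an iterated disjoint union. -/
abbrev sigmaReassoc {μ : ∀ i, κ' i → Type} (p : Σ i, Σ j, μ i j) : Σ q : Σ i, κ' i, μ q.1 q.2 :=
  ⟨⟨p.1, p.2.1⟩, p.2.2⟩

theorem sigmaReassoc_bijective {μ : ∀ i, κ' i → Type} :
    Function.Bijective (sigmaReassoc (μ := μ)) :=
  Function.bijective_iff_has_inverse.2
    ⟨fun p => ⟨p.1.1, ⟨p.1.2, p.2⟩⟩, fun _ => rfl, fun _ => rfl⟩

theorem flat_flat_aux {A A' B B' P P₁ P₂ Q Q₁ Q₂ D₁ D₂ D₃ E₁ E₂ E₃ F : C} (fa : A ⟶ A')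
    (fb : B ⟶ B') (s : A' ⟶ P) (t : B' ⟶ Q) (ap : P ⊗ Q ⟶ D₁) (r : D₁ ⟶ D₂) (ma : D₂ ⟶ D₃)
    (ra : P ⟶ P₁) (rb : Q ⟶ Q₁) (ap₁ : P₁ ⊗ Q₁ ⟶ D₃) (qa : P₁ ⟶ P₂) (qb : Q₁ ⟶ Q₂)
    (R : D₃ ⟶ E₁) (S : E₁ ⟶ E₂) (ap₂ : P₂ ⊗ Q₁ ⟶ E₁) (ap₃ : P₂ ⊗ Q₂ ⟶ E₂) (S' : E₂ ⟶ E₃)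
    (S'' : E₃ ⟶ E₂)
    {M N : C} (u : A ⟶ M) (w : B ⟶ N) (ap₄ : M ⊗ N ⟶ F) (fl : F ⟶ E₃) (fM : M ⟶ P₂) (fN : N ⟶ Q₂)
    (h₁ : ap ≫ r ≫ ma = (ra ⊗ₘ rb) ≫ ap₁) (h₂ : qa ▷ Q₁ ≫ ap₂ = ap₁ ≫ R)
    (h₃ : P₂ ◁ qb ≫ ap₃ = ap₂ ≫ S) (hA : fa ≫ s ≫ ra ≫ qa = u ≫ fM)
    (hB : fb ≫ t ≫ rb ≫ qb = w ≫ fN) (h₄ : ap₄ ≫ fl ≫ S'' = (fM ⊗ₘ fN) ≫ ap₃)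
    (hS : S'' ≫ S' = 𝟙 _) :
    (fa ⊗ₘ fb) ≫ ((s ⊗ₘ t) ≫ ap) ≫ r ≫ (ma ≫ (R ≫ (S ≫ S'))) =
      ((u ⊗ₘ w) ≫ ap₄) ≫ fl := by
  have h₄' := congrArg (fun z => (u ⊗ₘ w) ≫ z ≫ S') h₄
  simp only [Category.assoc, hS, Category.comp_id] at h₄' ⊢
  rw [h₄', tensorHom_comp_tensorHom_assoc, tensorHom_comp_tensorHom_assoc u, ← hA, ← hB,
    reassoc_of% h₁, ← reassoc_of% h₂,
    ← reassoc_of% h₃]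
  simp only [tensorHom_comp_tensorHom_assoc, tensorHom_comp_whiskerRight_assoc,
    tensorHom_comp_whiskerLeft_assoc, Category.assoc]

/-- The list form of associativity: flattening inside each block first, or over the outer index
first, gives the same map up to a rearrangement. In the inductive step `flat_reindex` along
`Sigma.mk a` treats the head, and `flat_append` splits the outer flattening into head and tail. -/
theorem flat_flat {μ : ∀ i, κ' i → Type} (Y : ∀ i j, μ i j → C) (n : ∀ i j, List (μ i j))
    (m : ∀ i, List (κ' i)) (l : List ι) :
    ∃ q : Rearr ((blocks (fun i => blocks (n i) (m i)) l).map sigmaReassoc)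
        (blocks (fun p : Σ i, κ' i => n p.1 p.2) (blocks m l)),
      listHom (fun i => flat (Y i) (n i) (m i)) l ≫
        flat (fun i (p : Σ j, μ i j) => Y i p.1 p.2) (fun i => blocks (n i) (m i)) l ≫
        listMap (Y := fun p : Σ q : Σ i, κ' i, μ q.1 q.2 => Y p.1.1 p.1.2 p.2) sigmaReassoc
          (fun p => 𝟙 (Y p.1 p.2.1 p.2.2)) _ ≫ q.eval _ =
      flat (fun i j => listTensor (Y i j) (n i j)) m l ≫
        flat (fun (p : Σ i, κ' i) k => Y p.1 p.2 k) (fun p => n p.1 p.2) (blocks m l) := by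
  induction l with
  | nil => exact ⟨.nil, by
      change 𝟙 (𝟙_ C) ≫ 𝟙 (𝟙_ C) ≫ 𝟙 (𝟙_ C) ≫ 𝟙 (𝟙_ C) = 𝟙 (𝟙_ C) ≫ 𝟙 (𝟙_ C)
      simp only [Category.comp_id]⟩
  | cons a l ih =>
    obtain ⟨qb, hqb⟩ := ih
    obtain ⟨qa, hqa⟩ := flat_reindex (fun (p : Σ i, κ' i) (k : μ p.1 p.2) => Y p.1 p.2 k)
      (Sigma.mk a) (fun p => n p.1 p.2) (m a)
    obtain ⟨S, hS⟩ := flat_append (fun (p : Σ i, κ' i) (k : μ p.1 p.2) => Y p.1 p.2 k)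
      (fun p => n p.1 p.2) ((m a).map (Sigma.mk a)) (blocks m l)
    -- The two successive relabellings of the head block combine to the one that occurs in
    -- `flat_reindex`; the factors `𝟙 ≫ 𝟙` are collapsed by `hid`.
    have hm := listMap_comp (Y := fun p : Σ i, Σ j, μ i j => Y p.1 p.2.1 p.2.2)
      (Z := fun p : Σ q : Σ i, κ' i, μ q.1 q.2 => Y p.1.1 p.1.2 p.2) (Sigma.mk a) sigmaReassoc
      (fun p : Σ j, μ a j => 𝟙 (Y a p.1 p.2)) (fun p => 𝟙 (Y p.1 p.2.1 p.2.2))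
      (blocks (n a) (m a))
    have hid : (fun p : Σ j, μ a j => 𝟙 (Y a p.1 p.2) ≫ 𝟙 (Y a p.1 p.2)) =
        fun p : Σ j, μ a j => 𝟙 (Y a p.1 p.2) := funext fun p => Category.comp_id _
    replace hm := hm.trans (congrArg (fun t => listMap
      (Y := fun p : Σ q : Σ i, κ' i, μ q.1 q.2 => Y p.1.1 p.1.2 p.2) (sigmaReassoc ∘ Sigma.mk a) t
      (blocks (n a) (m a))) hid)
    refine ⟨.trans (Rearr.mapAppend _ _ _) (.trans
      (((Rearr.mapMap _ _ _).trans qa).appendRight _) (.trans (qb.appendLeft _) S.symm)), ?_⟩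
    refine flat_flat_aux _ _ _ _ _ _ _ _ _ _ _ _ _ _ _ _ _ _ _ _ _ _ _ _ (append_listMap _ _ _ _)
      (append_appendRight _ _ _) (append_appendLeft _ qb _) ?_ hqb hS (Rearr.eval_symm _ S).1
    refine Eq.trans ?_ hqa.symm
    refine congrArg (flat (Y a) (n a) (m a) ≫ ·) ?_
    exact (congrArg (_ ≫ ·) (Category.assoc _ _ _).symm).trans 
      ((Category.assoc _ _ _).symm.trans (congrArg (· ≫ qa.eval _) hm))

/-- Computed on the chosen enumerations with `ins_unSigma`, the two sides become those of
`flat_flat`, and coherence removes the remaining rearrangement. -/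
theorem unSigma_assoc [Finite ι] {μ : ∀ i, κ' i → Type} [∀ i, Finite (κ' i)]
    [∀ i j, Finite (μ i j)] (Y : ∀ i j, μ i j → C) :
    unMap (Y := fun i => unTensor fun p : Σ j, μ i j => Y i p.1 p.2) id Function.bijective_id
        (fun i => unSigma (Y i)) ≫
      unSigma (fun i (p : Σ j, μ i j) => Y i p.1 p.2) ≫
      unMap (Y := fun p : Σ q : Σ i, κ' i, μ q.1 q.2 => Y p.1.1 p.1.2 p.2) sigmaReassoc
        sigmaReassoc_bijective (fun p => 𝟙 (Y p.1 p.2.1 p.2.2)) =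
    unSigma (fun i j => unTensor (Y i j)) ≫ unSigma (fun (p : Σ i, κ' i) k => Y p.1 p.2 k) := by
  obtain ⟨q, hq⟩ := flat_flat Y (fun i j => enum (μ i j)) (fun i => enum (κ' i)) (enum ι)
  have hm := fun i => isEnum_enum (κ' i)
  have hn := fun i j => isEnum_enum (μ i j)
  have h₁ := ins_unSigma (fun i (p : Σ j, μ i j) => Y i p.1 p.2) _ (isEnum_enum ι) _
    (fun i => isEnum_blocks (hn i) (hm i))
  have h₂ := ins_unSigma (fun (p : Σ i, κ' i) k => Y p.1 p.2 k) _
    (isEnum_blocks hm (isEnum_enum ι)) _ (fun p => hn p.1 p.2)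
  simp only [ins_enum, listHom_id, Category.id_comp] at h₁ h₂
  have h₃ : unMap (Y := fun i => unTensor fun p : Σ j, μ i j => Y i p.1 p.2) id
      Function.bijective_id (fun i => unSigma (Y i)) = _ := unMap_eq_listHom _
  rw [h₃, unSigma.eq_1 (fun i j => unTensor (Y i j)), Category.assoc, h₂, ← Category.assoc (flat _ _ _), ← hq]
  have h₄ : listHom (fun i => unSigma (Y i)) (enum ι) = _ :=
    (listHom_comp (fun i => flat (Y i) (fun j => enum (μ i j)) (enum (κ' i)))
      (fun i => ins _ _ (isEnum_blocks (hn i) (hm i))) (enum ι)).symm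
  rw [h₄, Category.assoc, reassoc_of% h₁, ins_unMap]
  simp only [Category.assoc]
  rw [eval_ins]

end UnorderedTensor

/-! ### Block maps: splitting each factor of an unordered tensor product -/

section BlockMap

variable {C : Type u} [Category.{v} C] [MonoidalCategory C] [SymmetricCategory C]
variable {ι κ θ : Type} {κ' : ι → Type}

/-- Map the factors `A i` to tensor products `⨂_j Y i j`, and identify the factors `Y i j` with
those of a second tensor product. -/
def blockMap [Finite ι] [∀ i, Finite (κ' i)] [Finite κ] {A : ι → C} {Y : ∀ i, κ' i → C} {B : κ → C}
    (f : ∀ i, A i ⟶ unTensor (Y i)) (e : (Σ i, κ' i) → κ) (he : Function.Bijective e)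
    (h : ∀ p : Σ i, κ' i, Y p.1 p.2 ⟶ B (e p)) : unTensor A ⟶ unTensor B :=
  unMap (Y := fun i => unTensor (Y i)) id Function.bijective_id f ≫ unSigma Y ≫ unMap e he h

/-- This and the next two are cases of `unMap_comp` in which the composite index map contains `id`;
they are stated with the `id` already removed so that they can be used for rewriting. -/
theorem unMap_id_comp_id [Finite ι] {X Y Z : ι → C} (f : ∀ i, X i ⟶ Y i) (g : ∀ i, Y i ⟶ Z i) :
    unMap id Function.bijective_id f ≫ unMap id Function.bijective_id g =
      unMap (Y := Z) id Function.bijective_id (fun i => f i ≫ g i) :=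
  unMap_comp _ _ _ _ _ _

theorem unMap_id_comp [Finite ι] [Finite κ] {X Y : ι → C} {Z : κ → C} (e : ι → κ)
    (he : Function.Bijective e) (f : ∀ i, X i ⟶ Y i) (g : ∀ i, Y i ⟶ Z (e i)) :
    unMap id Function.bijective_id f ≫ unMap e he g = unMap e he (fun i => f i ≫ g i) :=
  unMap_comp _ _ _ _ _ _

theorem unMap_comp_id [Finite ι] [Finite κ] {X : ι → C} {Y Z : κ → C} (e : ι → κ)
    (he : Function.Bijective e) (f : ∀ i, X i ⟶ Y (e i)) (g : ∀ i, Y i ⟶ Z i) :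
    unMap e he f ≫ unMap id Function.bijective_id g = unMap e he (fun i => f i ≫ g (e i)) :=
  unMap_comp _ _ _ _ _ _

variable [Finite ι] [∀ i, Finite (κ' i)] [Finite κ] [Finite θ]

/-- By naturality of `unSigma` in the outer index set, the reindexing moves past the flattening and
into `e`. The lemma `blockMap_unMap` does the same for the inner index sets. -/
theorem unMap_blockMap {ι₀ : Type} [Finite ι₀] {A₀ : ι₀ → C} {A : ι → C} {Y : ∀ i, κ' i → C}
    {B : κ → C} (c : ι₀ → ι) (hc : Function.Bijective c) (γ : ∀ i, A₀ i ⟶ A (c i))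
    (f : ∀ i, A i ⟶ unTensor (Y i)) (e : (Σ i, κ' i) → κ) (he : Function.Bijective e)
    (h : ∀ p : Σ i, κ' i, Y p.1 p.2 ⟶ B (e p)) :
    unMap c hc γ ≫ blockMap f e he h =
      blockMap (Y := fun i => Y (c i)) (B := B) (fun i => γ i ≫ f (c i))
        (fun p => e ⟨c p.1, p.2⟩)
        (he.comp (bijective_sigma (κ'' := κ') hc fun _ => Function.bijective_id))
        (fun p => h ⟨c p.1, p.2⟩) := by
  have h₁ := unSigma_reindex Y c hc
  have h₂ := unMap_id_comp (Y := fun i => unTensor (Y (c i))) (Z := fun i => unTensor (Y i)) c hc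
    (fun i => γ i ≫ f (c i)) (fun i => 𝟙 _)
  have h₃ := unMap_comp (Z := B) (fun p : Σ i, κ' (c i) => (⟨c p.1, p.2⟩ : Σ i, κ' i))
    (bijective_sigma hc fun _ => Function.bijective_id) e he (fun p => 𝟙 (Y (c p.1) p.2)) h
  simp only [Category.comp_id, Category.id_comp] at h₂ h₃
  rw [blockMap, reassoc_of% unMap_comp_id, ← h₂, Category.assoc, reassoc_of% h₁, h₃]
  rfl

theorem blockMap_unMap {κ'' : ι → Type} [∀ i, Finite (κ'' i)] {A : ι → C} {Y : ∀ i, κ' i → C}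
    {Y' : ∀ i, κ'' i → C} {B : κ → C} (f : ∀ i, A i ⟶ unTensor (Y i)) (d : ∀ i, κ' i → κ'' i)
    (hd : ∀ i, Function.Bijective (d i)) (k : ∀ i j, Y i j ⟶ Y' i (d i j))
    (e : (Σ i, κ'' i) → κ) (he : Function.Bijective e)
    (h : ∀ p : Σ i, κ'' i, Y' p.1 p.2 ⟶ B (e p)) :
    blockMap (fun i => f i ≫ unMap (d i) (hd i) (k i)) e he h =
      blockMap (Y := Y) (B := B) f (fun p => e ⟨p.1, d p.1 p.2⟩)
        (he.comp (bijective_sigma (κ'' := κ'') Function.bijective_id hd))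
        (fun p => k p.1 p.2 ≫ h ⟨p.1, d p.1 p.2⟩) := by
  have h₁ := unSigma_map Y Y' d hd k
  have h₂ := unMap_id_comp_id (Z := fun i => unTensor (Y' i)) f
    (fun i => unMap (d i) (hd i) (k i))
  have h₃ := unMap_comp (Z := B) (fun p : Σ i, κ' i => (⟨p.1, d p.1 p.2⟩ : Σ i, κ'' i))
    (bijective_sigma Function.bijective_id hd) e he (fun p => k p.1 p.2) h
  rw [blockMap, ← h₂, Category.assoc, reassoc_of% h₁, h₃]
  rfl

theorem blockMap_congr {A : ι → C} {Y : ∀ i, κ' i → C} {B : κ → C}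
    {f f' : ∀ i, A i ⟶ unTensor (Y i)} {e e' : (Σ i, κ' i) → κ} (he : Function.Bijective e)
    (he' : Function.Bijective e') {h : ∀ p : Σ i, κ' i, Y p.1 p.2 ⟶ B (e p)}
    {h' : ∀ p : Σ i, κ' i, Y p.1 p.2 ⟶ B (e' p)} (hf : ∀ i, f i = f' i) (hee : ∀ p, e p = e' p)
    (hh : ∀ p, h p ≫ eqToHom (congrArg B (hee p)) = h' p) :
    blockMap f e he h = blockMap f' e' he' h' := by
  obtain rfl : f = f' := funext hf
  rw [blockMap, blockMap, unMap_congr he he' hee h h' hh]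

theorem blockMap_comp_aux {P₀ P₁ P₂ P₃ P₄ P₅ Q₂ R₃ R₄ : C} (a : P₀ ⟶ P₁) (s : P₁ ⟶ P₂)
    (m : P₂ ⟶ P₃) (t : P₃ ⟶ P₄) (u : P₄ ⟶ P₅) (m' : P₁ ⟶ Q₂) (s' : Q₂ ⟶ P₃)
    (h₁ : m' ≫ s' = s ≫ m) (n : Q₂ ⟶ R₃) (r : R₃ ⟶ R₄) (w : R₄ ⟶ P₄)
    (h₂ : n ≫ r ≫ w = s' ≫ t) (b : P₀ ⟶ R₃) (hb : (a ≫ m') ≫ n = b) (x : R₄ ⟶ P₅)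
    (hx : w ≫ u = x) : a ≫ s ≫ m ≫ t ≫ u = b ≫ r ≫ x := by
  rw [← reassoc_of% h₁, ← reassoc_of% h₂, ← hb, ← hx]
  simp only [Category.assoc]

/-- By `unSigma_assoc`, splitting every `A i` into factors and then splitting those again can be
carried out inside each `i` before flattening over `i`. The data `E`, `H` regroup the final factors
belonging to `i`, and `F`, `K` place them in the target; `hFE` and `hKH` require this two-stage
placement to agree with `e'`, `h'`. -/
theorem blockMap_comp {A : ι → C} {Y : ∀ i, κ' i → C} {B : κ → C}
    (f : ∀ i, A i ⟶ unTensor (Y i)) (e : (Σ i, κ' i) → κ) (he : Function.Bijective e)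
    (h : ∀ p : Σ i, κ' i, Y p.1 p.2 ⟶ B (e p))
    {κ'' : κ → Type} [∀ k, Finite (κ'' k)] {Y' : ∀ k, κ'' k → C} {D : θ → C}
    (f' : ∀ k, B k ⟶ unTensor (Y' k)) (e' : (Σ k, κ'' k) → θ) (he' : Function.Bijective e')
    (h' : ∀ p : Σ k, κ'' k, Y' p.1 p.2 ⟶ D (e' p))
    {ρ : ι → Type} [∀ i, Finite (ρ i)] {Q : ∀ i, ρ i → C}
    (E : ∀ i, (Σ j : κ' i, κ'' (e ⟨i, j⟩)) → ρ i) (hE : ∀ i, Function.Bijective (E i))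
    (H : ∀ i, ∀ p : Σ j : κ' i, κ'' (e ⟨i, j⟩), Y' (e ⟨i, p.1⟩) p.2 ⟶ Q i (E i p))
    (F : (Σ i, ρ i) → θ) (hF : Function.Bijective F) (K : ∀ p : Σ i, ρ i, Q p.1 p.2 ⟶ D (F p))
    (hFE : ∀ i j w, F ⟨i, E i ⟨j, w⟩⟩ = e' ⟨e ⟨i, j⟩, w⟩)
    (hKH : ∀ i j w, H i ⟨j, w⟩ ≫ K ⟨i, E i ⟨j, w⟩⟩ ≫ eqToHom (congrArg D (hFE i j w)) =
      h' ⟨e ⟨i, j⟩, w⟩) :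
    blockMap f e he h ≫ blockMap f' e' he' h' =
      blockMap (fun i => f i ≫ blockMap (A := Y i) (Y := fun j => Y' (e ⟨i, j⟩))
        (fun j => h ⟨i, j⟩ ≫ f' (e ⟨i, j⟩)) (E i) (hE i) (H i)) F hF K := by
  -- The last step of each inner block map, the reindexing by `E`, is absorbed into `F`; after this
  -- both sides are chains of `unMap` and `unSigma`.
  have hR := blockMap_unMap (B := D) (fun i => f i ≫ unMap (Y := fun j => unTensor (Y' (e ⟨i, j⟩)))
    id Function.bijective_id (fun j => h ⟨i, j⟩ ≫ f' (e ⟨i, j⟩)) ≫ unSigma _) E hE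
    (fun i p => H i p) F hF K
  simp only [Category.assoc] at hR
  refine Eq.trans ?_ hR.symm
  have h₁ := unSigma_map Y (fun i j => unTensor (Y' (e ⟨i, j⟩))) (fun _ => id)
    (fun _ => Function.bijective_id) (fun i j => h ⟨i, j⟩ ≫ f' (e ⟨i, j⟩))
  have h₂ := unSigma_assoc (fun i (j : κ' i) (k : κ'' (e ⟨i, j⟩)) => Y' (e ⟨i, j⟩) k)
  have h₃ := unMap_blockMap (B := D) e he h f' e' he' h'
  rw [blockMap, Category.assoc, Category.assoc, h₃]
  dsimp only [blockMap]
  refine blockMap_comp_aux _ _ _ _ _ _ _ h₁ _ _ _ h₂ _ ?_ _ ?_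
  · rw [unMap_id_comp_id, unMap_id_comp_id]
    exact congrArg (unMap id Function.bijective_id) (funext fun i => Category.assoc _ _ _)
  refine (unMap_comp _ _ _ _ _ _).trans ?_
  refine unMap_congr _ _ (fun p : Σ i, Σ j : κ' i, κ'' (e ⟨i, j⟩) =>
    (hFE p.1 p.2.1 p.2.2).symm) _ _ fun p => ?_
  rw [Category.id_comp, ← hKH p.1 p.2.1 p.2.2]
  simp

/-- Removing an empty list at the end. -/
def Rearr.appendNil : (l : List ι) → Rearr (l ++ []) l
  | [] => .nil
  | a :: l => .cons a (appendNil l)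

theorem append_nil (X : ι → C) (l : List ι) :
    (ρ_ (listTensor X l)).inv ≫ append X l [] ≫ (Rearr.appendNil l).eval X = 𝟙 _ := by
  induction l with
  | nil =>
    exact (by simp [unitors_equal] : (ρ_ (𝟙_ C)).inv ≫ (λ_ (𝟙_ C)).hom ≫ 𝟙 _ = 𝟙 _)
  | cons a l ih =>
    have aux : ∀ {A L M : C} (p : L ⊗ 𝟙_ C ⟶ M) (q : M ⟶ L) (_ : (ρ_ L).inv ≫ p ≫ q = 𝟙 _),
        (ρ_ (A ⊗ L)).inv ≫ ((α_ A L (𝟙_ C)).hom ≫ A ◁ p) ≫ A ◁ q = 𝟙 _ := by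
      intro A L M p q h
      have h' := congrArg (A ◁ ·) h
      simpa using h'
    exact aux _ _ ih

theorem mk_bijective {s : ι} (hs : IsEnum [s]) :
    Function.Bijective (fun w : κ' s => (⟨s, w⟩ : Σ i, κ' i)) := by
  refine ⟨sigma_mk_injective, ?_⟩
  rintro ⟨i, w⟩
  obtain rfl := List.mem_singleton.1 (hs.2 i)
  exact ⟨w, rfl⟩

/-- With a one-element outer index set, flattening only appends the empty list to the single block,
and by `append_nil` this cancels the right unitor. -/
theorem ins_unSigma_singleton (Y : ∀ i, κ' i → C) (s : ι) (hs : IsEnum [s]) :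
    (ρ_ (unTensor (Y s))).inv ≫ ins (fun i => unTensor (Y i)) [s] hs ≫ unSigma Y =
      unMap (Y := fun p : Σ i, κ' i => Y p.1 p.2) (fun w => ⟨s, w⟩) (mk_bijective hs)
        (fun w => 𝟙 (Y s w)) := by
  have hm := fun i => isEnum_enum (κ' i)
  have h := ins_unSigma Y [s] hs _ hm
  simp only [ins_enum, listHom_id, Category.id_comp] at h
  have h₁ := append_nil (fun p : Σ i, κ' i => Y p.1 p.2) ((enum (κ' s)).map (Sigma.mk s))
  have h₂ := eval_ins (fun p : Σ i, κ' i => Y p.1 p.2) (isEnum_blocks hm hs)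
    ((isEnum_enum (κ' s)).map (mk_bijective hs)) (Rearr.appendNil _)
  have aux : ∀ {A B D E : C} (a : A ⟶ B) (p : B ⊗ 𝟙_ C ⟶ D) (q : D ⟶ B) (i : B ⟶ E) (j : D ⟶ E)
      (_ : (ρ_ B).inv ≫ p ≫ q = 𝟙 _) (_ : q ≫ i = j),
      (ρ_ A).inv ≫ ((a ⊗ₘ 𝟙 (𝟙_ C)) ≫ p) ≫ j = a ≫ i := by
    intro A B D E a p q i j h h'
    rw [← h', tensorHom_id, Category.assoc, ← rightUnitor_inv_naturality_assoc, reassoc_of% h]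
  exact (congrArg ((ρ_ (unTensor (Y s))).inv ≫ ·) h).trans (aux _ _ _ _ _ h₁ h₂)

/-- The case of a contracted tree with a single vertex: the block map reduces to the one map `f s`.
-/
theorem ins_blockMap_singleton {A : ι → C} {Y : ∀ i, κ' i → C} {B : κ → C}
    (f : ∀ i, A i ⟶ unTensor (Y i)) (e : (Σ i, κ' i) → κ) (he : Function.Bijective e)
    (h : ∀ p : Σ i, κ' i, Y p.1 p.2 ⟶ B (e p)) (s : ι) (hs : IsEnum [s]) :
    (ρ_ (A s)).inv ≫ ins A [s] hs ≫ blockMap f e he h =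
      f s ≫ unMap (Y := B) (fun w => e ⟨s, w⟩) (he.comp (mk_bijective hs)) (fun w => h ⟨s, w⟩) := by
  have h₁ := ins_unMap (Y := fun i => unTensor (Y i)) id Function.bijective_id f [s] hs
  have h₂ := ins_unSigma_singleton Y s hs
  have h₃ := unMap_comp (Z := B) (fun w => (⟨s, w⟩ : Σ i, κ' i)) (mk_bijective hs) e he
    (fun w => 𝟙 (Y s w)) h
  simp only [Category.id_comp] at h₃
  have h₄ : (ρ_ (A s)).inv ≫ listMap (Y := fun i => unTensor (Y i)) id f [s] =
      f s ≫ (ρ_ (unTensor (Y s))).inv :=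
    (by simp : (ρ_ (A s)).inv ≫ (f s ⊗ₘ 𝟙 (𝟙_ C)) = f s ≫ (ρ_ (unTensor (Y s))).inv)
  have aux : ∀ {P₀ P₁ P₂ P₃ P₄ P₅ Q₁ R : C} (r : P₀ ⟶ P₁) (i : P₁ ⟶ P₂) (m : P₂ ⟶ P₃)
      (t : P₃ ⟶ P₄) (w : P₄ ⟶ P₅) (l : P₁ ⟶ Q₁) (j : Q₁ ⟶ P₃) (_ : i ≫ m = l ≫ j) (g : P₀ ⟶ R)
      (r' : R ⟶ Q₁) (_ : r ≫ l = g ≫ r') (y : R ⟶ P₄) (_ : r' ≫ j ≫ t = y) (x : R ⟶ P₅)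
      (_ : y ≫ w = x), r ≫ i ≫ m ≫ t ≫ w = g ≫ x := by
    intro P₀ P₁ P₂ P₃ P₄ P₅ Q₁ R r i m t w l j h₁ g r' h₂ y h₃ x h₄
    rw [reassoc_of% h₁, reassoc_of% h₂, reassoc_of% h₃, h₄]
  exact aux _ _ _ _ _ _ _ h₁ _ _ h₄ _ h₂ _ h₃

/-- Each one-element block is its factor tensored with the unit of the empty list; the unit
introduced by `ρ⁻¹` disappears again when the block is appended to the rest. -/
theorem exists_flat_singletons (Y : ∀ i, κ' i → C) (s : ∀ i, κ' i) (l : List ι) :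
    ∃ q : Rearr (blocks (fun i => [s i]) l) (l.map fun i => ⟨i, s i⟩),
      listHom (fun i => (ρ_ (Y i (s i))).inv) l ≫ flat Y (fun i => [s i]) l ≫ q.eval _ =
        listMap (Y := fun p : Σ i, κ' i => Y p.1 p.2) (fun i => ⟨i, s i⟩)
          (fun i => 𝟙 (Y i (s i))) l := by
  induction l with
  | nil =>
    exact ⟨.nil, (Category.id_comp _).trans (Category.id_comp _)⟩
  | cons a l ih =>
    obtain ⟨q, hq⟩ := ih
    have aux : ∀ {A L M N : C} (x : L ⟶ M) (y : M ⟶ N) (z : L ⟶ N) (_ : x ≫ y = z),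
        ((ρ_ A).inv ⊗ₘ x) ≫ (((𝟙 A ⊗ₘ 𝟙 (𝟙_ C)) ⊗ₘ 𝟙 M) ≫ ((α_ A (𝟙_ C) M).hom ≫ A ◁ (λ_ M).hom)) ≫
          A ◁ y = 𝟙 A ⊗ₘ z := by
      intro A L M N x y z h
      rw [← h]
      simp [MonoidalCategory.tensorHom_def]
    refine ⟨.cons _ q, Eq.trans ?_ (aux _ _ _ ((Category.assoc _ _ _).trans hq))⟩
    have aux' : ∀ {A L K M N : C} (x : L ⟶ K) (x' : K ⟶ M) (y : M ⟶ N) (r : A ⟶ A ⊗ 𝟙_ C),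
        (r ⊗ₘ x) ≫ (((𝟙 A ⊗ₘ 𝟙 (𝟙_ C)) ⊗ₘ x') ≫ ((α_ A (𝟙_ C) M).hom ≫ A ◁ (λ_ M).hom)) ≫
          A ◁ y = (r ⊗ₘ (x ≫ x')) ≫ (((𝟙 A ⊗ₘ 𝟙 (𝟙_ C)) ⊗ₘ 𝟙 M) ≫
            ((α_ A (𝟙_ C) M).hom ≫ A ◁ (λ_ M).hom)) ≫ A ◁ y := by
      intro A L K M N x x' y r
      simp [MonoidalCategory.tensorHom_def]
    exact aux' _ _ _ _

theorem singletons_bijective {s : ∀ i, κ' i} (hs : ∀ i, IsEnum [s i]) :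
    Function.Bijective (fun i => (⟨i, s i⟩ : Σ i, κ' i)) := by
  refine ⟨fun i j h => congrArg Sigma.fst h, ?_⟩
  rintro ⟨i, w⟩
  obtain rfl := List.mem_singleton.1 ((hs i).2 w)
  exact ⟨i, rfl⟩

theorem unSigma_singletons (Y : ∀ i, κ' i → C) (s : ∀ i, κ' i) (hs : ∀ i, IsEnum [s i]) :
    unMap (Y := fun i => unTensor (Y i)) id Function.bijective_id
        (fun i => (ρ_ (Y i (s i))).inv ≫ ins (Y i) [s i] (hs i)) ≫ unSigma Y =
      unMap (Y := fun p : Σ i, κ' i => Y p.1 p.2) (fun i => ⟨i, s i⟩) (singletons_bijective hs)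
        (fun i => 𝟙 (Y i (s i))) := by
  obtain ⟨q, hq⟩ := exists_flat_singletons Y s (enum ι)
  have h := ins_unSigma Y _ (isEnum_enum ι) _ hs
  simp only [ins_enum, Category.id_comp] at h
  have h₀ : unMap (Y := fun i => unTensor (Y i)) id Function.bijective_id
      (fun i => (ρ_ (Y i (s i))).inv ≫ ins (Y i) [s i] (hs i)) = _ :=
    (unMap_eq_listHom _).trans (listHom_comp (fun i => (ρ_ (Y i (s i))).inv)
      (fun i => ins (Y i) [s i] (hs i)) (enum ι)).symm
  have h₁ := eval_ins (fun p : Σ i, κ' i => Y p.1 p.2) (isEnum_blocks hs (isEnum_enum ι))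
    ((isEnum_enum ι).map (singletons_bijective hs)) q
  have aux : ∀ {P₀ P₁ P₂ P₃ Q R : C} (a : P₀ ⟶ P₁) (b : P₁ ⟶ P₂) (c : P₂ ⟶ P₃) (d : P₁ ⟶ Q)
      (j : Q ⟶ P₃) (r : Q ⟶ R) (j' : R ⟶ P₃) (_ : b ≫ c = d ≫ j) (_ : r ≫ j' = j),
      (a ≫ b) ≫ c = (a ≫ d ≫ r) ≫ j' := by
    intro P₀ P₁ P₂ P₃ Q R a b c d j r j' h₁ h₂
    rw [Category.assoc, h₁, ← h₂, Category.assoc, Category.assoc]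
  rw [h₀, unMap, ← hq]
  exact aux _ _ _ _ _ _ _ h h₁

/-- The opposite degenerate case, needed for contraction along the identity: each factor is split
into a single factor, so no genuine flattening remains. -/
theorem blockMap_singletons {A : ι → C} {Y : ∀ i, κ' i → C} {B : κ → C} (s : ∀ i, κ' i)
    (hs : ∀ i, IsEnum [s i]) (a : ∀ i, A i ⟶ Y i (s i)) (e : (Σ i, κ' i) → κ)
    (he : Function.Bijective e) (h : ∀ p : Σ i, κ' i, Y p.1 p.2 ⟶ B (e p)) :
    blockMap (fun i => a i ≫ (ρ_ (Y i (s i))).inv ≫ ins (Y i) [s i] (hs i)) e he h =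
      unMap (Y := B) (fun i => e ⟨i, s i⟩) (he.comp (singletons_bijective hs))
        (fun i => a i ≫ h ⟨i, s i⟩) := by
  have h₁ := unMap_id_comp_id (Z := fun i => unTensor (Y i)) a
    (fun i => (ρ_ (Y i (s i))).inv ≫ ins (Y i) [s i] (hs i))
  have h₂ := unMap_comp (Z := B) (fun i => (⟨i, s i⟩ : Σ i, κ' i)) (singletons_bijective hs) e he
    (fun i => 𝟙 (Y i (s i))) h
  simp only [Category.id_comp] at h₂
  rw [blockMap, ← h₁, Category.assoc, reassoc_of% unSigma_singletons, h₂]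
  exact unMap_id_comp _ _ _ _

end BlockMap

open LevelTree

/-! ### End point preserving maps: composites and induced maps on gaps -/

namespace EndMap

variable {l m n : ℕ}

theorem ext {φ ψ : EndMap m n} (h : ∀ i, φ.toFun i = ψ.toFun i) : φ = ψ := by
  cases φ; cases ψ
  congr
  exact funext h

/-- The identity map. -/
def id (n : ℕ) : EndMap n n := ⟨fun i => i, monotone_id, rfl, rfl⟩

/-- Composition of end point preserving maps, in diagrammatic order. -/
def comp (ψ : EndMap l m) (φ : EndMap m n) : EndMap l n where
  toFun i := φ.toFun (ψ.toFun i)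
  mono := φ.mono.comp ψ.mono
  zero := by rw [ψ.zero, φ.zero]
  last := by rw [ψ.last, φ.last]

/-- The identity map between two equal ordinals. -/
def cast (h : m = n) : EndMap m n where
  toFun i := Fin.cast (congrArg (· + 1) h) i
  mono _ _ h := h
  zero := rfl
  last := Fin.ext h

/-- The map between the ordinals of levels over the `i`-th gap of `ψ` which `φ` induces. -/
def loc (ψ : EndMap l m) (φ : EndMap m n) (i : Fin l) :
    EndMap (ψ.gap i) ((ψ.comp φ).gap i) where
  toFun j := ⟨φ.toFun (ψ.seg i j) - φ.toFun (ψ.toFun i.castSucc), by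
    have h : (φ.toFun (ψ.seg i j) : ℕ) ≤ φ.toFun (ψ.toFun i.succ) := by
      rw [← ψ.seg_last]
      exact φ.mono (ψ.seg_mono i (Fin.le_last j))
    simp only [gap, comp]
    omega⟩
  mono j j' h := by
    have h : (φ.toFun (ψ.seg i j) : ℕ) ≤ φ.toFun (ψ.seg i j') := φ.mono (ψ.seg_mono i h)
    simp only [Fin.mk_le_mk]
    omega
  zero := by simp [ψ.seg_zero]
  last := by
    ext
    have h := congrArg φ.toFun (ψ.seg_last i)
    simp only [h]
    rfl

variable (ψ : EndMap l m) (φ : EndMap m n) (i : Fin l)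

/-- Monotonicity shows that the natural number subtraction in `loc` does not truncate; in additive
form it can be used by `omega`. -/
theorem loc_val (j : Fin (ψ.gap i + 1)) :
    (φ.toFun (ψ.toFun i.castSucc) : ℕ) + (ψ.loc φ i).toFun j = φ.toFun (ψ.seg i j) := by
  have h : (φ.toFun (ψ.toFun i.castSucc) : ℕ) ≤ φ.toFun (ψ.seg i j) := by
    rw [← ψ.seg_zero]
    exact φ.mono (ψ.seg_mono i (Fin.zero_le j))
  simp only [loc]
  omega

theorem seg_loc (j : Fin (ψ.gap i + 1)) :
    φ.toFun (ψ.seg i j) = (ψ.comp φ).seg i ((ψ.loc φ i).toFun j) :=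
  Fin.ext (ψ.loc_val φ i j).symm

/-- The `j`-th level over the `i`-th gap of `ψ`. -/
abbrev pos (j : Fin (ψ.gap i)) : Fin m :=
  ⟨ψ.toFun i.castSucc + j, by have := ψ.add_gap i; omega⟩

/-- On the levels over the gap, `loc` is `φ` shifted by the constant `φ (ψ i)`, so differences are
unchanged. The equality is not definitional, which is why trees of propositionally equal heights are
compared along `EndMap.cast` below. -/
theorem gap_loc (j : Fin (ψ.gap i)) : φ.gap (ψ.pos i j) = (ψ.loc φ i).gap j := by
  have h₁ : (φ.toFun (ψ.pos i j).castSucc : ℕ) = _ := (ψ.loc_val φ i j.castSucc).symm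
  have h₂ : (φ.toFun (ψ.pos i j).succ : ℕ) = _ := (ψ.loc_val φ i j.succ).symm
  simp only [gap] at h₁ h₂ ⊢
  rw [h₁, h₂]
  omega

theorem seg_pos (j : Fin (ψ.gap i)) (x : Fin (φ.gap (ψ.pos i j) + 1)) :
    φ.seg (ψ.pos i j) x = (ψ.comp φ).seg i
      ((ψ.loc φ i).seg j ((cast (ψ.gap_loc φ i j)).toFun x)) := by
  have h₁ : (φ.toFun (ψ.pos i j).castSucc : ℕ) = _ := (ψ.loc_val φ i j.castSucc).symm
  ext
  simp only [seg, cast, Fin.val_cast] at h₁ ⊢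
  rw [h₁, add_assoc]
  rfl

end EndMap

/-! ### Subtrees of subtrees -/

namespace LevelTree

variable {l m n g g' : ℕ}

/-- Levels of subtrees with equal indices. -/
def fiberCast (X : LevelTree n) {a b c : Fin (n + 1)} (h : a = b) (ha : c ≤ a) (hb : c ≤ b)
    (s : X.S c) : {t : X.S a // X.f ha t = s} ≃ {t : X.S b // X.f hb t = s} :=
  (X.cast h).subtypeEquiv fun t => by
    rw [show X.f hb (X.cast h t) = X.f ha t from X.f_trans _ _ _]

/-- Levels of subtrees of subtrees with equal indices. -/
def nestedFiberCast (X : LevelTree n) {x x' p p' r : Fin (n + 1)} (hx : x = x') (hp : p = p')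
    (h : p ≤ x) (h' : p' ≤ x') (hr : r ≤ p) (hr' : r ≤ x') {w : X.S p} {s : X.S r}
    (hw : X.f hr w = s) (hr'' : r ≤ p')
    (q : ∀ t : {t : X.S x' // X.f hr' t = s}, X.f hr'' (X.f h' t.1) = s)
    (q' : X.f hr'' (X.f hp.ge w) = s) :
    {t : X.S x // X.f h t = w} ≃ {t : {t : X.S x' // X.f hr' t = s} //
      (⟨X.f h' t.1, q t⟩ : {y : X.S p' // X.f hr'' y = s}) = ⟨X.f hp.ge w, q'⟩} where
  toFun t := ⟨⟨X.f hx.ge t.1, by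
      have ht := t.2
      rw [← ht, X.f_trans] at hw
      rw [X.f_trans, ← hw]⟩, Subtype.ext (by
      have ht := congrArg (X.f hp.ge) t.2
      rw [X.f_trans] at ht
      exact (X.f_trans _ _ _).trans ht)⟩
  invFun t := ⟨X.f hx.le t.1.1, by
    have ht := congrArg (X.f hp.le) (congrArg Subtype.val t.2)
    simp only [X.f_trans, X.f_refl] at ht ⊢
    exact ht⟩
  left_inv t := Subtype.ext ((X.f_trans _ _ _).trans (X.f_refl _ _))
  right_inv t := Subtype.ext (Subtype.ext ((X.f_trans _ _ _).trans (X.f_refl _ _)))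

/-- Incoming edges of equal vertices. -/
def inCast (X : LevelTree n) {v v' : X.V} (h : v = v') : X.In v ≃ X.In v' :=
  Equiv.cast (congrArg X.In h)

/-- On underlying elements the cast is a structure map of the chain, so equalities of bijections of
edges reduce to `f_trans` and `f_refl`. -/
theorem inCast_val (X : LevelTree n) {v v' : X.V} (h : v = v') (t : X.In v) :
    (X.inCast h t).1 = X.f (by rw [h]) t.1 := by
  subst h
  exact (X.f_refl _ _).symm

/-- Turns the `eqToHom` appearing in `unMap_congr` and `blockMap_comp` into the value of `A` at a
bijection, which can be checked on elements. -/
theorem map_inCast {C : Type u} [Category.{v} C] (A : SymSeq C) (X : LevelTree n) {v v' : X.V}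
    (h : v = v') {α : Type} [Finite α] (e : α ≃ X.In v) :
    A.map (Sig.map e) ≫ eqToHom (congrArg (fun v => A.obj (Sig.of (X.In v))) h) =
      A.map (Sig.map (e.trans (X.inCast h))) := by
  subst h
  exact Category.comp_id _

variable (ψ : EndMap l m) (φ : EndMap m n) (X : LevelTree n)

/-- The parts of `φ^* X` contracted by `ψ` arise from the parts of `X` by contraction. -/
def partHom (v : ((pull ψ).obj ((pull φ).obj X)).V) :
    ((pull φ).obj X).part ψ v ⟶ (pull (ψ.loc φ v.1)).obj (X.part (ψ.comp φ) v) where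
  e j := X.fiberCast (ψ.seg_loc φ v.1 j) _ _ v.2
  comm _ _ := Subtype.ext ((X.f_trans _ _ _).trans (X.f_trans _ _ _).symm)

/-- The parts of `X` contracted by `φ` are parts of parts of `X`. -/
def partPartHom (v : ((pull ψ).obj ((pull φ).obj X)).V) (w : (((pull φ).obj X).part ψ v).V) :
    X.part φ (((pull φ).obj X).glue ψ ⟨v, w⟩) ⟶
      (pull (EndMap.cast (ψ.gap_loc φ v.1 w.1))).obj
        ((X.part (ψ.comp φ) v).part (ψ.loc φ v.1) (Hom.v (partHom ψ φ X v) w)) where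
  e x := X.nestedFiberCast (ψ.seg_pos φ v.1 w.1 x) (ψ.seg_loc φ v.1 w.1.castSucc)
    ((φ.seg_zero (ψ.pos v.1 w.1)).ge.trans (φ.seg_mono _ (Fin.zero_le x))) _ _ _ w.2.2 _ _ _
  comm _ _ := Subtype.ext (Subtype.ext ((X.f_trans _ _ _).trans (X.f_trans _ _ _).symm))

/-- The map of vertices induced by an isomorphism of chains of equal lengths. -/
abbrev castV (h : g = g') {X : LevelTree g} {Y : LevelTree g'}
    (c : X ⟶ (pull (EndMap.cast h)).obj Y) (v : X.V) : Y.V := ⟨Fin.cast h v.1, c.e v.1.castSucc v.2⟩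

theorem castV_bijective (h : g = g') {X : LevelTree g} {Y : LevelTree g'}
    (c : X ⟶ (pull (EndMap.cast h)).obj Y) : Function.Bijective (castV h c) := by
  subst h
  exact Hom.v_bijective (Y := Y) c

/-- The bijection of incoming edges induced by an isomorphism of chains of equal lengths. -/
def castIn (h : g = g') {X : LevelTree g} {Y : LevelTree g'}
    (c : X ⟶ (pull (EndMap.cast h)).obj Y) (v : X.V) : X.In v ≃ Y.In (castV h c v) :=
  Hom.inEquiv c v

/-- The bijection of leaves induced by an isomorphism of chains of equal lengths. -/
def castLeaf (h : g = g') {X : LevelTree g} {Y : LevelTree g'}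
    (c : X ⟶ (pull (EndMap.cast h)).obj Y) : X.S (Fin.last g) ≃ Y.S (Fin.last g') :=
  (c.e (Fin.last g)).trans (Y.cast (EndMap.cast h).last)

end LevelTree

namespace PreCooperad

variable {C : Type u} [Category.{v} C] [MonoidalCategory C] [SymmetricCategory C] [HasTerminal C]
variable (P : PreCooperad C)

/-- Naturality of `localOp` for isomorphisms of trees whose heights are only propositionally equal.
Once the heights are identified it is ordinary naturality. -/
theorem localOp_cast {g g' : ℕ} (h : g = g') (hg : g ≤ 2) (hg' : g' ≤ 2) {X : LevelTree g}
    {Y : LevelTree g'} (c : X ⟶ (pull (EndMap.cast h)).obj Y) :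
    P.O.map (Sig.map (castLeaf h c)) ≫ (P.localOp g' hg').app Y =
      (P.localOp g hg).app X ≫ unMap (Y := fun v : Y.V => P.O.obj (Sig.of (Y.In v)))
        (castV h c) (castV_bijective h c) (fun v => P.O.map (Sig.map (castIn h c v))) := by
  subst h
  have e : castLeaf rfl c = c.e (Fin.last g) := Equiv.ext fun t => Y.f_refl _ _
  rw [e]
  exact (P.localOp g hg).naturality (Y := Y) c

end PreCooperad

theorem EndMap.gap_loc_le {l m n k : ℕ} (ψ : EndMap l m) (φ : EndMap m n) (hφ : ∀ i, φ.gap i ≤ k)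
    (i : Fin l) (j : Fin (ψ.gap i)) : (ψ.loc φ i).gap j ≤ k :=
  (ψ.gap_loc φ i j).symm.trans_le (hφ _)

/-! ### Locality of the composite of two operations -/

namespace PreCooperad

variable {C : Type u} [Category.{v} C] [MonoidalCategory C] [SymmetricCategory C] [HasTerminal C]
variable (P : PreCooperad C) {l m n : ℕ}

/-- The map `O^{⊚ m}(φ^* X) ⟶ O^{⊚ n}(X)` obtained from maps `t v` for the parts of `X`. -/
def glueMap (φ : EndMap m n) (X : LevelTree n)
    (t : ∀ v : ((pull φ).obj X).V, P.O.obj (Sig.of ((X.part φ v).S (Fin.last _))) ⟶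
      (circPow P.O (φ.gap v.1)).obj (X.part φ v)) :
    (circPow P.O m).obj ((pull φ).obj X) ⟶ (circPow P.O n).obj X :=
  blockMap (B := fun v : X.V => P.O.obj (Sig.of (X.In v)))
    (Y := fun (v : ((pull φ).obj X).V) (w : (X.part φ v).V) => P.O.obj (Sig.of ((X.part φ v).In w)))
    (fun v => P.O.map (Sig.map (X.leafEquiv φ v)) ≫ t v)
    (X.glue φ) (X.glue_bijective φ) (fun p => P.O.map (Sig.map (X.glueIn φ p)))

/-- In `glueMap` only the family of maps on the parts varies, so comparisons of operations reduce to
comparisons of such families. -/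
theorem opAlong_app (φ : EndMap m n) (hφ : ∀ i, φ.gap i ≤ 2) (X : LevelTree n) :
    (P.opAlong φ hφ).app X =
      P.glueMap φ X fun v => (P.localOp (φ.gap v.1) (hφ v.1)).app (X.part φ v) := rfl

theorem map_map {α β γ δ : Type} [Finite α] [Finite β] [Finite γ] [Finite δ] (A : SymSeq C)
    (a : α ≃ β) (b : β ≃ δ) (c : α ≃ γ) (d : γ ≃ δ) (h : ∀ x, b (a x) = d (c x)) :
    A.map (Sig.map a) ≫ A.map (Sig.map b) = A.map (Sig.map c) ≫ A.map (Sig.map d) := by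
  rw [← A.map_comp, ← A.map_comp, Sig.map_comp, Sig.map_comp]
  exact congrArg (fun t => A.map (Sig.map t)) (Equiv.ext h)

section Comp

variable (ψ : EndMap l m) (φ : EndMap m n) (hψ : ∀ i, ψ.gap i ≤ 2) (hφ : ∀ i, φ.gap i ≤ 2)

variable (X : LevelTree n)

/-- The vertices of the parts contracted by `φ`, as vertices of the parts contracted by
`ψ.comp φ`. -/
def glueParts (v : ((pull ψ).obj ((pull φ).obj X)).V)
    (p : Σ w : (((pull φ).obj X).part ψ v).V, (X.part φ (((pull φ).obj X).glue ψ ⟨v, w⟩)).V) :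
    (X.part (ψ.comp φ) v).V :=
  (X.part (ψ.comp φ) v).glue (ψ.loc φ v.1)
    ⟨Hom.v (partHom ψ φ X v) p.1, castV (ψ.gap_loc φ v.1 p.1.1) (partPartHom ψ φ X v p.1) p.2⟩

theorem glueParts_bijective (v : ((pull ψ).obj ((pull φ).obj X)).V) :
    Function.Bijective (glueParts ψ φ X v) :=
  ((X.part (ψ.comp φ) v).glue_bijective (ψ.loc φ v.1)).comp
    (bijective_sigma (κ'' := fun w => ((X.part (ψ.comp φ) v).part (ψ.loc φ v.1) w).V)
      (f := fun w => castV (ψ.gap_loc φ v.1 w.1) (partPartHom ψ φ X v w))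
      (Hom.v_bijective (partHom ψ φ X v))
      fun w => castV_bijective (ψ.gap_loc φ v.1 w.1) (partPartHom ψ φ X v w))

theorem glue_glueParts (v : ((pull ψ).obj ((pull φ).obj X)).V)
    (w : (((pull φ).obj X).part ψ v).V) (x : (X.part φ (((pull φ).obj X).glue ψ ⟨v, w⟩)).V) :
    X.glue (ψ.comp φ) ⟨v, glueParts ψ φ X v ⟨w, x⟩⟩ =
      X.glue φ ⟨((pull φ).obj X).glue ψ ⟨v, w⟩, x⟩ := by
  refine V_ext (Fin.ext ?_) _ _ rfl
  have h := ψ.loc_val φ v.1 w.1.castSucc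
  change (φ.toFun (ψ.toFun v.1.castSucc) : ℕ) + ((ψ.loc φ v.1).toFun w.1.castSucc + x.1) =
    φ.toFun (ψ.seg v.1 w.1.castSucc) + x.1
  omega

/-- The bijections of incoming edges accompanying `glueParts`. -/
def glueInParts (v : ((pull ψ).obj ((pull φ).obj X)).V)
    (p : Σ w : (((pull φ).obj X).part ψ v).V, (X.part φ (((pull φ).obj X).glue ψ ⟨v, w⟩)).V) :
    (X.part φ (((pull φ).obj X).glue ψ ⟨v, p.1⟩)).In p.2 ≃
      (X.part (ψ.comp φ) v).In (glueParts ψ φ X v p) :=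
  (castIn (ψ.gap_loc φ v.1 p.1.1) (partPartHom ψ φ X v p.1) p.2).trans
    ((X.part (ψ.comp φ) v).glueIn (ψ.loc φ v.1) ⟨Hom.v (partHom ψ φ X v) p.1,
      castV (ψ.gap_loc φ v.1 p.1.1) (partPartHom ψ φ X v p.1) p.2⟩)

/-- The subtree of `X` contracted by `φ` at a vertex coming from the part of `φ^* X` over `v` is,
through `partPartHom`, a subtree of the part of `X` over `v`. The operation is transported by
`localOp_cast`, since the two heights are related by `gap_loc`. -/
theorem localOp_partPart (v : ((pull ψ).obj ((pull φ).obj X)).V)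
    (w : (((pull φ).obj X).part ψ v).V) :
    P.O.map (Sig.map (Hom.inEquiv (partHom ψ φ X v) w)) ≫
      P.O.map (Sig.map ((X.part (ψ.comp φ) v).leafEquiv (ψ.loc φ v.1)
        (Hom.v (partHom ψ φ X v) w))) ≫
      (P.localOp _ (ψ.gap_loc_le φ hφ v.1 w.1)).app ((X.part (ψ.comp φ) v).part (ψ.loc φ v.1)
        (Hom.v (partHom ψ φ X v) w)) =
    (P.O.map (Sig.map (((pull φ).obj X).glueIn ψ ⟨v, w⟩)) ≫
      P.O.map (Sig.map (X.leafEquiv φ (((pull φ).obj X).glue ψ ⟨v, w⟩))) ≫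
      (P.localOp _ (hφ _)).app (X.part φ (((pull φ).obj X).glue ψ ⟨v, w⟩))) ≫
      unMap (Y := fun y : ((X.part (ψ.comp φ) v).part (ψ.loc φ v.1)
        (Hom.v (partHom ψ φ X v) w)).V => P.O.obj (Sig.of (In _ y)))
        (castV (ψ.gap_loc φ v.1 w.1) (partPartHom ψ φ X v w)) (castV_bijective _ _)
        (fun x => P.O.map (Sig.map (castIn (ψ.gap_loc φ v.1 w.1) (partPartHom ψ φ X v w) x))) := by
  have h := P.localOp_cast (ψ.gap_loc φ v.1 w.1) (hφ _) (ψ.gap_loc_le φ hφ v.1 w.1)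
    (partPartHom ψ φ X v w)
  have h₁ := map_map P.O (Hom.inEquiv (partHom ψ φ X v) w)
    ((X.part (ψ.comp φ) v).leafEquiv (ψ.loc φ v.1) (Hom.v (partHom ψ φ X v) w))
    (((pull φ).obj X).glueIn ψ ⟨v, w⟩)
    ((X.leafEquiv φ (((pull φ).obj X).glue ψ ⟨v, w⟩)).trans
      (castLeaf (ψ.gap_loc φ v.1 w.1) (partPartHom ψ φ X v w)))
    -- All the bijections involved are structure maps of `X` on underlying elements, so both routes
    -- are the same composite structure map.
    (fun t => Subtype.ext (Subtype.ext ((X.f_trans _ _ _).trans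
      ((X.f_trans _ _ _).trans (X.f_trans _ _ _)).symm)))
  have h₂ := P.O.map_comp (Sig.map (X.leafEquiv φ (((pull φ).obj X).glue ψ ⟨v, w⟩)))
    (Sig.map (castLeaf (ψ.gap_loc φ v.1 w.1) (partPartHom ψ φ X v w)))
  have aux : ∀ {P₀ P₁ P₂ P₃ Q₁ Q₂ R₃ : C} (a : P₀ ⟶ P₁) (b : P₁ ⟶ P₂) (c : P₂ ⟶ P₃) (d : P₀ ⟶ Q₁)
      (e : Q₁ ⟶ Q₂) (f : Q₂ ⟶ P₂) (j : Q₁ ⟶ P₂) (g : Q₂ ⟶ R₃) (k : R₃ ⟶ P₃) (_ : a ≫ b = d ≫ j)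
      (_ : j = e ≫ f) (_ : f ≫ c = g ≫ k), a ≫ b ≫ c = (d ≫ e ≫ g) ≫ k := by
    intro P₀ P₁ P₂ P₃ Q₁ Q₂ R₃ a b c d e f j g k h₁ h₂ h₃
    rw [reassoc_of% h₁, h₂, Category.assoc, h₃]
    simp only [Category.assoc]
  exact aux _ _ _ _ _ _ _ _ _ h₁ h₂ h

/-- The first operation splits each vertex `v` into the vertices of the contracted part over `v`,
and the second acts on these without mixing different `v`; so `blockMap_comp` applies, with the
grouping of vertices given by `glueParts`. No cooperad axiom enters. -/
theorem opAlong_comp_app :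
    (P.opAlong ψ hψ).app ((pull φ).obj X) ≫ (P.opAlong φ hφ).app X =
      P.glueMap (ψ.comp φ) X fun v => (restrict (ψ.loc φ v.1) (P.localOp _ (hψ v.1)) ≫
        P.opAlong (ψ.loc φ v.1) (ψ.gap_loc_le φ hφ v.1)).app (X.part (ψ.comp φ) v) := by
  refine (blockMap_comp (D := fun v : X.V => P.O.obj (Sig.of (X.In v)))
    (ι := ((pull ψ).obj ((pull φ).obj X)).V) (κ := ((pull φ).obj X).V)
    (fun v => P.O.map (Sig.map (((pull φ).obj X).leafEquiv ψ v)) ≫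
      (P.localOp (ψ.gap v.1) (hψ v.1)).app (((pull φ).obj X).part ψ v))
    (((pull φ).obj X).glue ψ) (((pull φ).obj X).glue_bijective ψ)
    (fun p => P.O.map (Sig.map (((pull φ).obj X).glueIn ψ p)))
    (fun v => P.O.map (Sig.map (X.leafEquiv φ v)) ≫
      (P.localOp (φ.gap v.1) (hφ v.1)).app (X.part φ v))
    (X.glue φ) (X.glue_bijective φ) (fun p => P.O.map (Sig.map (X.glueIn φ p)))
    (Q := fun (v : ((pull ψ).obj ((pull φ).obj X)).V) (w : (X.part (ψ.comp φ) v).V) =>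
      P.O.obj (Sig.of ((X.part (ψ.comp φ) v).In w)))
    (glueParts ψ φ X) (glueParts_bijective ψ φ X)
    (fun v p => P.O.map (Sig.map (glueInParts ψ φ X v p))) (X.glue (ψ.comp φ))
    (X.glue_bijective (ψ.comp φ)) (fun p => P.O.map (Sig.map (X.glueIn (ψ.comp φ) p)))
    (glue_glueParts ψ φ X) ?_).trans (blockMap_congr _ _ ?_ (fun _ => rfl)
      (fun p => Category.comp_id _))
  -- Compatibility on incoming edges: passing through the part over `v` or directly to `X` leaves
  -- the underlying element unchanged, up to a cast of levels.
  · intro v w x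
    refine (congrArg (P.O.map (Sig.map (glueInParts ψ φ X v ⟨w, x⟩)) ≫ ·)
      (map_inCast P.O X (glue_glueParts ψ φ X v w x) (X.glueIn (ψ.comp φ)
        ⟨v, glueParts ψ φ X v ⟨w, x⟩⟩))).trans ?_
    refine (P.O.map_comp _ _).symm.trans (congrArg P.O.map ((Sig.map_comp _ _).trans
      (congrArg Sig.map (Equiv.ext fun t => Subtype.ext ?_))))
    exact (X.inCast_val (glue_glueParts ψ φ X v w x) _).trans ((X.f_trans _ _ _).trans (X.f_refl _ _))
  -- Naturality along `partHom` replaces the part of `φ^* X` by the contraction along `loc` of the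
  -- part of `X`. The inner block map then becomes `opAlong` along `loc`, with the factors matched
  -- by `localOp_partPart`.
  · intro v
    have h₁ := (P.localOp _ (hψ v.1)).naturality (partHom ψ φ X v)
    have h₂ := map_map P.O (((pull φ).obj X).leafEquiv ψ v) ((partHom ψ φ X v).e (Fin.last _))
      (X.leafEquiv (ψ.comp φ) v) ((X.part (ψ.comp φ) v).cast (ψ.loc φ v.1).last.symm)
      (fun t => Subtype.ext ((X.f_trans _ _ _).trans (X.f_trans _ _ _).symm))
    have h₃ := unMap_blockMap
      (B := fun w : (X.part (ψ.comp φ) v).V => P.O.obj (Sig.of (In _ w)))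
      (Y := fun w (x : ((X.part (ψ.comp φ) v).part (ψ.loc φ v.1) w).V) =>
        P.O.obj (Sig.of (In _ x)))
      (Hom.v (partHom ψ φ X v)) (Hom.v_bijective _)
      (fun w => P.O.map (Sig.map (Hom.inEquiv (partHom ψ φ X v) w)))
      (fun w => P.O.map (Sig.map ((X.part (ψ.comp φ) v).leafEquiv (ψ.loc φ v.1) w)) ≫
        (P.localOp _ (ψ.gap_loc_le φ hφ v.1 w.1)).app ((X.part (ψ.comp φ) v).part (ψ.loc φ v.1) w))
      ((X.part (ψ.comp φ) v).glue (ψ.loc φ v.1)) ((X.part (ψ.comp φ) v).glue_bijective _)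
      (fun p => P.O.map (Sig.map ((X.part (ψ.comp φ) v).glueIn (ψ.loc φ v.1) p)))
    have hb := ((X.part (ψ.comp φ) v).glue_bijective (ψ.loc φ v.1)).comp
      (bijective_sigma (κ'' := fun w => ((X.part (ψ.comp φ) v).part (ψ.loc φ v.1) w).V)
        (Hom.v_bijective (partHom ψ φ X v)) fun _ => Function.bijective_id)
    have h₄ := h₃.trans ((blockMap_congr _ hb (P.localOp_partPart ψ φ hφ X v) (fun _ => rfl)
      (fun _ => Category.comp_id _)).trans (blockMap_unMap _ _ _ _ _ hb _))
    have aux : ∀ {P₀ P₁ P₂ P₃ Q₁ Q₂ R : C} (a : P₀ ⟶ P₁) (b : P₁ ⟶ P₂) (c : P₂ ⟶ P₃) (c' : P₂ ⟶ R)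
        (c'' : R ⟶ P₃) (a' : P₁ ⟶ Q₂) (b' : Q₂ ⟶ R) (d : P₀ ⟶ Q₁) (e : Q₁ ⟶ Q₂)
        (_ : a' ≫ b' = b ≫ c') (_ : a ≫ a' = d ≫ e) (_ : c' ≫ c'' = c),
        (a ≫ b) ≫ c = d ≫ (e ≫ b') ≫ c'' := by
      intro P₀ P₁ P₂ P₃ Q₁ Q₂ R a b c c' c'' a' b' d e h₁ h₂ h₃
      rw [← h₃, Category.assoc, ← reassoc_of% h₁, reassoc_of% h₂, Category.assoc]
    refine aux _ _ _ _ _ _ _ _ _ h₁ h₂ (h₄.trans ?_)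
    refine blockMap_congr _ _ (fun _ => rfl) (fun _ => rfl) fun p => ?_
    exact (Category.comp_id _).trans (P.O.map_comp _ _).symm

end Comp

end PreCooperad

/-! ### Contraction to a single vertex and contraction along the identity -/

namespace EndMap

/-- The only end point preserving map from `{0 < 1}`. -/
def ends (g : ℕ) : EndMap 1 g where
  toFun i := if i = 0 then 0 else Fin.last g
  mono i j h := by
    dsimp only
    split_ifs with h₁ h₂ h₂
    · exact le_rfl
    · exact Fin.zero_le _
    · subst h₂
      exact absurd (Fin.le_zero_iff.1 h) h₁
    · exact le_rfl
  zero := rfl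
  last := rfl

theorem gap_one {g : ℕ} (τ : EndMap 1 g) : τ.gap 0 = g := by
  have h₁ : τ.toFun 1 = Fin.last g := τ.last
  have h₂ : τ.toFun 0 = 0 := τ.zero
  simp [gap, h₁, h₂]

theorem gap_id {n : ℕ} (i : Fin n) : (EndMap.id n).gap i = 1 := by
  simp [gap, EndMap.id]

end EndMap

section

variable {C : Type u} [Category.{v} C] {l m n : ℕ}

theorem restrict_app (φ : EndMap m n) {B : SymSeq C} {F : LevelTree m ⥤ C} (t : gamma m ⋙ B ⟶ F)
    (X : LevelTree n) : (restrict φ t).app X =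
      B.map (Sig.map (X.cast φ.last.symm)) ≫ t.app ((pull φ).obj X) := rfl

theorem restrict_id {B : SymSeq C} {F : LevelTree n ⥤ C} (t : gamma n ⋙ B ⟶ F)
    (X : LevelTree n) : (restrict (EndMap.id n) t).app X = t.app X := by
  have h : X.cast (EndMap.id n).last.symm = Equiv.refl _ := Equiv.ext fun x => X.f_refl _ _
  rw [restrict_app, h]
  exact (congrArg (· ≫ t.app X) (B.map_id _)).trans (Category.id_comp _)

theorem map_cast_comp (ψ : EndMap l m) (φ : EndMap m n) (B : SymSeq C) (X : LevelTree n) :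
    B.map (Sig.map (X.cast (ψ.comp φ).last.symm)) =
      B.map (Sig.map (X.cast φ.last.symm)) ≫
        B.map (Sig.map (((pull φ).obj X).cast ψ.last.symm)) := by
  refine Eq.trans ?_ (B.map_comp _ _)
  have h : X.cast (ψ.comp φ).last.symm =
      (X.cast φ.last.symm).trans (((pull φ).obj X).cast ψ.last.symm) :=
    Equiv.ext fun x => (X.f_trans _ _ _).symm
  exact congrArg (fun t => B.map (Sig.map t)) h

end

namespace LevelTree

/-- The part of a tree over all levels is the tree itself. -/
def partOneHom {g : ℕ} (τ : EndMap 1 g) (X : LevelTree g) (s : ((pull τ).obj X).S 0) :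
    X.part τ ⟨0, s⟩ ⟶ (pull (EndMap.cast τ.gap_one)).obj X where
  e x := (Equiv.subtypeUnivEquiv fun _ => ((pull τ).obj X).root_subsingleton.elim _ _).trans
    (X.cast (Fin.ext (by
      simp [EndMap.seg, EndMap.cast, τ.zero])))
  comm _ _ := (X.f_trans _ _ _).trans (X.f_trans _ _ _).symm

end LevelTree

namespace PreCooperad

variable {C : Type u} [Category.{v} C] [MonoidalCategory C] [SymmetricCategory C] [HasTerminal C]
variable (P : PreCooperad C) {l m n : ℕ}

/-- The tree `τ^* X` has one vertex, and the part over it is all of `X`. So `opAlong τ` applies the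
operation for `g` levels once, and the unitor in `unitHom` is cancelled by `ins_blockMap_singleton`.
-/
theorem restrict_unitHom_opAlong {g : ℕ} (τ : EndMap 1 g) (hτ : ∀ i, τ.gap i ≤ 2) (hg : g ≤ 2) :
    restrict τ (unitHom P.O) ≫ P.opAlong τ hτ = P.localOp g hg := by
  ext X
  let s := ((pull τ).obj X).root_nonempty.some
  have h₁ := ins_blockMap_singleton (B := fun v : X.V => P.O.obj (Sig.of (X.In v)))
    (Y := fun (v : ((pull τ).obj X).V) (w : (X.part τ v).V) => P.O.obj (Sig.of ((X.part τ v).In w)))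
    (fun v => P.O.map (Sig.map (X.leafEquiv τ v)) ≫
      (P.localOp (τ.gap v.1) (hτ v.1)).app (X.part τ v))
    (X.glue τ) (X.glue_bijective τ) (fun p => P.O.map (Sig.map (X.glueIn τ p))) ⟨0, s⟩
    (isEnum_root ((pull τ).obj X) s)
  have h₂ := P.localOp_cast τ.gap_one (hτ 0) hg (partOneHom τ X s)
  have hV : ∀ w, X.glue τ ⟨⟨0, s⟩, w⟩ = castV τ.gap_one (partOneHom τ X s) w := fun w =>
    Eq.symm (V_ext (Fin.ext (by
      simp [τ.zero])) _ _ rfl)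
  have h₃ : unMap (Y := fun v : X.V => P.O.obj (Sig.of (X.In v))) (fun w => X.glue τ ⟨⟨0, s⟩, w⟩)
      ((X.glue_bijective τ).comp (mk_bijective (κ' := fun v => (X.part τ v).V)
        (isEnum_root ((pull τ).obj X) s)))
      (fun w => P.O.map (Sig.map (X.glueIn τ ⟨⟨0, s⟩, w⟩))) =
      unMap (castV τ.gap_one (partOneHom τ X s)) (castV_bijective _ _)
        (fun w => P.O.map (Sig.map (castIn τ.gap_one (partOneHom τ X s) w))) := by
    refine unMap_congr _ _ hV _ _ fun w => (map_inCast P.O X (hV w) _).trans ?_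
    exact congrArg (fun t => P.O.map (Sig.map t)) (Equiv.ext fun t => Subtype.ext
      (X.inCast_val (hV w) _))
  -- Going from the leaves of `X` to the edges at the root of `τ^* X`, then to the leaves of the
  -- part and back to `X`, does not change the leaf.
  have h₄ : P.O.map (Sig.map (X.cast τ.last.symm)) ≫
      P.O.map (Sig.map (rootIn ((pull τ).obj X) s)) ≫ P.O.map (Sig.map (X.leafEquiv τ ⟨0, s⟩)) ≫
      P.O.map (Sig.map (castLeaf τ.gap_one (partOneHom τ X s))) = 𝟙 _ := by
    refine Eq.trans ?_ (P.O.map_id (Sig.of (X.S (Fin.last g))))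
    have h : ((X.cast τ.last.symm).trans ((rootIn ((pull τ).obj X) s).trans
        ((X.leafEquiv τ ⟨0, s⟩).trans (castLeaf τ.gap_one (partOneHom τ X s))))) =
        Equiv.refl _ := Equiv.ext fun x => by
      refine Eq.trans ?_ (X.f_refl le_rfl x)
      exact (X.f_trans _ _ _).trans ((X.f_trans _ _ _).trans (X.f_trans _ _ _))
    rw [← Sig.map_refl, ← h, ← P.O.map_comp, ← P.O.map_comp, ← P.O.map_comp]
    rfl
  have aux : ∀ {P₀ P₁ P₂ P₃ P₄ P₅ P₆ R : C} (a : P₀ ⟶ P₁) (b : P₁ ⟶ P₂) (r : P₂ ⟶ P₃) (i : P₃ ⟶ P₄)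
      (k : P₄ ⟶ P₅) (c : P₂ ⟶ P₆) (d : P₆ ⟶ R) (w w' : R ⟶ P₅) (j : P₆ ⟶ P₀) (f : P₀ ⟶ P₅)
      (_ : r ≫ i ≫ k = (c ≫ d) ≫ w) (_ : w = w') (_ : j ≫ f = d ≫ w')
      (_ : a ≫ b ≫ c ≫ j = 𝟙 _), (a ≫ (b ≫ r ≫ i)) ≫ k = f := by
    intro P₀ P₁ P₂ P₃ P₄ P₅ P₆ R a b r i k c d w w' j f h₁ h₂ h₃ h₄
    simp only [Category.assoc, h₁, h₂, ← h₃]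
    rw [← Category.id_comp f, ← h₄]
    simp only [Category.assoc]
    rw [reassoc_of% h₄]
  exact aux _ _ _ _ _ _ _ _ _ _ _ h₁ h₃ h₂ h₄

/-- The height is a variable with a hypothesis `g = 1` because the gaps of `EndMap.id` equal 1 only
propositionally. The bijection `r` is given through its underlying map, which is all that is needed
later. -/
theorem localOp_of_eq_one {g : ℕ} (hg : g = 1) (hg' : g ≤ 2) (T : LevelTree g) (w : T.V) :
    ∃ (hw : IsEnum [w]) (h : w.1.succ ≤ Fin.last g) (r : T.S (Fin.last g) ≃ T.In w),
      (∀ x, (r x).1 = T.f h x) ∧ (P.localOp g hg').app T = P.O.map (Sig.map r) ≫ (ρ_ _).inv ≫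
        ins (fun v : T.V => P.O.obj (Sig.of (T.In v))) [w] hw := by
  subst hg
  obtain ⟨i, s⟩ := w
  obtain rfl : i = 0 := Subsingleton.elim _ _
  obtain rfl : T.root_nonempty.some = s := T.root_subsingleton.elim _ _
  exact ⟨isEnum_root T _, Fin.le_last _, rootIn T _, fun x => (T.f_refl _ _).symm, rfl⟩

/-- Every gap is 1, so every part has a single vertex and carries the identity operation;
`blockMap_singletons` reduces the operation to a reindexing that fixes every vertex and edge. -/
theorem opAlong_id (h : ∀ i, (EndMap.id n).gap i ≤ 2) (X : LevelTree n) :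
    (P.opAlong (EndMap.id n) h).app X = 𝟙 ((circPow P.O n).obj X) := by
  let s : ∀ v : ((pull (EndMap.id n)).obj X).V, (X.part (EndMap.id n) v).V := fun v =>
    ⟨⟨0, by simp [EndMap.gap_id]⟩, ⟨X.f ((EndMap.id n).seg_zero v.1).le v.2,
      (X.f_trans _ _ _).trans (X.f_refl _ _)⟩⟩
  have H := fun v => P.localOp_of_eq_one (EndMap.gap_id v.1) (h v.1) (X.part (EndMap.id n) v) (s v)
  choose hw hle r hr hop using H
  have hV : ∀ v, X.glue (EndMap.id n) ⟨v, s v⟩ = v := fun v => V_ext (Fin.ext rfl) _ _ rfl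
  have h₁ := blockMap_singletons (B := fun v : X.V => P.O.obj (Sig.of (X.In v)))
    (Y := fun (v : ((pull (EndMap.id n)).obj X).V) (w : (X.part (EndMap.id n) v).V) =>
      P.O.obj (Sig.of ((X.part (EndMap.id n) v).In w))) s hw
    (fun v => P.O.map (Sig.map (X.leafEquiv (EndMap.id n) v)) ≫ P.O.map (Sig.map (r v)))
    (X.glue (EndMap.id n)) (X.glue_bijective _)
    (fun p => P.O.map (Sig.map (X.glueIn (EndMap.id n) p)))
  rw [opAlong_app]
  unfold glueMap
  refine Eq.trans (blockMap_congr _ _ (fun v => ?_) (fun _ => rfl) (fun _ => Category.comp_id _))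
    (h₁.trans (Eq.trans (unMap_congr _ Function.bijective_id hV _ _ fun v => ?_)
      (unMap_id _)))
  · exact (congrArg (_ ≫ ·) (hop v)).trans (Category.assoc _ _ _).symm
  · have h₂ : (P.O.map (Sig.map (X.leafEquiv (EndMap.id n) v)) ≫ P.O.map (Sig.map (r v))) ≫
        P.O.map (Sig.map (X.glueIn (EndMap.id n) ⟨v, s v⟩)) =
        P.O.map (Sig.map (((X.leafEquiv (EndMap.id n) v).trans (r v)).trans
          (X.glueIn (EndMap.id n) ⟨v, s v⟩))) := by
      rw [← P.O.map_comp]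
      exact (P.O.map_comp _ _).symm
    refine (congrArg (· ≫ eqToHom _) h₂).trans ((map_inCast P.O X (hV v) _).trans
      (Eq.trans ?_ (P.O.map_id _)))
    refine congrArg (fun t : X.In v ≃ X.In v => P.O.map (Sig.map t))
      (a₂ := Equiv.refl (X.In v)) (Equiv.ext fun t => Subtype.ext ?_)
    refine (X.inCast_val (hV v) _).trans ?_
    refine (congrArg (X.f _) (congrArg Subtype.val (hr v _))).trans ?_
    exact (X.f_trans _ _ _).trans ((X.f_trans _ _ _).trans (X.f_refl _ _))

end PreCooperad

/-! ### Local operations on trees with at most three levels -/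

theorem EndMap.degen_gap_le_one (i : Fin 2) (j : Fin 2) : (EndMap.degen i).gap j ≤ 1 := by
  revert i j
  decide

namespace PreCooperad

variable {C : Type u} [Category.{v} C] [MonoidalCategory C] [SymmetricCategory C] [HasTerminal C]
variable (P : PreCooperad C) {l m n : ℕ}

/-- The operation `O(leaves) → O^{⊚ g}` for trees with at most three levels. -/
def localOp₃ : (g : ℕ) → g ≤ 3 → (gamma g ⋙ P.O ⟶ circPow P.O g)
  | 0, _ => P.counitHom
  | 1, _ => unitHom P.O
  | 2, _ => P.Δ
  -- One of the two composites in the coassociativity axiom; for a cooperad the other one gives the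
  -- same transformation.
  | 3, _ => restrict (EndMap.face 0) P.Δ ≫ P.treeCoface (0 : Fin 2)
  | _ + 4, h => absurd h (by omega)

theorem localOp₃_eq (g : ℕ) (h : g ≤ 2) (h' : g ≤ 3) : P.localOp₃ g h' = P.localOp g h := by
  match g, h with
  | 0, _ => rfl
  | 1, _ => rfl
  | 2, _ => rfl

/-- For `a = 0` the two end points coincide, which forces `g = 0` and makes `φ` the identity; `a =
1` is contraction to a single vertex. Neither case uses the cooperad axioms. -/
theorem restrict_localOp_of_le_one {a g : ℕ} (ha : a ≤ 1) (ha' : a ≤ 2) (hg : g ≤ 2) (φ : EndMap a g)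
    (hφ : ∀ i, φ.gap i ≤ 2) :
    restrict φ (P.localOp a ha') ≫ P.opAlong φ hφ = P.localOp g hg := by
  match a, ha with
  | 0, _ =>
    obtain rfl : g = 0 := (congrArg Fin.val (φ.last.symm.trans φ.zero) : g = 0)
    obtain rfl : φ = EndMap.id 0 := EndMap.ext fun i => Subsingleton.elim (α := Fin 1) _ _
    ext X
    exact (congrArg₂ (· ≫ ·) (restrict_id (P.localOp 0 ha') X) (P.opAlong_id hφ X)).trans
      (Category.comp_id _)
  | 1, _ => exact P.restrict_unitHom_opAlong φ hφ hg

theorem restrict_comp_app (ψ : EndMap l m) (φ : EndMap m n) {B : SymSeq C} {F : LevelTree l ⥤ C}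
    {G : LevelTree m ⥤ C} {H : LevelTree n ⥤ C} (t : gamma l ⋙ B ⟶ F) (θ : pull ψ ⋙ F ⟶ G)
    (η : pull φ ⋙ G ⟶ H) (X : LevelTree n) :
    (restrict φ (restrict ψ t ≫ θ) ≫ η).app X =
      (restrict (ψ.comp φ) t).app X ≫ θ.app ((pull φ).obj X) ≫ η.app X := by
  have h := map_cast_comp ψ φ B X
  have aux : ∀ {P₀ P₁ P₂ P₃ P₄ P₅ : C} (a : P₀ ⟶ P₁) (b : P₁ ⟶ P₂) (c : P₂ ⟶ P₃) (d : P₃ ⟶ P₄)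
      (e : P₄ ⟶ P₅) (a' : P₀ ⟶ P₂) (_ : a' = a ≫ b),
      (a ≫ ((b ≫ c) ≫ d)) ≫ e = (a' ≫ c) ≫ d ≫ e := by
    intro P₀ P₁ P₂ P₃ P₄ P₅ a b c d e a' h
    simp only [h, Category.assoc]
  exact aux _ _ _ _ _ _ h

/-- The counit axiom `hi` writes `unitHom` as the cocomposition followed by a codegeneracy, and
`opAlong τ` turns `unitHom` into the operation for `g` levels. By locality the codegeneracy and
`opAlong τ` combine to `opAlong` of the composite: the gaps of `degen i` are at most 1 here, so the
local composites are already known without the axioms. -/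
theorem restrict_comp_degen {g : ℕ} (hg : g ≤ 2) (i : Fin 2)
    (hi : restrict (EndMap.degen i) P.Δ ≫ P.treeCodegen i = unitHom P.O) (τ : EndMap 1 g)
    (hφ : ∀ j, ((EndMap.degen i).comp τ).gap j ≤ 2) :
    restrict ((EndMap.degen i).comp τ) P.Δ ≫ P.opAlong ((EndMap.degen i).comp τ) hφ =
      P.localOp g hg := by
  have hτ : ∀ j, τ.gap j ≤ 2 := fun j => by
    obtain rfl : j = 0 := Subsingleton.elim _ _
    rwa [τ.gap_one]
  rw [← P.restrict_unitHom_opAlong τ hτ hg, ← hi]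
  ext X
  refine Eq.trans ?_ (restrict_comp_app (EndMap.degen i) τ P.Δ (P.treeCodegen i)
    (P.opAlong τ hτ) X).symm
  refine congrArg ((restrict ((EndMap.degen i).comp τ) P.Δ).app X ≫ ·) ?_
  refine Eq.trans ?_ (P.opAlong_comp_app (EndMap.degen i) τ (EndMap.degen_gap i) hτ X).symm
  refine congrArg (P.glueMap ((EndMap.degen i).comp τ) X) (funext fun v => ?_)
  rw [P.restrict_localOp_of_le_one (EndMap.degen_gap_le_one i v.1) _ (hφ v.1)]

end PreCooperad

namespace Cooperad

variable {C : Type u} [Category.{v} C] [MonoidalCategory C] [SymmetricCategory C] [HasTerminal C]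
variable (P : Cooperad C) {l m n : ℕ}

/-- The operations on trees with at most three levels are compatible with contractions. -/
theorem restrict_localOp {a g : ℕ} (ha : a ≤ 2) (hg : g ≤ 3) (φ : EndMap a g)
    (hφ : ∀ i, φ.gap i ≤ 2) :
    restrict φ (P.localOp a ha) ≫ P.opAlong φ hφ = P.localOp₃ g hg := by
  by_cases ha' : a ≤ 1
  -- With at most one gap in the source, `g` is 0 or the single gap of `φ`.
  · have hg' : g ≤ 2 := by
      interval_cases a
      · have := congrArg Fin.val (φ.last.symm.trans φ.zero)
        simp at this
        omega
      · exact φ.gap_one ▸ hφ 0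
    rw [P.restrict_localOp_of_le_one ha' ha hg', P.localOp₃_eq g hg']
  obtain rfl : a = 2 := by omega
  have h₀ : φ.toFun 0 = 0 := φ.zero
  have h₂ : φ.toFun 2 = Fin.last g := φ.last
  -- Middle level at the bottom: the first gap is empty, and `φ` factors through the degeneracy of
  -- the left counit axiom.
  by_cases hl : φ.toFun 1 = 0
  · obtain rfl : φ = (EndMap.degen 0).comp (EndMap.ends g) := EndMap.ext fun i => by
      fin_cases i
      · exact h₀
      · exact hl
      · exact h₂
    have hg' : g ≤ 2 := by
      have := hφ 1
      simpa [EndMap.gap, h₂, hl] using this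
    rw [P.localOp₃_eq g hg']
    exact P.restrict_comp_degen hg' 0 P.counit_left _ hφ
  -- Middle level at the top: the right counit axiom, in the same way.
  by_cases hr : φ.toFun 1 = Fin.last g
  · obtain rfl : φ = (EndMap.degen 1).comp (EndMap.ends g) := EndMap.ext fun i => by
      fin_cases i
      · exact h₀
      · exact hr
      · exact h₂
    have hg' : g ≤ 2 := by
      have := hφ 0
      simpa [EndMap.gap, h₀, hr] using this
    rw [P.localOp₃_eq g hg']
    exact P.restrict_comp_degen hg' 1 P.counit_right _ hφ
  have hl' : 0 < (φ.toFun 1 : ℕ) := Nat.pos_of_ne_zero fun h => hl (Fin.ext h)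
  have hr' : (φ.toFun 1 : ℕ) < g := lt_of_le_of_ne (Nat.lt_succ_iff.1 (φ.toFun 1).2)
    fun h => hr (Fin.ext h)
  obtain rfl | rfl : g = 2 ∨ g = 3 := by omega
  · obtain rfl : φ = EndMap.id 2 := EndMap.ext fun i => by
      fin_cases i
      · exact h₀
      · exact Fin.ext (show (φ.toFun 1 : ℕ) = 1 by omega)
      · exact h₂
    ext X
    exact (congrArg₂ (· ≫ ·) (restrict_id P.Δ X) (P.opAlong_id hφ X)).trans (Category.comp_id _)
  -- As `face k` omits `k + 1`, the map with middle value 1 is `face 1`, which needs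
  -- coassociativity, and the map with middle value 2 is `face 0`, which was used to define
  -- `localOp₃`.
  · obtain h₁ | h₁ : (φ.toFun 1 : ℕ) = 1 ∨ (φ.toFun 1 : ℕ) = 2 := by omega
    · obtain rfl : φ = EndMap.face (1 : Fin 2) := EndMap.ext fun i => by
        fin_cases i
        · exact h₀
        · exact Fin.ext h₁
        · exact h₂
      exact P.coassoc.symm
    · obtain rfl : φ = EndMap.face (0 : Fin 2) := EndMap.ext fun i => by
        fin_cases i
        · exact h₀
        · exact Fin.ext h₁
        · exact h₂
      rfl

/-- The cooperad axioms enter the comparison of composites here: the right side involves `ψ` and `φ`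
only through `ψ.comp φ`. -/
theorem opAlong_comp_opAlong (ψ : EndMap l m) (φ : EndMap m n) (hψ : ∀ i, ψ.gap i ≤ 2)
    (hφ : ∀ i, φ.gap i ≤ 2) (h : ∀ i, (ψ.comp φ).gap i ≤ 3) (X : LevelTree n) :
    (P.opAlong ψ hψ).app ((pull φ).obj X) ≫ (P.opAlong φ hφ).app X =
      P.glueMap (ψ.comp φ) X fun v => (P.localOp₃ _ (h v.1)).app (X.part (ψ.comp φ) v) := by
  refine (P.opAlong_comp_app ψ φ hψ hφ X).trans
    (congrArg (P.glueMap (ψ.comp φ) X) (funext fun v => ?_))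
  rw [P.restrict_localOp (hψ v.1) (h v.1)]

end Cooperad

/-! ### Identities between faces and degeneracies, and bounds for their gaps -/

namespace EndMap

variable {n : ℕ}

/-- A face or a degeneracy displaces each level by at most one, always in the same direction. Hence
each map in a composite lengthens a gap by at most one, and two of them give gaps of length at most
3. -/
theorem face_bounds (k : Fin n) (x : Fin (n + 1)) :
    (x : ℕ) ≤ (face k).toFun x ∧ ((face k).toFun x : ℕ) ≤ x + 1 := by
  simp only [face, Fin.succAbove, Fin.lt_def]
  split_ifs <;> simp

theorem degen_bounds (k : Fin (n + 1)) (x : Fin (n + 2)) :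
    ((degen k).toFun x : ℕ) ≤ x ∧ (x : ℕ) ≤ (degen k).toFun x + 1 := by
  simp only [degen, Fin.predAbove, Fin.lt_def]
  split_ifs <;> simp
  omega

theorem gap_face_comp_face (i : Fin n) (j : Fin (n + 1)) :
    ∀ x, ((face i).comp (face j)).gap x ≤ 3 := by
  refine gap_le _ _ fun x => ?_
  have h₁ := face_bounds i x.succ
  have h₂ := face_bounds i x.castSucc
  have h₃ := face_bounds j ((face i).toFun x.succ)
  have h₄ := face_bounds j ((face i).toFun x.castSucc)
  simp only [comp, Fin.val_succ, Fin.val_castSucc] at *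
  omega

theorem gap_degen_comp_degen (i : Fin (n + 2)) (j : Fin (n + 1)) :
    ∀ x, ((degen i).comp (degen j)).gap x ≤ 3 := by
  refine gap_le _ _ fun x => ?_
  have h₁ := degen_bounds i x.succ
  have h₂ := degen_bounds i x.castSucc
  have h₃ := degen_bounds j ((degen i).toFun x.succ)
  have h₄ := degen_bounds j ((degen i).toFun x.castSucc)
  simp only [comp, Fin.val_succ, Fin.val_castSucc] at *
  omega

theorem gap_degen_comp_face (i : Fin (n + 1)) (j : Fin n) :
    ∀ x, ((degen i).comp (face j)).gap x ≤ 3 := by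
  refine gap_le _ _ fun x => ?_
  have h₁ := degen_bounds i x.succ
  have h₂ := degen_bounds i x.castSucc
  have h₃ := face_bounds j ((degen i).toFun x.succ)
  have h₄ := face_bounds j ((degen i).toFun x.castSucc)
  simp only [comp, Fin.val_succ, Fin.val_castSucc] at *
  omega

theorem face_val (k : Fin n) (x : Fin (n + 1)) :
    ((face k).toFun x : ℕ) = if (x : ℕ) < k + 1 then (x : ℕ) else x + 1 := by
  simp only [face, Fin.succAbove, Fin.lt_def]
  split_ifs <;> simp_all

theorem degen_val (k : Fin (n + 1)) (x : Fin (n + 2)) :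
    ((degen k).toFun x : ℕ) = if (k : ℕ) < x then (x : ℕ) - 1 else x := by
  rcases lt_or_ge (k : ℕ) x with h | h
  · rw [if_pos h]
    simp only [degen, Fin.predAbove_of_castSucc_lt k x (Fin.lt_def.2 h), Fin.val_pred]
  · rw [if_neg (not_lt.2 h)]
    simp only [degen, Fin.predAbove_of_le_castSucc k x (Fin.le_def.2 h), Fin.coe_castPred]

theorem face_comp_face (i j : Fin n) (h : i ≤ j) :
    (face i).comp (face j.succ) = (face j).comp (face i.castSucc) := by
  have h : (i : ℕ) ≤ j := h
  refine ext fun x => Fin.ext ?_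
  simp only [comp, face_val, Fin.val_succ, Fin.val_castSucc]
  split_ifs <;> omega

theorem degen_comp_degen (i j : Fin (n + 1)) (h : i ≤ j) :
    (degen j.succ).comp (degen i) = (degen i.castSucc).comp (degen j) := by
  have h : (i : ℕ) ≤ j := h
  refine ext fun x => Fin.ext ?_
  simp only [comp, degen_val, Fin.val_succ, Fin.val_castSucc]
  split_ifs <;> omega

theorem face_comp_degen_castSucc (i : Fin n) : (face i).comp (degen i.castSucc) = EndMap.id n := by
  refine ext fun x => Fin.ext ?_
  simp only [comp, degen_val, face_val, Fin.val_castSucc, EndMap.id]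
  split_ifs <;> omega

theorem face_comp_degen_succ (i : Fin n) : (face i).comp (degen i.succ) = EndMap.id n := by
  refine ext fun x => Fin.ext ?_
  simp only [comp, degen_val, face_val, Fin.val_succ, EndMap.id]
  split_ifs <;> omega

/-- Here `face i.succ` omits `i + 2`, so `j ≤ i` is the condition `j < i' - 1` of the cosimplicial
identity with coface index `i' = i + 2`. In the next lemma the coface and codegeneracy indices are
`i + 1` and `j + 1`. -/
theorem face_comp_degen_of_le (i : Fin n) (j : Fin (n + 1)) (h : j ≤ i.castSucc) :
    (face i.succ).comp (degen j.castSucc) = (degen j).comp (face i) := by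
  have h : (j : ℕ) ≤ i := h
  refine ext fun x => Fin.ext ?_
  simp only [comp, degen_val, face_val, Fin.val_succ, Fin.val_castSucc]
  split_ifs <;> omega

theorem face_comp_degen_of_lt (i : Fin n) (j : Fin (n + 1)) (h : i.castSucc < j) :
    (face i.castSucc).comp (degen j.succ) = (degen j).comp (face i) := by
  have h : (i : ℕ) < j := h
  refine ext fun x => Fin.ext ?_
  simp only [comp, degen_val, face_val, Fin.val_succ, Fin.val_castSucc]
  split_ifs <;> omega

end EndMap

/-! ### Trees with one level are determined by their leaves -/

section GammaOne

theorem Sig.map_injective {α β : Type} [Finite α] [Finite β] :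
    Function.Injective (Sig.map : (α ≃ β) → _) := fun _ _ h =>
  FintypeCat.equivEquivIso.injective (congrArg CoreHom.iso h)

/-- The isomorphism of trees with one level induced by a bijection of leaves. -/
def homOfLeaves {X Y : LevelTree 1} (e : X.S 1 ≃ Y.S 1) : X ⟶ Y where
  e i := match i with
    | 0 =>
      have := X.root_subsingleton
      have := Y.root_subsingleton
      ⟨fun _ => Y.root_nonempty.some, fun _ => X.root_nonempty.some,
        fun _ => Subsingleton.elim _ _, fun _ => Subsingleton.elim _ _⟩
    | 1 => e
  comm {i j} h x := match i, j, h with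
    | 0, _, _ => Y.root_subsingleton.elim _ _
    | 1, 1, _ => (congrArg e (X.f_refl _ x)).trans (Y.f_refl _ _).symm
    | 1, 0, h => absurd h (by decide)

/-- The tree with one level and a given set of leaves. -/
def corolla (T : Type) [Finite T] : LevelTree 1 where
  S i := match i with
    | 0 => Unit
    | 1 => T
  finite i := match i with
    | 0 => inferInstanceAs (Finite Unit)
    | 1 => inferInstanceAs (Finite T)
  f {i j} h := match i, j, h with
    | 0, _, _ => fun _ => ()
    | 1, 1, _ => fun x => x
    | 1, 0, h => absurd h (by decide)
  f_refl {i} h x := match i with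
    | 0 => rfl
    | 1 => rfl
  f_trans {i j k} h h' x := match i, j, k, h, h' with
    | 0, _, _, _, _ => rfl
    | 1, 1, 1, _, _ => rfl
    | 1, 0, _, h, _ => absurd h (by decide)
    | 1, 1, 0, _, h' => absurd h' (by decide)
  root_nonempty := ⟨()⟩
  root_subsingleton := inferInstanceAs (Subsingleton Unit)

instance : (gamma 1).Faithful where
  map_injective {X Y} a b h := by
    refine LevelTree.Hom.ext (funext fun i => ?_)
    match i with
    | 0 => exact Equiv.ext fun _ => Y.root_subsingleton.elim _ _
    | 1 => exact Sig.map_injective h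

instance : (gamma 1).Full where
  map_surjective f :=
    ⟨homOfLeaves (FintypeCat.equivEquivIso.symm f.iso),
      CoreHom.ext (FintypeCat.equivEquivIso.apply_symm_apply f.iso)⟩

instance : (gamma 1).EssSurj where
  mem_essImage T := ⟨corolla T.of, ⟨eqToIso rfl⟩⟩

instance : (gamma 1).IsEquivalence where

end GammaOne

/-! ### Passage to right Kan extensions -/

section Kan

variable {C : Type u} [Category.{v} C] [HasLimitsOfSize.{0, 0} C]

theorem ranLift_fac {n : ℕ} {F : LevelTree n ⥤ C} {B : Core FintypeCat.{0} ⥤ C}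
    (t : gamma n ⋙ B ⟶ F) : Functor.whiskerLeft (gamma n) (ranLift t) ≫ ranι F = t :=
  Functor.liftOfIsRightKanExtension_fac _ _ _ _

theorem ran_hom_ext {n : ℕ} {F : LevelTree n ⥤ C} {B : Core FintypeCat.{0} ⥤ C} {s t : B ⟶ ran F}
    (h : Functor.whiskerLeft (gamma n) s ≫ ranι F = Functor.whiskerLeft (gamma n) t ≫ ranι F) :
    s = t :=
  Functor.hom_ext_of_isRightKanExtension _ (ranι F) _ _ h

/-- Naturality of `s` at the relabelling of leaves. It allows the equation characterising the first
of two maps to be substituted into that of the second. -/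
theorem whiskerLeft_restrict {m n : ℕ} (φ : EndMap m n) {A B : SymSeq C} {F : LevelTree m ⥤ C}
    (s : A ⟶ B) (t : gamma m ⋙ B ⟶ F) : Functor.whiskerLeft (gamma n) s ≫ restrict φ t =
      restrict φ (Functor.whiskerLeft (gamma m) s ≫ t) := by
  ext X
  have h := s.naturality (Sig.map (X.cast φ.last.symm))
  have aux : ∀ {P₀ P₁ P₂ P₃ Q : C} (a : P₀ ⟶ P₁) (b : P₁ ⟶ P₂) (c : P₂ ⟶ P₃) (d : P₀ ⟶ Q)
      (e : Q ⟶ P₂) (_ : d ≫ e = a ≫ b), a ≫ b ≫ c = d ≫ e ≫ c := by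
    intro P₀ P₁ P₂ P₃ Q a b c d e h
    rw [reassoc_of% h]
  exact aux _ _ _ _ _ h

/-- Precomposition with the equivalence `gamma 1` is fully faithful, so `ranι F ≫ inv t` comes from
a map `ran F ⟶ B`. This is the inverse: faithfulness gives one identity and the universal property
the other. -/
theorem isIso_ranLift {F : LevelTree 1 ⥤ C} {B : Core FintypeCat.{0} ⥤ C}
    (t : gamma 1 ⋙ B ⟶ F) [IsIso t] : IsIso (ranLift t) := by
  let W := (Functor.whiskeringLeft _ _ C).obj (gamma 1)
  let s : ran F ⟶ B := W.preimage (ranι F ≫ inv t)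
  have hs : Functor.whiskerLeft (gamma 1) s = ranι F ≫ inv t := W.map_preimage (ranι F ≫ inv t)
  refine ⟨s, W.map_injective ?_, ran_hom_ext ?_⟩
  · change Functor.whiskerLeft (gamma 1) (ranLift t ≫ s) = Functor.whiskerLeft (gamma 1) (𝟙 _)
    rw [Functor.whiskerLeft_comp, hs, ← Category.assoc, ranLift_fac, IsIso.hom_inv_id]
    rfl
  · rw [Functor.whiskerLeft_comp, Category.assoc, ranLift_fac, hs, Category.assoc,
      IsIso.inv_hom_id, Category.comp_id]
    exact (Category.id_comp _).symm

variable [MonoidalCategory C] [SymmetricCategory C]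

theorem ranCompare_ranMap_fac {m n : ℕ} (φ : EndMap m n) {F : LevelTree m ⥤ C}
    {G : LevelTree n ⥤ C} (θ : pull φ ⋙ F ⟶ G) :
    Functor.whiskerLeft (gamma n) (ranCompare φ F ≫ ranMap θ) ≫ ranι G =
      restrict φ (ranι F) ≫ θ := by
  rw [Functor.whiskerLeft_comp, Category.assoc, ranMap, ranLift_fac, ← Category.assoc, ranCompare,
    ranLift_fac]

theorem isIso_unitHom (A : SymSeq C) : IsIso (unitHom A) := by
  have : ∀ X, IsIso ((unitHom A).app X) := fun X => by
    have h := ins_isIso (fun v : X.V => A.obj (Sig.of (X.In v))) [⟨0, X.root_nonempty.some⟩]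
      (isEnum_root X _)
    have h₁ : IsIso (Sig.map (rootIn X X.root_nonempty.some)) := inferInstance
    have h₂ : IsIso (A.map (Sig.map (rootIn X X.root_nonempty.some))) := inferInstance
    exact IsIso.comp_isIso' h₂ (IsIso.comp_isIso' inferInstance h)
  exact NatIso.isIso_of_isIso_app _

namespace PreCooperad

variable (P : PreCooperad C)

theorem coface_fac {n : ℕ} (k : Fin n) :
    Functor.whiskerLeft (gamma (n + 1)) (P.coface k) ≫ ranι (circPow P.O (n + 1)) =
      restrict (EndMap.face k) (ranι (circPow P.O n)) ≫ P.treeCoface k :=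
  ranCompare_ranMap_fac _ _

theorem codegen_fac {n : ℕ} (i : Fin (n + 1)) :
    Functor.whiskerLeft (gamma n) (P.codegen i) ≫ ranι (circPow P.O n) =
      restrict (EndMap.degen i) (ranι (circPow P.O (n + 1))) ≫ P.treeCodegen i :=
  ranCompare_ranMap_fac _ _

end PreCooperad

namespace Cooperad

variable (P : Cooperad C) {l m n : ℕ}

/-- The map `O^{∘̂ m}(leaves of X) ⟶ O^{⊚ n}(X)` given by an end point preserving map. -/
def compPowOp (χ : EndMap l n) (h : ∀ i, χ.gap i ≤ 3) (X : LevelTree n) :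
    (compPow P.O l).obj (Sig.of (X.S (Fin.last n))) ⟶ (circPow P.O n).obj X :=
  (restrict χ (ranι (circPow P.O l))).app X ≫
    P.glueMap χ X fun v => (P.localOp₃ _ (h v.1)).app (X.part χ v)

/-- The right side depends on `χ` alone, so any two factorisations of `χ` give the same composite
with `ranι`. -/
theorem comp_fac {ψ : EndMap l m} {φ : EndMap m n} {χ : EndMap l n} (hψ : ∀ i, ψ.gap i ≤ 2)
    (hφ : ∀ i, φ.gap i ≤ 2) (hχ : ψ.comp φ = χ) (h : ∀ i, χ.gap i ≤ 3)
    {s : compPow P.O l ⟶ compPow P.O m} {t : compPow P.O m ⟶ compPow P.O n}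
    (hs : Functor.whiskerLeft (gamma m) s ≫ ranι (circPow P.O m) =
      restrict ψ (ranι (circPow P.O l)) ≫ P.opAlong ψ hψ)
    (ht : Functor.whiskerLeft (gamma n) t ≫ ranι (circPow P.O n) =
      restrict φ (ranι (circPow P.O m)) ≫ P.opAlong φ hφ) (X : LevelTree n) :
    (Functor.whiskerLeft (gamma n) (s ≫ t) ≫ ranι (circPow P.O n)).app X =
      P.compPowOp χ h X := by
  subst hχ
  rw [Functor.whiskerLeft_comp, Category.assoc, ht, ← Category.assoc, whiskerLeft_restrict, hs]
  refine (PreCooperad.restrict_comp_app ψ φ _ _ _ X).trans ?_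
  exact congrArg ((restrict (ψ.comp φ) (ranι (circPow P.O l))).app X ≫ ·)
    (P.opAlong_comp_opAlong ψ φ hψ hφ h X)

/-- By the universal property it suffices to compare after `ranι`, where both composites equal
`compPowOp` of the common map. The gap bound is required for one factorisation only and transfers
along `hχ`. -/
theorem comp_eq_comp {m' : ℕ} {ψ : EndMap l m} {φ : EndMap m n} {ψ' : EndMap l m'}
    {φ' : EndMap m' n} (hψ : ∀ i, ψ.gap i ≤ 2) (hφ : ∀ i, φ.gap i ≤ 2) (hψ' : ∀ i, ψ'.gap i ≤ 2)
    (hφ' : ∀ i, φ'.gap i ≤ 2) (hχ : ψ.comp φ = ψ'.comp φ') (h : ∀ i, (ψ'.comp φ').gap i ≤ 3)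
    {s : compPow P.O l ⟶ compPow P.O m} {t : compPow P.O m ⟶ compPow P.O n}
    {s' : compPow P.O l ⟶ compPow P.O m'} {t' : compPow P.O m' ⟶ compPow P.O n}
    (hs : Functor.whiskerLeft (gamma m) s ≫ ranι (circPow P.O m) =
      restrict ψ (ranι (circPow P.O l)) ≫ P.opAlong ψ hψ)
    (ht : Functor.whiskerLeft (gamma n) t ≫ ranι (circPow P.O n) =
      restrict φ (ranι (circPow P.O m)) ≫ P.opAlong φ hφ)
    (hs' : Functor.whiskerLeft (gamma m') s' ≫ ranι (circPow P.O m') =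
      restrict ψ' (ranι (circPow P.O l)) ≫ P.opAlong ψ' hψ')
    (ht' : Functor.whiskerLeft (gamma n) t' ≫ ranι (circPow P.O n) =
      restrict φ' (ranι (circPow P.O m')) ≫ P.opAlong φ' hφ') : s ≫ t = s' ≫ t' :=
  ran_hom_ext (NatTrans.ext (funext fun X => (P.comp_fac hψ hφ hχ h hs ht X).trans
    (P.comp_fac hψ' hφ' rfl h hs' ht' X).symm))

theorem compPowOp_id (h : ∀ i, (EndMap.id n).gap i ≤ 3) (X : LevelTree n) :
    P.compPowOp (EndMap.id n) h X = (ranι (circPow P.O n)).app X := by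
  have h' : ∀ i, (EndMap.id n).gap i ≤ 2 := fun i => (EndMap.gap_id i).trans_le one_le_two
  have h₁ : (P.glueMap (EndMap.id n) X fun v => (P.localOp₃ _ (h v.1)).app (X.part _ v)) =
      𝟙 ((circPow P.O n).obj X) := by
    refine Eq.trans (congrArg (P.glueMap (EndMap.id n) X) (funext fun v => ?_)) (P.opAlong_id h' X)
    rw [P.localOp₃_eq _ (h' v.1)]
  exact (congrArg₂ (· ≫ ·) (restrict_id (ranι (circPow P.O n)) X) h₁).trans (Category.comp_id _)

theorem comp_eq_id {ψ : EndMap n m} {φ : EndMap m n} (hψ : ∀ i, ψ.gap i ≤ 2)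
    (hφ : ∀ i, φ.gap i ≤ 2) (hχ : ψ.comp φ = EndMap.id n)
    {s : compPow P.O n ⟶ compPow P.O m} {t : compPow P.O m ⟶ compPow P.O n}
    (hs : Functor.whiskerLeft (gamma m) s ≫ ranι (circPow P.O m) =
      restrict ψ (ranι (circPow P.O n)) ≫ P.opAlong ψ hψ)
    (ht : Functor.whiskerLeft (gamma n) t ≫ ranι (circPow P.O n) =
      restrict φ (ranι (circPow P.O m)) ≫ P.opAlong φ hφ) : s ≫ t = 𝟙 _ := by
  have h : ∀ i, (EndMap.id n).gap i ≤ 3 := fun i => (EndMap.gap_id i).trans_le (by omega)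
  refine ran_hom_ext (NatTrans.ext (funext fun X => (P.comp_fac hψ hφ hχ h hs ht X).trans
    ((P.compPowOp_id h X).trans ?_)))
  exact (Category.id_comp _).symm

theorem isCoaugmentedCosimplicialWithTwoExtra :
    IsCoaugmentedCosimplicialWithTwoExtra (fun k => compPow P.O (k + 1))
      (fun k (i : Fin (k + 1)) => P.coface i) (fun k (j : Fin (k + 2)) => P.codegen j) where
  d_comp_d _ i j h := P.comp_eq_comp _ _ _ _ (EndMap.face_comp_face i j h)
    (EndMap.gap_face_comp_face _ _) (P.coface_fac i) (P.coface_fac j.succ) (P.coface_fac j)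
    (P.coface_fac i.castSucc)
  s_comp_s _ i j h := P.comp_eq_comp _ _ _ _ (EndMap.degen_comp_degen i j h)
    (EndMap.gap_degen_comp_degen _ _) (P.codegen_fac j.succ) (P.codegen_fac i)
    (P.codegen_fac i.castSucc) (P.codegen_fac j)
  d_comp_s_castSucc _ i := P.comp_eq_id _ _ (EndMap.face_comp_degen_castSucc i) (P.coface_fac i)
    (P.codegen_fac i.castSucc)
  d_comp_s_succ _ i := P.comp_eq_id _ _ (EndMap.face_comp_degen_succ i) (P.coface_fac i)
    (P.codegen_fac i.succ)
  -- In this and the next identity the gap bound is taken from the side where the degeneracy comes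
  -- first.
  d_comp_s_of_lt _ i j h := P.comp_eq_comp _ _ _ _ (EndMap.face_comp_degen_of_le i j h)
    (EndMap.gap_degen_comp_face _ _) (P.coface_fac i.succ) (P.codegen_fac j.castSucc)
    (P.codegen_fac j) (P.coface_fac i)
  d_comp_s_of_gt _ i j h := P.comp_eq_comp _ _ _ _ (EndMap.face_comp_degen_of_lt i j h)
    (EndMap.gap_degen_comp_face _ _) (P.coface_fac i.castSucc) (P.codegen_fac j.succ)
    (P.codegen_fac j) (P.coface_fac i)

end Cooperad

end Kan

end WreathCooperad

end

/-! ### The theorem -/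

theorem mainTheorem1 {C : Type u} [Category.{v} C] [MonoidalCategory C] [SymmetricCategory C]
    [HasLimitsOfSize.{0, 0} C] (P : WreathCooperad.Cooperad C) :
    -- the cosimplicial identities
    WreathCooperad.IsCoaugmentedCosimplicialWithTwoExtra
      (fun k => WreathCooperad.compPow P.O (k + 1))
      (fun k (i : Fin (k + 1)) => P.coface i)
      (fun k (j : Fin (k + 2)) => P.codegen j) ∧
    -- the first term is `O`, and the first coface is the map `O ⟶ O ∘̂ O` corresponding to `Δ`
    IsIso (WreathCooperad.ranLift (WreathCooperad.unitHom P.O)) ∧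
    WreathCooperad.ranLift (WreathCooperad.unitHom P.O) ≫ P.coface (0 : Fin 1) =
      WreathCooperad.ranLift P.Δ ∧
    -- the universal properties of the cofaces and the codegeneracies
    (∀ (n : ℕ) (k : Fin n)
      (t : WreathCooperad.compPow P.O n ⟶ WreathCooperad.compPow P.O (n + 1)),
      t = P.coface k ↔
        Functor.whiskerLeft (WreathCooperad.LevelTree.gamma (n + 1)) t ≫
            WreathCooperad.ranι (WreathCooperad.circPow P.O (n + 1)) =
          WreathCooperad.restrict (WreathCooperad.EndMap.face k)
            (WreathCooperad.ranι (WreathCooperad.circPow P.O n)) ≫ P.treeCoface k) ∧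
    (∀ (n : ℕ) (i : Fin (n + 1))
      (t : WreathCooperad.compPow P.O (n + 1) ⟶ WreathCooperad.compPow P.O n),
      t = P.codegen i ↔
        Functor.whiskerLeft (WreathCooperad.LevelTree.gamma n) t ≫
            WreathCooperad.ranι (WreathCooperad.circPow P.O n) =
          WreathCooperad.restrict (WreathCooperad.EndMap.degen i)
            (WreathCooperad.ranι (WreathCooperad.circPow P.O (n + 1))) ≫ P.treeCodegen i) := by
  refine ⟨P.isCoaugmentedCosimplicialWithTwoExtra, ?_, ?_, fun n k t => ?_, fun n i t => ?_⟩
  · have := WreathCooperad.isIso_unitHom P.O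
    exact WreathCooperad.isIso_ranLift _
  · refine WreathCooperad.ran_hom_ext ?_
    rw [Functor.whiskerLeft_comp, Category.assoc, P.coface_fac, ← Category.assoc,
      WreathCooperad.whiskerLeft_restrict, WreathCooperad.ranLift_fac, WreathCooperad.ranLift_fac]
    -- The face in question is a map from `{0 < 1}` to `{0 < 1 < 2}`, so it contracts the whole tree
    -- to one vertex; the operation applied there is the one for two levels, which is `Δ`.
    exact P.restrict_unitHom_opAlong _ _ le_rfl
  · refine ⟨fun h => h ▸ P.coface_fac k, fun h => WreathCooperad.ran_hom_ext ?_⟩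
    exact h.trans (P.coface_fac k).symm
  · refine ⟨fun h => h ▸ P.codegen_fac i, fun h => WreathCooperad.ran_hom_ext ?_⟩
    exact h.trans (P.codegen_fac i).symm
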